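/- Work over $\mathbb F_2$; all tensor products are over $\mathbb F_2$. For a simplicial module $A$ let $N(A)$ be its normalized chain complex, $N_n(A)=A_n/\sum_k s_k(A_{n-1})$ with $\partial=\sum_k(-1)^kd_k$. For a cosimplicial module $W$ let $C^k(W)=W^k/\sum_{i=1}^{k}d^i(W^{k-1})$ with differential $\sum_i(-1)^id^i$. For a cosimplicial simplicial module $V$ let $CNV$ be the bicomplex with $(CNV)_{-k,t}=C^k(N_tV)$, and for $0\le\ell\le\infty$ let $T_\ell CNV$ be the quotient of the product total complex by the columns $-k$ with $k>\ell$, so that $(T_\ell CNV)_m=\prod_{k\le\ell}C^k(N_{m+k}V)$ for $m\in\mathbb Z$. Let $\mathrm{Tot}_\ell V$ be the simplicial module whose $q$-simplices are the maps of cosimplicial simplicial sets $f:\mathrm{sk}_\ell\Delta^\bullet\times\Delta^q\to V$, and let $U\otimes V$ be the levelwise tensor product. Let $\nabla:N(A)\otimes N(B)\to N(A\otimes B)$ denote the shuffle map. Let $\iota_k\wedge\iota_q$ denote $\nabla(\iota_k\otimes\iota_q)$, where $\iota_k$ is the top simplex of $\Delta^k$, and let $\phi_\ell:N(\mathrm{Tot}_\ell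 V)\to T_\ell CNV$ be Bousfield's map $\phi_\ell(f)=\prod_{k\le\ell}f(\iota_k\wedge\iota_q)$ for $f\in(\mathrm{Tot}_\ell V)_q$. Let $\chi:\mathrm{Tot}_\ell U\otimes\mathrm{Tot}_\ell V\to\mathrm{Tot}_\ell(U\otimes V)$ be the interchange map $\chi(f\otimes g)(\alpha,\beta)=f(\alpha,\beta)\otimes g(\alpha,\beta)$. For cosimplicial modules $W,W'$ let $AW:C^k(W)\otimes C^{k'}(W')\to C^{k+k'}(W\otimes W')$ be the Alexander–Whitney map, which sends $[y]\otimes[z]$ to $[d^{k+k'}\cdots d^{k+1}y\otimes d^{k-1}\cdots d^0z]$, where $y$ and $z$ are the unique representatives of their classes that are killed by all codegeneracies. **Theorem.** Let $U$ and $V$ be cosimplicial simplicial $\mathbb F_2$-modules and $0\le\ell\le\infty$. The maps $\phi_\ell$, the composite $$N(\mathrm{Tot}_\ell U)\otimes N(\mathrm{Tot}_\ell V)\xrightarrow{\nabla}N(\mathrm{Tot}_\ell U\otimes\mathrm{Tot}_\ell V)\xrightarrow{N\chi}N(\mathrm{Tot}_\ell(U\otimes V))$$ and the composite $$T_\ell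 CNU\otimes T_\ell CNV\to T_\ell(CNU\otimes CNV)\xrightarrow{AW}T_\ell C(NU\otimes NV)\xrightarrow{\nabla}T_\ell CN(U\otimes V)$$ are chain maps, and for all $m,n\in\mathbb Z$ the maps induced in homology make the following square commute, where $H(\mathrm{Tot}_\ell V)$ denotes $H(N(\mathrm{Tot}_\ell V))$: $$\begin{array}{ccc}H_m(\mathrm{Tot}_\ell U)\otimes H_n(\mathrm{Tot}_\ell V)&\xrightarrow{\ \phi_\ell\otimes\phi_\ell\ }&H_m(T_\ell CNU)\otimes H_n(T_\ell CNV)\\[2pt]{\scriptstyle H(\chi\nabla)}\downarrow&&\downarrow{\scriptstyle H(\nabla AW)}\\[2pt]H_{m+n}(\mathrm{Tot}_\ell(U\otimes V))&\xrightarrow{\ \phi_\ell\ }&H_{m+n}(T_\ell CN(U\otimes V))\end{array}$$ -/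

import Mathlib

universe u

open CategoryTheory Opposite Simplicial

noncomputable section

namespace TotProd

/-! ### Chain complexes over `F₂` and their homology -/

/-- A `ℤ`-graded chain complex of `F₂`-vector spaces. Its part in degree `m` is the subspace `deg m`
of an ambient space; only these homogeneous parts and the restrictions `deg m → deg (m - 1)` of `d`
are meaningful. -/
structure Cpx where
  carrier : ModuleCat.{u} (ZMod 2)
  deg : ℤ → Submodule (ZMod 2) carrier
  d : carrier →ₗ[ZMod 2] carrier
  d_mem : ∀ (m : ℤ) (x : carrier), x ∈ deg m → d x ∈ deg (m - 1)
  d_d : ∀ x : carrier, d (d x) = 0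

namespace Cpx

/-- The `m`-cycles. -/
def cycles (K : Cpx.{u}) (m : ℤ) : Submodule (ZMod 2) K.carrier := K.deg m ⊓ LinearMap.ker K.d

/-- The `m`-boundaries. -/
def boundaries (K : Cpx.{u}) (m : ℤ) : Submodule (ZMod 2) K.carrier := (K.deg (m + 1)).map K.d

/-- The homology `H_m(K)`. -/
abbrev H (K : Cpx.{u}) (m : ℤ) : Type u :=
  ↥(K.cycles m) ⧸ (K.boundaries m).submoduleOf (K.cycles m)

end Cpx

/-- A bilinear map that vanishes on `p × N` and on `M × q` induces one on the quotients. -/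
def quotBilin {M N P : Type u} [AddCommGroup M] [Module (ZMod 2) M] [AddCommGroup N]
    [Module (ZMod 2) N] [AddCommGroup P] [Module (ZMod 2) P]
    (p : Submodule (ZMod 2) M) (q : Submodule (ZMod 2) N)
    (B : M →ₗ[ZMod 2] N →ₗ[ZMod 2] P)
    (hp : ∀ x ∈ p, ∀ y, B x y = 0) (hq : ∀ x, ∀ y ∈ q, B x y = 0) :
    (M ⧸ p) →ₗ[ZMod 2] (N ⧸ q) →ₗ[ZMod 2] P :=
  p.liftQ
    { toFun := fun x => q.liftQ (B x) (fun y hy => hq x y hy)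
      map_add' := fun x x' => by
        ext y
        change B (x + x') y = B x y + B x' y
        simp
      map_smul' := fun c x => by
        ext y
        change B (c • x) y = c • B x y
        simp }
    (fun x hx => by
      rw [LinearMap.mem_ker]
      ext y
      exact hp x hx y)

@[simp]
lemma quotBilin_mk {M N P : Type u} [AddCommGroup M] [Module (ZMod 2) M] [AddCommGroup N]
    [Module (ZMod 2) N] [AddCommGroup P] [Module (ZMod 2) P]
    (p : Submodule (ZMod 2) M) (q : Submodule (ZMod 2) N)
    (B : M →ₗ[ZMod 2] N →ₗ[ZMod 2] P)
    (hp : ∀ x ∈ p, ∀ y, B x y = 0) (hq : ∀ x, ∀ y ∈ q, B x y = 0) (x : M) (y : N) :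
    quotBilin p q B hp hq (Submodule.Quotient.mk x) (Submodule.Quotient.mk y) = B x y := rfl

/-- `f` is a chain map `K → L`. -/
structure IsChainMap (K L : Cpx.{u}) (f : K.carrier →ₗ[ZMod 2] L.carrier) : Prop where
  mem : ∀ (m : ℤ) (x : K.carrier), x ∈ K.deg m → f x ∈ L.deg m
  comm : ∀ (m : ℤ) (x : K.carrier), x ∈ K.deg m → f (K.d x) = L.d (f x)

/-- `B` is a chain map `K ⊗ L → M`, described as a bilinear map obeying the Leibniz rule (the sign
is immaterial over `F₂`). -/
structure IsPairing (K L M : Cpx.{u})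
    (B : K.carrier →ₗ[ZMod 2] L.carrier →ₗ[ZMod 2] M.carrier) : Prop where
  mem : ∀ (m n : ℤ) (x : K.carrier) (y : L.carrier), x ∈ K.deg m → y ∈ L.deg n →
    B x y ∈ M.deg (m + n)
  leibniz : ∀ (m n : ℤ) (x : K.carrier) (y : L.carrier), x ∈ K.deg m → y ∈ L.deg n →
    M.d (B x y) = B (K.d x) y + B x (L.d y)

/-- The map `H_m(K) → H_m(L)` induced by a chain map. -/
def IsChainMap.onH {K L : Cpx.{u}} {f : K.carrier →ₗ[ZMod 2] L.carrier} (hf : IsChainMap K L f)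
    (m : ℤ) : K.H m →ₗ[ZMod 2] L.H m :=
  Submodule.mapQ _ _
    (f.restrict (p := K.cycles m) (q := L.cycles m) (fun x hx => by
      refine ⟨hf.mem m x hx.1, ?_⟩
      have h0 : K.d x = 0 := hx.2
      change L.d (f x) = 0
      rw [← hf.comm m x hx.1, h0, map_zero]))
    (by
      rintro ⟨x, hx⟩ ⟨z, hz, hzx⟩
      exact ⟨f z, hf.mem _ z hz, by rw [← hf.comm _ z hz, hzx]; rfl⟩)

/-- The map `H_m(K) × H_n(L) → H_{m+n}(M)`, `([x], [y]) ↦ [B x y]`, induced by a chain map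
`K ⊗ L → M`. -/
def IsPairing.onH {K L M : Cpx.{u}} {B : K.carrier →ₗ[ZMod 2] L.carrier →ₗ[ZMod 2] M.carrier}
    (hB : IsPairing K L M B) (m n : ℤ) : K.H m →ₗ[ZMod 2] L.H n →ₗ[ZMod 2] M.H (m + n) :=
  quotBilin _ _
    (LinearMap.mk₂ (ZMod 2)
      (fun (x : K.cycles m) (y : L.cycles n) =>
        (Submodule.Quotient.mk ⟨B x.1 y.1, hB.mem m n _ _ x.2.1 y.2.1, by
          have hx : K.d x.1 = 0 := x.2.2
          have hy : L.d y.1 = 0 := y.2.2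
          change M.d (B x.1 y.1) = 0
          rw [hB.leibniz m n _ _ x.2.1 y.2.1, hx, hy]
          simp⟩ : M.H (m + n)))
      (fun x x' y => by
        rw [← Submodule.Quotient.mk_add]; congr 1; ext; simp)
      (fun c x y => by
        rw [← Submodule.Quotient.mk_smul]; congr 1; ext; simp)
      (fun x y y' => by
        rw [← Submodule.Quotient.mk_add]; congr 1; ext; simp)
      (fun c x y => by
        rw [← Submodule.Quotient.mk_smul]; congr 1; ext; simp))
    (by
      rintro ⟨x, hx⟩ ⟨z, hz, hzx⟩ ⟨y, hy⟩
      have hy0 : L.d y = 0 := hy.2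
      have hzx' : K.d z = x := hzx
      refine (Submodule.Quotient.mk_eq_zero _).2 ⟨B z y, ?_, ?_⟩
      · have := hB.mem _ _ z y hz hy.1
        rwa [add_right_comm] at this
      · change M.d (B z y) = B x y
        rw [hB.leibniz _ _ z y hz hy.1, hy0, hzx', map_zero, add_zero])
    (by
      rintro ⟨x, hx⟩ ⟨y, hy⟩ ⟨z, hz, hzy⟩
      have hx0 : K.d x = 0 := hx.2
      have hzy' : L.d z = y := hzy
      refine (Submodule.Quotient.mk_eq_zero _).2 ⟨B x z, ?_, ?_⟩
      · have := hB.mem _ _ x z hx.1 hz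
        rwa [← add_assoc] at this
      · change M.d (B x z) = B x y
        rw [hB.leibniz _ _ x z hx.1 hz, hx0, hzy', map_zero, LinearMap.zero_apply, zero_add])

/-! ### Simplicial and cosimplicial modules and their tensor products -/

/-- Simplicial `F₂`-modules. -/
abbrev SMod := SimplexCategoryᵒᵖ ⥤ ModuleCat.{u} (ZMod 2)

/-- Cosimplicial `F₂`-modules. -/
abbrev CMod := SimplexCategory ⥤ ModuleCat.{u} (ZMod 2)

/-- Cosimplicial simplicial `F₂`-modules. -/
abbrev CSMod := SimplexCategory ⥤ SimplexCategoryᵒᵖ ⥤ ModuleCat.{u} (ZMod 2)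

/-- The objectwise tensor product over `F₂` of two functors. -/
abbrev tens {C : Type*} [Category C] (F G : C ⥤ ModuleCat.{u} (ZMod 2)) :
    C ⥤ ModuleCat.{u} (ZMod 2) where
  obj c := ModuleCat.of (ZMod 2) (TensorProduct (ZMod 2) (F.obj c) (G.obj c))
  map f := ModuleCat.ofHom (TensorProduct.map (F.map f).hom (G.map f).hom)
  map_id c := by
    ext x
    simp
  map_comp f g := by
    ext x
    simp [TensorProduct.map_comp]

/-- The bilinear map `(a, b) ↦ a ⊗ b` into the tensor product. -/
def tm {C : Type*} [Category C] (F G : C ⥤ ModuleCat.{u} (ZMod 2)) (c : C) :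
    F.obj c →ₗ[ZMod 2] G.obj c →ₗ[ZMod 2] (tens F G).obj c :=
  TensorProduct.mk (ZMod 2) (F.obj c) (G.obj c)

/-- The tensor product of natural transformations. -/
def tensMap {C : Type*} [Category C] {F F' G G' : C ⥤ ModuleCat.{u} (ZMod 2)}
    (a : F ⟶ F') (b : G ⟶ G') : tens F G ⟶ tens F' G' where
  app c := ModuleCat.ofHom (TensorProduct.map (a.app c).hom (b.app c).hom)
  naturality c c' f := by
    refine ModuleCat.hom_ext (TensorProduct.ext' fun x y => ?_)
    exact congrArg₂ (TensorProduct.tmul (ZMod 2)) (ConcreteCategory.congr_hom (a.naturality f) x)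
      (ConcreteCategory.congr_hom (b.naturality f) y)

/-- `U ⊗ V` for cosimplicial simplicial modules: `(U ⊗ V)^p_q = U^p_q ⊗ V^p_q`. -/
abbrev CSMod.tensor (U V : CSMod.{u}) : CSMod.{u} where
  obj p := tens (U.obj p) (V.obj p)
  map f := tensMap (U.map f) (V.map f)
  map_id p := by
    refine NatTrans.ext (funext fun n => ModuleCat.hom_ext (TensorProduct.ext' fun x y => ?_))
    have h1 := ConcreteCategory.congr_hom (NatTrans.congr_app (U.map_id p) n) x
    have h2 := ConcreteCategory.congr_hom (NatTrans.congr_app (V.map_id p) n) y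
    exact congrArg₂ (TensorProduct.tmul (ZMod 2)) h1 h2
  map_comp f g := by
    refine NatTrans.ext (funext fun n => ModuleCat.hom_ext (TensorProduct.ext' fun x y => ?_))
    have h1 := ConcreteCategory.congr_hom (NatTrans.congr_app (U.map_comp f g) n) x
    have h2 := ConcreteCategory.congr_hom (NatTrans.congr_app (V.map_comp f g) n) y
    exact congrArg₂ (TensorProduct.tmul (ZMod 2)) h1 h2

/-! ### Normalization of simplicial modules -/

/-- The span of the images of the degeneracies `s_0, …, s_{n-1}` in `A_n`. -/
def degen (A : SMod.{u}) (n : ℕ) : Submodule (ZMod 2) (A.obj (op ⦋n⦌)) :=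
  match n with
  | 0 => ⊥
  | n + 1 => ⨆ k : Fin (n + 1), LinearMap.range (A.map (SimplexCategory.σ k).op).hom

lemma σ_mem_degen (A : SMod.{u}) {n : ℕ} (k : Fin (n + 1)) (x : A.obj (op ⦋n⦌)) :
    (A.map (SimplexCategory.σ k).op).hom x ∈ degen A (n + 1) :=
  (le_iSup (fun k : Fin (n + 1) => LinearMap.range (A.map (SimplexCategory.σ k).op).hom) k) ⟨x, rfl⟩

lemma degen_le {A : SMod.{u}} {n : ℕ} {S : Submodule (ZMod 2) (A.obj (op ⦋n + 1⦌))}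
    (h : ∀ (k : Fin (n + 1)) (x : A.obj (op ⦋n⦌)), (A.map (SimplexCategory.σ k).op).hom x ∈ S) : degen A (n + 1) ≤ S := by
  refine iSup_le fun k => ?_
  rintro _ ⟨x, rfl⟩
  exact h k x

lemma map_mem_degen (A : SMod.{u}) {n : ℕ} {m : SimplexCategory} (θ : ⦋n + 1⦌ ⟶ m)
    (j : Fin (n + 1)) (h : θ.toOrderHom j.castSucc = θ.toOrderHom j.succ) (x : A.obj (op m)) :
    (A.map θ.op).hom x ∈ degen A (n + 1) := by
  obtain ⟨θ', rfl⟩ := SimplexCategory.eq_σ_comp_of_not_injective' θ j h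
  rw [op_comp, A.map_comp]
  exact σ_mem_degen A j _

lemma degen_map {A B : SMod.{u}} (f : A ⟶ B) (n : ℕ) :
    degen A n ≤ (degen B n).comap (f.app (op ⦋n⦌)).hom := by
  cases n with
  | zero => exact bot_le
  | succ n =>
    refine degen_le fun k x => ?_
    have h : (f.app (op ⦋n + 1⦌)).hom ((A.map (SimplexCategory.σ k).op).hom x) = (B.map (SimplexCategory.σ k).op).hom ((f.app (op ⦋n⦌)).hom x) :=
      ConcreteCategory.congr_hom (SimplicialObject.σ_naturality f k) x
    rw [Submodule.mem_comap, h]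
    exact σ_mem_degen B k _

/-- `N_n(A)`, the quotient of `A_n` by the degenerate elements. -/
abbrev NObj (A : SMod.{u}) (n : ℕ) : ModuleCat.{u} (ZMod 2) :=
  ModuleCat.of (ZMod 2) (A.obj (op ⦋n⦌) ⧸ degen A n)

/-- The alternating sum `∂ = ∑ (-1)^k d_k : A_{n+1} → A_n`. -/
abbrev bdry (A : SMod.{u}) (n : ℕ) : A.obj (op ⦋n + 1⦌) →ₗ[ZMod 2] A.obj (op ⦋n⦌) :=
  (AlgebraicTopology.AlternatingFaceMapComplex.objD A n).hom

lemma bdry_apply (A : SMod.{u}) (n : ℕ) (x : A.obj (op ⦋n + 1⦌)) :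
    bdry A n x = ∑ i : Fin (n + 2), (-1 : ℤ) ^ (i : ℕ) • (A.map (SimplexCategory.δ i).op).hom x := by
  simp [bdry, AlgebraicTopology.AlternatingFaceMapComplex.objD, ModuleCat.hom_sum]
  rfl

lemma bdry_bdry (A : SMod.{u}) (n : ℕ) (x : A.obj (op ⦋n + 2⦌)) : bdry A n (bdry A (n + 1) x) = 0 :=
  ConcreteCategory.congr_hom (AlgebraicTopology.AlternatingFaceMapComplex.d_squared A n) x

lemma bdry_naturality {A B : SMod.{u}} (f : A ⟶ B) (n : ℕ) (x : A.obj (op ⦋n + 1⦌)) :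
    (f.app (op ⦋n⦌)).hom (bdry A n x) = bdry B n ((f.app (op ⦋n + 1⦌)).hom x) := by
  rw [bdry_apply, bdry_apply, map_sum]
  refine Finset.sum_congr rfl fun i _ => ?_
  rw [map_zsmul]
  exact congrArg _ (ConcreteCategory.congr_hom (SimplicialObject.δ_naturality f i) x)

lemma bdry_degen (A : SMod.{u}) (n : ℕ) : degen A (n + 1) ≤ (degen A n).comap (bdry A n) := by
  refine degen_le fun k x => ?_
  rw [Submodule.mem_comap, bdry_apply]
  have hne : k.castSucc ≠ k.succ := (Fin.castSucc_lt_succ).ne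
  rw [← Finset.add_sum_erase _ _ (Finset.mem_univ k.castSucc),
    ← Finset.add_sum_erase _ _ (Finset.mem_erase.2 ⟨hne.symm, Finset.mem_univ k.succ⟩), ← add_assoc]
  have h1 : (A.map (SimplexCategory.δ k.castSucc).op).hom ((A.map (SimplexCategory.σ k).op).hom x) = x :=
    ConcreteCategory.congr_hom (SimplicialObject.δ_comp_σ_self (X := A) (i := k)) x
  have h2 : (A.map (SimplexCategory.δ k.succ).op).hom ((A.map (SimplexCategory.σ k).op).hom x) = x :=
    ConcreteCategory.congr_hom (SimplicialObject.δ_comp_σ_succ (X := A) (i := k)) x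
  refine add_mem ?_ (Submodule.sum_mem _ fun i hi => ?_)
  · rw [h1, h2]
    simp [pow_succ]
  · refine zsmul_mem ?_ _
    simp only [Finset.mem_erase, Finset.mem_univ, and_true] at hi
    cases n with
    | zero =>
      exfalso
      obtain ⟨ha, hb⟩ := hi
      fin_cases k
      fin_cases i
      · exact hb rfl
      · exact ha rfl
    | succ n =>
      rcases lt_or_ge i k.castSucc with h | h
      · obtain ⟨k', rfl⟩ : ∃ k' : Fin (n + 1), k = k'.succ :=
          ⟨k.pred (by rintro rfl; simp at h), by simp⟩
        obtain ⟨i', rfl⟩ : ∃ i' : Fin (n + 2), i = i'.castSucc :=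
          ⟨i.castPred (by rintro rfl; exact absurd h (not_lt.2 (Fin.le_last _))), by simp⟩
        have h3 := ConcreteCategory.congr_hom
          (SimplicialObject.δ_comp_σ_of_le (X := A) (i := i') (j := k') (by
            simp only [Fin.lt_def, Fin.le_def, Fin.val_castSucc, Fin.val_succ] at h ⊢; omega)) x
        change (A.map (SimplexCategory.δ i'.castSucc).op).hom ((A.map (SimplexCategory.σ k'.succ).op).hom x) = (A.map (SimplexCategory.σ k').op).hom ((A.map (SimplexCategory.δ i').op).hom x) at h3
        rw [h3]
        exact σ_mem_degen A _ _
      · have hlt : k.succ < i := by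
          have e1 : (i : ℕ) ≠ k := fun e => hi.2 (Fin.ext e)
          have e2 : (i : ℕ) ≠ k + 1 := fun e => hi.1 (Fin.ext e)
          simp only [Fin.lt_def, Fin.le_def, Fin.val_castSucc, Fin.val_succ] at h ⊢
          omega
        have h3 := ConcreteCategory.congr_hom (SimplicialObject.δ_comp_σ_of_gt' (X := A) hlt) x
        erw [h3]
        exact σ_mem_degen A _ _

/-- `N_n` as a functor. -/
abbrev NFun (n : ℕ) : SMod.{u} ⥤ ModuleCat.{u} (ZMod 2) where
  obj A := NObj A n
  map f := ModuleCat.ofHom (Submodule.mapQ _ _ (f.app (op ⦋n⦌)).hom (degen_map f n))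
  map_id A := by
    refine ModuleCat.hom_ext (Submodule.linearMap_qext _ (LinearMap.ext fun x => rfl))
  map_comp f g := by
    refine ModuleCat.hom_ext (Submodule.linearMap_qext _ (LinearMap.ext fun x => rfl))

/-- The differential `N_{n+1}(A) → N_n(A)`. -/
def Nd (A : SMod.{u}) (n : ℕ) : NObj A (n + 1) →ₗ[ZMod 2] NObj A n :=
  Submodule.mapQ _ _ (bdry A n) (bdry_degen A n)

lemma Nd_Nd (A : SMod.{u}) (n : ℕ) (x : NObj A (n + 2)) : Nd A n (Nd A (n + 1) x) = 0 := by
  obtain ⟨x, rfl⟩ := Submodule.Quotient.mk_surjective _ x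
  exact congrArg Submodule.Quotient.mk (bdry_bdry A n x)

/-- The differential `N_{n+1} → N_n` as a natural transformation. -/
def NBdry (n : ℕ) : NFun.{u} (n + 1) ⟶ NFun.{u} n where
  app A := ModuleCat.ofHom (Nd A n)
  naturality A B f := by
    refine ModuleCat.hom_ext (Submodule.linearMap_qext _ (LinearMap.ext fun x => ?_))
    exact congrArg Submodule.Quotient.mk (bdry_naturality f n x).symm

/-- The normalized chain complex `N(A)`; an element of the ambient space is a family
`x_n ∈ N_n(A)`. -/
abbrev N (A : SMod.{u}) : Cpx.{u} where
  carrier := ModuleCat.of (ZMod 2) (∀ n : ℕ, NObj A n)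
  deg m :=
    { carrier := {x | ∀ n : ℕ, (n : ℤ) ≠ m → x n = 0}
      add_mem' := fun {x y} hx hy n hn => by
        rw [Pi.add_apply, hx n hn, hy n hn, add_zero]
      zero_mem' := fun n _ => rfl
      smul_mem' := fun c x hx n hn => by
        rw [Pi.smul_apply, hx n hn, smul_zero] }
  d := LinearMap.pi fun n => Nd A n ∘ₗ LinearMap.proj (n + 1)
  d_mem m x hx n hn := by
    have h : x (n + 1) = 0 := hx (n + 1) (by push_cast; omega)
    change Nd A n (x (n + 1)) = 0
    rw [h, map_zero]
  d_d x := funext fun n => Nd_Nd A n (x (n + 2))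

/-! ### Conormalization of cosimplicial modules -/

/-- The span of the images of the cofaces `d^1, …, d^k` in `W^k`. -/
def coim (W : CMod.{u}) (k : ℕ) : Submodule (ZMod 2) (W.obj ⦋k⦌) :=
  match k with
  | 0 => ⊥
  | k + 1 => ⨆ i : Fin (k + 1), LinearMap.range (W.map (SimplexCategory.δ i.succ)).hom

lemma δ_mem_coim (W : CMod.{u}) {k : ℕ} (i : Fin (k + 1)) (x : W.obj ⦋k⦌) :
    (W.map (SimplexCategory.δ i.succ)).hom x ∈ coim W (k + 1) :=
  (le_iSup (fun i : Fin (k + 1) => LinearMap.range (W.map (SimplexCategory.δ i.succ)).hom) i) ⟨x, rfl⟩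

lemma coim_le {W : CMod.{u}} {k : ℕ} {S : Submodule (ZMod 2) (W.obj ⦋k + 1⦌)}
    (h : ∀ (i : Fin (k + 1)) (x : W.obj ⦋k⦌), (W.map (SimplexCategory.δ i.succ)).hom x ∈ S) : coim W (k + 1) ≤ S := by
  refine iSup_le fun i => ?_
  rintro _ ⟨x, rfl⟩
  exact h i x

lemma coim_map {W W' : CMod.{u}} (f : W ⟶ W') (k : ℕ) :
    coim W k ≤ (coim W' k).comap (f.app ⦋k⦌).hom := by
  cases k with
  | zero => exact bot_le
  | succ k =>
    refine coim_le fun i x => ?_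
    have h : (f.app ⦋k + 1⦌).hom ((W.map (SimplexCategory.δ i.succ)).hom x) = (W'.map (SimplexCategory.δ i.succ)).hom ((f.app ⦋k⦌).hom x) :=
      ConcreteCategory.congr_hom (CosimplicialObject.δ_naturality f i.succ) x
    rw [Submodule.mem_comap, h]
    exact δ_mem_coim W' i _

/-- `C^k(W)`, the quotient of `W^k` by the images of `d^1, …, d^k`. -/
abbrev CObj (W : CMod.{u}) (k : ℕ) : ModuleCat.{u} (ZMod 2) :=
  ModuleCat.of (ZMod 2) (W.obj ⦋k⦌ ⧸ coim W k)

/-- The alternating sum `∑ (-1)^i d^i : W^k → W^{k+1}`. -/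
abbrev cobdry (W : CMod.{u}) (k : ℕ) : W.obj ⦋k⦌ →ₗ[ZMod 2] W.obj ⦋k + 1⦌ :=
  (AlgebraicTopology.AlternatingCofaceMapComplex.objD W k).hom

lemma cobdry_apply (W : CMod.{u}) (k : ℕ) (x : W.obj ⦋k⦌) :
    cobdry W k x = ∑ i : Fin (k + 2), (-1 : ℤ) ^ (i : ℕ) • (W.map (SimplexCategory.δ i)).hom x := by
  simp [cobdry, AlgebraicTopology.AlternatingCofaceMapComplex.objD, ModuleCat.hom_sum]
  rfl

lemma cobdry_cobdry (W : CMod.{u}) (k : ℕ) (x : W.obj ⦋k⦌) :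
    cobdry W (k + 1) (cobdry W k x) = 0 :=
  ConcreteCategory.congr_hom (AlgebraicTopology.AlternatingCofaceMapComplex.d_squared W k) x

lemma cobdry_naturality {W W' : CMod.{u}} (f : W ⟶ W') (k : ℕ) (x : W.obj ⦋k⦌) :
    (f.app ⦋k + 1⦌).hom (cobdry W k x) = cobdry W' k ((f.app ⦋k⦌).hom x) := by
  rw [cobdry_apply, cobdry_apply, map_sum]
  refine Finset.sum_congr rfl fun i _ => ?_
  rw [map_zsmul]
  exact congrArg _ (ConcreteCategory.congr_hom (CosimplicialObject.δ_naturality f i) x)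

lemma cobdry_coim (W : CMod.{u}) (k : ℕ) :
    coim W k ≤ (coim W (k + 1)).comap (cobdry W k) := by
  cases k with
  | zero => exact bot_le
  | succ k =>
    refine coim_le fun i x => ?_
    rw [Submodule.mem_comap, cobdry_apply, Fin.sum_univ_succ]
    refine add_mem (zsmul_mem ?_ _) (Submodule.sum_mem _ fun j _ => zsmul_mem ?_ _)
    · have h := ConcreteCategory.congr_hom (CosimplicialObject.δ_comp_δ (X := W) (Fin.zero_le i.succ)) x
      change (W.map (SimplexCategory.δ i.succ.succ)).hom ((W.map (SimplexCategory.δ 0)).hom x) = (W.map (SimplexCategory.δ 0)).hom ((W.map (SimplexCategory.δ i.succ)).hom x) at h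
      rw [← h]
      exact δ_mem_coim W _ _
    · exact δ_mem_coim W _ _

/-- The functor `C^k` on morphisms. -/
def CMap {W W' : CMod.{u}} (f : W ⟶ W') (k : ℕ) : CObj W k →ₗ[ZMod 2] CObj W' k :=
  Submodule.mapQ _ _ (f.app ⦋k⦌).hom (coim_map f k)

/-- The differential `C^k(W) → C^{k+1}(W)`. -/
def CBdry (W : CMod.{u}) (k : ℕ) : CObj W k →ₗ[ZMod 2] CObj W (k + 1) :=
  Submodule.mapQ _ _ (cobdry W k) (cobdry_coim W k)

/-- The elements of `W^k` that are killed by all codegeneracies. -/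
def codegKer (W : CMod.{u}) (k : ℕ) : Submodule (ZMod 2) (W.obj ⦋k⦌) :=
  match k with
  | 0 => ⊤
  | k + 1 => ⨅ i : Fin (k + 1), LinearMap.ker (W.map (SimplexCategory.σ i)).hom

lemma mem_codegKer {W : CMod.{u}} {k : ℕ} {x : W.obj ⦋k + 1⦌} :
    x ∈ codegKer W (k + 1) ↔ ∀ i : Fin (k + 1), (W.map (SimplexCategory.σ i)).hom x = 0 := by
  simp [codegKer]

lemma σ_δ_succ (W : CMod.{u}) {k : ℕ} (i : Fin (k + 1)) (x : W.obj ⦋k⦌) :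
    (W.map (SimplexCategory.σ i)).hom ((W.map (SimplexCategory.δ i.succ)).hom x) = x :=
  ConcreteCategory.congr_hom (CosimplicialObject.δ_comp_σ_succ (X := W) (i := i)) x

lemma δ_σ_δ (W : CMod.{u}) {k : ℕ} (i j : Fin (k + 1)) (h : j < i) (x : W.obj ⦋k⦌) :
    ∃ y, (W.map (SimplexCategory.δ j.succ)).hom ((W.map (SimplexCategory.σ j)).hom ((W.map (SimplexCategory.δ i.succ)).hom x)) = (W.map (SimplexCategory.δ i.succ)).hom y := by
  cases k with
  | zero => exact absurd h (by fin_cases i; fin_cases j; simp)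
  | succ n =>
    obtain ⟨i, rfl⟩ : ∃ i' : Fin (n + 1), i = i'.succ :=
      ⟨i.pred (by rintro rfl; simp at h), by simp⟩
    obtain ⟨j, rfl⟩ : ∃ j' : Fin (n + 1), j = j'.castSucc :=
      ⟨j.castPred (by rintro rfl; exact absurd h (not_lt.2 (Fin.le_last _))), by simp⟩
    refine ⟨(W.map (SimplexCategory.δ j.succ)).hom ((W.map (SimplexCategory.σ j)).hom x), ?_⟩
    have h1 := ConcreteCategory.congr_hom (CosimplicialObject.δ_comp_σ_of_gt (X := W) (i := i.succ) (j := j) h) x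
    have h2 := ConcreteCategory.congr_hom (CosimplicialObject.δ_comp_δ (X := W) (i := j.succ) (j := i.succ)
      (by simp only [Fin.lt_def, Fin.le_def, Fin.val_castSucc, Fin.val_succ] at h ⊢; omega))
      ((W.map (SimplexCategory.σ j)).hom x)
    change (W.map (SimplexCategory.σ j.castSucc)).hom ((W.map (SimplexCategory.δ i.succ.succ)).hom x) = (W.map (SimplexCategory.δ i.succ)).hom ((W.map (SimplexCategory.σ j)).hom x) at h1
    change (W.map (SimplexCategory.δ i.succ.succ)).hom ((W.map (SimplexCategory.δ j.succ)).hom ((W.map (SimplexCategory.σ j)).hom x)) =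
      (W.map (SimplexCategory.δ j.succ.castSucc)).hom ((W.map (SimplexCategory.δ i.succ)).hom ((W.map (SimplexCategory.σ j)).hom x)) at h2
    rw [h1, h2, Fin.succ_castSucc]

lemma σ_δ_σ (W : CMod.{u}) {k : ℕ} (i j : Fin (k + 1)) (h : i < j) (x : W.obj ⦋k + 1⦌)
    (hx : (W.map (SimplexCategory.σ i)).hom x = 0) : (W.map (SimplexCategory.σ i)).hom ((W.map (SimplexCategory.δ j.succ)).hom ((W.map (SimplexCategory.σ j)).hom x)) = 0 := by
  cases k with
  | zero => exact absurd h (by fin_cases i; fin_cases j; simp)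
  | succ n =>
    obtain ⟨j, rfl⟩ : ∃ j' : Fin (n + 1), j = j'.succ :=
      ⟨j.pred (by rintro rfl; simp at h), by simp⟩
    obtain ⟨i, rfl⟩ : ∃ i' : Fin (n + 1), i = i'.castSucc :=
      ⟨i.castPred (by rintro rfl; exact absurd h (not_lt.2 (Fin.le_last _))), by simp⟩
    have h1 := ConcreteCategory.congr_hom (CosimplicialObject.δ_comp_σ_of_gt (X := W) (i := j.succ) (j := i) h)
      ((W.map (SimplexCategory.σ j.succ)).hom x)
    have h2 := ConcreteCategory.congr_hom (CosimplicialObject.σ_comp_σ (X := W) (i := i) (j := j)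
      (by simp only [Fin.lt_def, Fin.le_def, Fin.val_castSucc, Fin.val_succ] at h ⊢; omega)) x
    change (W.map (SimplexCategory.σ i.castSucc)).hom ((W.map (SimplexCategory.δ j.succ.succ)).hom ((W.map (SimplexCategory.σ j.succ)).hom x)) =
      (W.map (SimplexCategory.δ j.succ)).hom ((W.map (SimplexCategory.σ i)).hom ((W.map (SimplexCategory.σ j.succ)).hom x)) at h1
    change (W.map (SimplexCategory.σ j)).hom ((W.map (SimplexCategory.σ i.castSucc)).hom x) = (W.map (SimplexCategory.σ i)).hom ((W.map (SimplexCategory.σ j.succ)).hom x) at h2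
    rw [h1, ← h2, hx, map_zero, map_zero]

lemma exists_projector (W : CMod.{u}) (k j : ℕ) :
    ∃ E : W.obj ⦋k + 1⦌ →ₗ[ZMod 2] W.obj ⦋k + 1⦌,
      (∀ y ∈ codegKer W (k + 1), E y = y) ∧ (∀ y, y - E y ∈ coim W (k + 1)) ∧
      (∀ i : Fin (k + 1), (i : ℕ) < j → ∀ y, (W.map (SimplexCategory.σ i)).hom (E y) = 0) ∧
      (∀ i : Fin (k + 1), (i : ℕ) < j → ∀ z, E ((W.map (SimplexCategory.δ i.succ)).hom z) = 0) ∧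
      (∀ i : Fin (k + 1), j ≤ (i : ℕ) → ∀ z, ∃ z', E ((W.map (SimplexCategory.δ i.succ)).hom z) = (W.map (SimplexCategory.δ i.succ)).hom z') := by
  induction j with
  | zero => exact ⟨LinearMap.id, fun _ _ => rfl, fun y => by simp, by simp, by simp,
      fun i _ z => ⟨z, rfl⟩⟩
  | succ j ih =>
    obtain ⟨E, h1, h2, h3, h4, h5⟩ := ih
    by_cases hj : j < k + 1
    · let e : W.obj ⦋k + 1⦌ →ₗ[ZMod 2] W.obj ⦋k + 1⦌ :=
        LinearMap.id - (W.map (SimplexCategory.δ (Fin.succ ⟨j, hj⟩))).hom ∘ₗ (W.map (SimplexCategory.σ ⟨j, hj⟩)).hom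
      have he : ∀ y, e y = y - (W.map (SimplexCategory.δ (Fin.succ ⟨j, hj⟩))).hom ((W.map (SimplexCategory.σ ⟨j, hj⟩)).hom y) := fun y => rfl
      refine ⟨e ∘ₗ E, fun y hy => ?_, fun y => ?_, fun i hi y => ?_, fun i hi z => ?_,
        fun i hi z => ?_⟩
      · rw [LinearMap.comp_apply, h1 y hy, he, mem_codegKer.1 hy, map_zero, sub_zero]
      · rw [LinearMap.comp_apply, he, sub_sub_eq_add_sub, add_sub_right_comm]
        exact add_mem (h2 y) (δ_mem_coim W _ _)
      · rw [LinearMap.comp_apply, he, map_sub]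
        rcases Nat.lt_succ_iff_lt_or_eq.1 hi with hi | hi
        · rw [h3 i hi, σ_δ_σ W i ⟨j, hj⟩ hi _ (h3 i hi y), sub_zero]
        · obtain rfl : i = ⟨j, hj⟩ := Fin.ext hi
          rw [σ_δ_succ, sub_self]
      · rw [LinearMap.comp_apply]
        rcases Nat.lt_succ_iff_lt_or_eq.1 hi with hi | hi
        · rw [h4 i hi, map_zero]
        · obtain rfl : i = ⟨j, hj⟩ := Fin.ext hi
          obtain ⟨z', hz'⟩ := h5 ⟨j, hj⟩ le_rfl z
          rw [hz', he, σ_δ_succ, sub_self]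
      · obtain ⟨z', hz'⟩ := h5 i (by omega) z
        obtain ⟨w, hw⟩ := δ_σ_δ W i ⟨j, hj⟩ hi z'
        exact ⟨z' - w, by rw [LinearMap.comp_apply, hz', he, hw, map_sub]⟩
    · exact ⟨E, h1, h2, fun i _ => h3 i (by omega), fun i _ => h4 i (by omega),
        fun i hi => absurd i.2 (by omega)⟩

lemma normRep_bijective (W : CMod.{u}) (k : ℕ) :
    Function.Bijective ((coim W k).mkQ ∘ₗ (codegKer W k).subtype) := by
  cases k with
  | zero =>
    constructor
    · rw [← LinearMap.ker_eq_bot, LinearMap.ker_eq_bot']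
      intro x hx
      have : x.1 ∈ (⊥ : Submodule (ZMod 2) (W.obj ⦋0⦌)) := (Submodule.Quotient.mk_eq_zero _).1 hx
      exact Subtype.ext this
    · intro x
      obtain ⟨x, rfl⟩ := Submodule.Quotient.mk_surjective _ x
      exact ⟨⟨x, trivial⟩, rfl⟩
  | succ k =>
    obtain ⟨E, h1, h2, h3, h4, -⟩ := exists_projector W k (k + 1)
    constructor
    · rw [← LinearMap.ker_eq_bot, LinearMap.ker_eq_bot']
      intro x hx
      have hx' : x.1 ∈ coim W (k + 1) := (Submodule.Quotient.mk_eq_zero _).1 hx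
      have hle : coim W (k + 1) ≤ LinearMap.ker E := coim_le fun i z => h4 i i.2 z
      exact Subtype.ext ((h1 x.1 x.2).symm.trans (hle hx'))
    · intro x
      obtain ⟨x, rfl⟩ := Submodule.Quotient.mk_surjective _ x
      refine ⟨⟨E x, mem_codegKer.2 fun i => h3 i i.2 x⟩, ?_⟩
      exact ((Submodule.Quotient.eq _).2 (h2 x)).symm

/-- Every class in `C^k(W)` has exactly one representative that is killed by all codegeneracies. -/
def normRep (W : CMod.{u}) (k : ℕ) : CObj W k ≃ₗ[ZMod 2] codegKer W k :=
  (LinearEquiv.ofBijective _ (normRep_bijective W k)).symm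

/-! ### Bicomplexes and truncated product total complexes -/

/-- A second-quadrant bicomplex; `X k t` sits in bidegree `(-k, t)`. Signs are immaterial over
`F₂`. -/
structure Bicpx where
  X : ℕ → ℕ → ModuleCat.{u} (ZMod 2)
  h : ∀ k t : ℕ, X k t →ₗ[ZMod 2] X (k + 1) t
  v : ∀ k t : ℕ, X k (t + 1) →ₗ[ZMod 2] X k t
  h_h : ∀ (k t : ℕ) (x : X k t), h (k + 1) t (h k t x) = 0
  v_v : ∀ (k t : ℕ) (x : X k (t + 2)), v k t (v k (t + 1) x) = 0
  h_v : ∀ (k t : ℕ) (x : X k (t + 1)), h k t (v k t x) = v (k + 1) t (h k (t + 1) x)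

/-- The horizontal differential that ends in column `-k`. -/
def Bicpx.hIn (B : Bicpx.{u}) (k t : ℕ) : (∀ k t : ℕ, B.X k t) →ₗ[ZMod 2] B.X k t :=
  match k with
  | 0 => 0
  | k + 1 => B.h k t ∘ₗ LinearMap.proj t ∘ₗ LinearMap.proj k

open Classical in
/-- `T_ℓ B`, the quotient of the product total complex `(TB)_m = ∏_k B_{-k, m+k}` by the
subcomplex of the columns to the left of column `-ℓ`, realized on the products
`∏_{k ≤ ℓ} B_{-k, m+k}`. -/
abbrev T (ℓ : ℕ∞) (B : Bicpx.{u}) : Cpx.{u} where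
  carrier := ModuleCat.of (ZMod 2) (∀ k t : ℕ, B.X k t)
  deg m :=
    { carrier := {x | ∀ k t : ℕ, ¬((k : ℕ∞) ≤ ℓ ∧ (t : ℤ) - k = m) → x k t = 0}
      add_mem' := fun {x y} hx hy k t hn => by
        rw [Pi.add_apply, Pi.add_apply, hx k t hn, hy k t hn, add_zero]
      zero_mem' := fun k t _ => rfl
      smul_mem' := fun c x hx k t hn => by
        rw [Pi.smul_apply, Pi.smul_apply, hx k t hn, smul_zero] }
  d := LinearMap.pi fun k => LinearMap.pi fun t =>
    if (k : ℕ∞) ≤ ℓ then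
      B.v k t ∘ₗ LinearMap.proj (t + 1) ∘ₗ LinearMap.proj k + B.hIn k t
    else 0
  d_mem m x hx k t hn := by
    simp only [LinearMap.pi_apply]
    split_ifs with hk
    · have h1 : x k (t + 1) = 0 := hx k (t + 1) (fun h => hn ⟨hk, by have := h.2; push_cast at this; omega⟩)
      have h2 : B.hIn k t x = 0 := by
        cases k with
        | zero => rfl
        | succ k =>
          have h3 : x k t = 0 := hx k t (fun h => hn ⟨hk, by have := h.2; push_cast; omega⟩)
          change B.h k t (x k t) = 0
          rw [h3, map_zero]
      change B.v k t (x k (t + 1)) + B.hIn k t x = 0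
      rw [h1, h2, map_zero, add_zero]
    · rfl
  d_d x := by
    funext k t
    simp only [LinearMap.pi_apply]
    by_cases hk : (k : ℕ∞) ≤ ℓ
    · simp only [hk, if_true]
      cases k with
      | zero =>
        change B.v 0 t ((if ((0 : ℕ) : ℕ∞) ≤ ℓ then _ else _ : _ →ₗ[ZMod 2] _) x) + 0 = 0
        rw [if_pos hk]
        change B.v 0 t (B.v 0 (t + 1) (x 0 (t + 2)) + 0) + 0 = 0
        rw [add_zero, add_zero, B.v_v]
      | succ k =>
        have hk' : (k : ℕ∞) ≤ ℓ := le_trans (by exact_mod_cast Nat.le_succ k) hk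
        change B.v (k + 1) t ((if ((k + 1 : ℕ) : ℕ∞) ≤ ℓ then _ else _ : _ →ₗ[ZMod 2] _) x) +
          B.h k t ((if (k : ℕ∞) ≤ ℓ then _ else _ : _ →ₗ[ZMod 2] _) x) = 0
        rw [if_pos hk, if_pos hk']
        change B.v (k + 1) t (B.v (k + 1) (t + 1) (x (k + 1) (t + 2)) + B.h k (t + 1) (x k (t + 1)))
          + B.h k t (B.v k t (x k (t + 1)) + B.hIn k t x) = 0
        have h0 : B.h k t (B.hIn k t x) = 0 := by
          cases k with
          | zero => exact map_zero _
          | succ k => exact B.h_h k t (x k t)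
        rw [map_add, map_add, B.v_v, B.h_v, h0, zero_add, add_zero]
        exact ZModModule.add_self _
    · simp only [hk, if_false]
      rfl

/-- The cosimplicial module `p ↦ N_t(V^p)`. -/
abbrev CSMod.NV (V : CSMod.{u}) (t : ℕ) : CMod.{u} := V ⋙ NFun t

/-- The vertical differential of `N V`. -/
abbrev CSMod.NVd (V : CSMod.{u}) (t : ℕ) : V.NV (t + 1) ⟶ V.NV t := Functor.whiskerLeft V (NBdry t)

/-- The bicomplex `CN V`, with `(CN V)_{-k,t} = C^k(N_t V)`. -/
abbrev CN (V : CSMod.{u}) : Bicpx.{u} where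
  X k t := CObj (V.NV t) k
  h k t := CBdry (V.NV t) k
  v k t := CMap (V.NVd t) k
  h_h k t x := by
    obtain ⟨x, rfl⟩ := Submodule.Quotient.mk_surjective _ x
    exact congrArg Submodule.Quotient.mk (cobdry_cobdry (V.NV t) k x)
  v_v k t x := by
    obtain ⟨x, rfl⟩ := Submodule.Quotient.mk_surjective _ x
    exact congrArg Submodule.Quotient.mk (Nd_Nd (V.obj ⦋k⦌) t x)
  h_v k t x := by
    obtain ⟨x, rfl⟩ := Submodule.Quotient.mk_surjective _ x
    exact congrArg Submodule.Quotient.mk (cobdry_naturality (V.NVd t) k x).symm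

/-! ### Totalization -/

/-- The `n`-simplex `α` of `Δ^p` lies in the `ℓ`-skeleton `sk_ℓ Δ^p`: it is an iterated degeneracy
of a simplex of dimension at most `ℓ`. -/
def InSk (ℓ : ℕ∞) {n p : SimplexCategory} (α : n ⟶ p) : Prop :=
  ∃ k : ℕ, (k : ℕ∞) ≤ ℓ ∧ ∃ (θ : n ⟶ ⦋k⦌) (y : ⦋k⦌ ⟶ p), θ ≫ y = α

lemma InSk.precomp {ℓ : ℕ∞} {n n' p : SimplexCategory} {α : n ⟶ p} (h : InSk ℓ α) (θ : n' ⟶ n) :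
    InSk ℓ (θ ≫ α) := by
  obtain ⟨k, hk, θ', y, rfl⟩ := h
  exact ⟨k, hk, θ ≫ θ', y, Category.assoc _ _ _⟩

lemma InSk.postcomp {ℓ : ℕ∞} {n p p' : SimplexCategory} {α : n ⟶ p} (h : InSk ℓ α) (γ : p ⟶ p') :
    InSk ℓ (α ≫ γ) := by
  obtain ⟨k, hk, θ', y, rfl⟩ := h
  exact ⟨k, hk, θ', y ≫ γ, (Category.assoc _ _ _).symm⟩

/-- The `n`-simplices of `sk_ℓ Δ^p`. -/
abbrev Sk (ℓ : ℕ∞) (p n : SimplexCategory) : Type := {α : n ⟶ p // InSk ℓ α}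

/-- The module `(Tot_ℓ V)_q` of families `f^p_n : (sk_ℓ Δ^p)_n × (Δ^q)_n → V^p_n` that are natural
in `n` and in `p`, that is, of maps of cosimplicial spaces `sk_ℓ Δ^• × Δ^q → V`. -/
def TotObj (ℓ : ℕ∞) (V : CSMod.{u}) (q : SimplexCategory) :
    Submodule (ZMod 2)
      (∀ p n : SimplexCategory, Sk ℓ p n → (n ⟶ q) → ((V.obj p).obj (op n) : Type u)) where
  carrier := {f |
    (∀ (p n n' : SimplexCategory) (θ : n' ⟶ n) (α : Sk ℓ p n) (β : n ⟶ q),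
      f p n' ⟨θ ≫ α.1, α.2.precomp θ⟩ (θ ≫ β) = ((V.obj p).map θ.op).hom (f p n α β)) ∧
    (∀ (p p' n : SimplexCategory) (γ : p ⟶ p') (α : Sk ℓ p n) (β : n ⟶ q),
      f p' n ⟨α.1 ≫ γ, α.2.postcomp γ⟩ β = ((V.map γ).app (op n)).hom (f p n α β))}
  add_mem' := by
    rintro f g ⟨hf, hf'⟩ ⟨hg, hg'⟩
    constructor
    · intro p n n' θ α β
      simp only [Pi.add_apply, hf, hg, map_add]
    · intro p p' n γ α β
      simp only [Pi.add_apply, hf', hg', map_add]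
  zero_mem' := by
    constructor
    · intro p n n' θ α β
      simp only [Pi.zero_apply, map_zero]
    · intro p p' n γ α β
      simp only [Pi.zero_apply, map_zero]
  smul_mem' := by
    rintro c f ⟨hf, hf'⟩
    constructor
    · intro p n n' θ α β
      simp only [Pi.smul_apply, hf, map_smul]
    · intro p p' n γ α β
      simp only [Pi.smul_apply, hf', map_smul]

/-- The simplicial module `Tot_ℓ V`. -/
abbrev Tot (ℓ : ℕ∞) (V : CSMod.{u}) : SMod.{u} where
  obj Q := ModuleCat.of (ZMod 2) (TotObj ℓ V Q.unop)
  map {Q Q'} θ := ModuleCat.ofHom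
    { toFun := fun f => ⟨fun p n α β => f.1 p n α (β ≫ θ.unop), by
        constructor
        · intro p n n' θ' α β
          exact (congrArg (f.1 p n' ⟨θ' ≫ α.1, α.2.precomp θ'⟩) (Category.assoc θ' β θ.unop)).trans
            (f.2.1 p n n' θ' α (β ≫ θ.unop))
        · intro p p' n γ α β
          exact f.2.2 p p' n γ α (β ≫ θ.unop)⟩
      map_add' := fun f g => rfl
      map_smul' := fun c f => rfl }
  map_id Q := by
    refine ModuleCat.hom_ext (LinearMap.ext fun f => Subtype.ext ?_)
    funext p n α β
    exact congrArg (f.1 p n α) (Category.comp_id β)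
  map_comp θ θ' := by
    refine ModuleCat.hom_ext (LinearMap.ext fun f => Subtype.ext ?_)
    funext p n α β
    exact congrArg (f.1 p n α) (Category.assoc β θ'.unop θ.unop).symm

/-- The interchange map `χ : Tot_ℓ U ⊗ Tot_ℓ V → Tot_ℓ (U ⊗ V)` given by the diagonal:
`χ(f ⊗ g)(α, β) = f(α, β) ⊗ g(α, β)`. -/
def interchange (ℓ : ℕ∞) (U V : CSMod.{u}) :
    tens (Tot ℓ U) (Tot ℓ V) ⟶ Tot ℓ (U.tensor V) where
  app Q := ModuleCat.ofHom (TensorProduct.lift (LinearMap.mk₂ (ZMod 2)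
    (fun (f : TotObj ℓ U Q.unop) (g : TotObj ℓ V Q.unop) =>
      (⟨fun p n α β => TensorProduct.tmul (ZMod 2) (f.1 p n α β) (g.1 p n α β), by
        constructor
        · intro p n n' θ α β
          exact congrArg₂ (TensorProduct.tmul (ZMod 2)) (f.2.1 p n n' θ α β) (g.2.1 p n n' θ α β)
        · intro p p' n γ α β
          exact congrArg₂ (TensorProduct.tmul (ZMod 2)) (f.2.2 p p' n γ α β)
            (g.2.2 p p' n γ α β)⟩ : TotObj ℓ (U.tensor V) Q.unop))
    (fun f f' g => Subtype.ext (by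
      funext p n α β
      exact TensorProduct.add_tmul _ _ _))
    (fun c f g => Subtype.ext (by
      funext p n α β
      exact TensorProduct.smul_tmul' _ _ _))
    (fun f g g' => Subtype.ext (by
      funext p n α β
      exact TensorProduct.tmul_add _ _ _))
    (fun c f g => Subtype.ext (by
      funext p n α β
      exact TensorProduct.tmul_smul _ _ _))))
  naturality Q Q' θ := by
    refine ModuleCat.hom_ext (TensorProduct.ext' fun f g => rfl)

/-! ### The shuffle map -/

/-- The `(p,q)`-shuffles, for `n = p + q`. A shuffle `τ` is encoded by the pair of iterated
codegeneracies `α = s^{τ(p)} ⋯ s^{τ(p+q-1)} : [n] → [p]` and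
`β = s^{τ(0)} ⋯ s^{τ(p-1)} : [n] → [q]`, in other words
`α(i) = #{j < p | τ(j) < i}` and `β(i) = #{j ≥ p | τ(j) < i}`. The pairs that arise are exactly
those with `α(i) + β(i) = i` for all `i`. -/
abbrev Shuf (p q n : ℕ) : Type :=
  {x : (⦋n⦌ ⟶ ⦋p⦌) × (⦋n⦌ ⟶ ⦋q⦌) //
    ∀ i : Fin (n + 1), (x.1.toOrderHom i : ℕ) + (x.2.toOrderHom i : ℕ) = i}

instance (p q n : ℕ) : Fintype (Shuf p q n) := Fintype.ofFinite _

lemma exists_step {p q n : ℕ} (h : p + q = n + 1) (f g : ℕ → ℕ) (hf : ∀ i ≤ n + 1, f i ≤ p)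
    (hg : ∀ i ≤ n + 1, g i ≤ q) (hg' : ∀ i ≤ n, g i ≤ g (i + 1))
    (hfg : ∀ i ≤ n + 1, f i + g i = i) (k : ℕ) (hk : k < p) :
    ∃ j ≤ n, f j = k ∧ f (j + 1) = k + 1 ∧ g j = g (j + 1) := by
  have key : ∀ m ≤ n + 1, k < f m → ∃ j ≤ n, f j ≤ k ∧ k < f (j + 1) := by
    intro m
    induction m with
    | zero =>
      intro _ h0
      have := hfg 0 (by omega)
      omega
    | succ m ih =>
      intro hm h0
      by_cases h1 : k < f m
      · exact ih (by omega) h1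
      · exact ⟨m, by omega, by omega, h0⟩
  have e := hfg (n + 1) le_rfl
  have e1 := hf (n + 1) le_rfl
  have e2 := hg (n + 1) le_rfl
  obtain ⟨j, hj, h1, h2⟩ := key (n + 1) le_rfl (by omega)
  have a1 := hfg j (by omega)
  have a2 := hfg (j + 1) (by omega)
  have a3 := hg' j hj
  exact ⟨j, hj, by omega, by omega, by omega⟩

lemma Shuf.exists_step_left {p q n : ℕ} (h : p + q = n + 1) (x : Shuf p q (n + 1)) (k : ℕ)
    (hk : k < p) : ∃ j : Fin (n + 1), (x.1.1.toOrderHom j.castSucc : ℕ) = k ∧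
      (x.1.1.toOrderHom j.succ : ℕ) = k + 1 ∧
      x.1.2.toOrderHom j.castSucc = x.1.2.toOrderHom j.succ := by
  obtain ⟨j, hj, h1, h2, h3⟩ := exists_step h
    (fun i => if hi : i < n + 2 then (x.1.1.toOrderHom ⟨i, hi⟩ : ℕ) else 0)
    (fun i => if hi : i < n + 2 then (x.1.2.toOrderHom ⟨i, hi⟩ : ℕ) else 0)
    (fun i hi => by
      rw [dif_pos (by omega)]
      exact Nat.lt_succ_iff.1 (Fin.is_lt _))
    (fun i hi => by
      rw [dif_pos (by omega)]
      exact Nat.lt_succ_iff.1 (Fin.is_lt _))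
    (fun i hi => by
      rw [dif_pos (by omega), dif_pos (by omega)]
      exact x.1.2.toOrderHom.monotone (by simp [Fin.le_def]))
    (fun i hi => by
      rw [dif_pos (by omega), dif_pos (by omega)]
      exact x.2 ⟨i, by omega⟩) k hk
  rw [dif_pos (by omega)] at h1 h2 h3
  rw [dif_pos (by omega)] at h3
  exact ⟨⟨j, by omega⟩, h1, h2, Fin.ext h3⟩

/-- Exchange of the two components. -/
def Shuf.swap {p q n : ℕ} (x : Shuf p q n) : Shuf q p n :=
  ⟨(x.1.2, x.1.1), fun i => by rw [add_comm]; exact x.2 i⟩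

lemma Shuf.exists_step_right {p q n : ℕ} (h : p + q = n + 1) (x : Shuf p q (n + 1)) (k : ℕ)
    (hk : k < q) : ∃ j : Fin (n + 1), (x.1.2.toOrderHom j.castSucc : ℕ) = k ∧
      (x.1.2.toOrderHom j.succ : ℕ) = k + 1 ∧
      x.1.1.toOrderHom j.castSucc = x.1.1.toOrderHom j.succ :=
  Shuf.exists_step_left (by omega) x.swap k hk

lemma comp_σ_eq {p m : ℕ} (α : ⦋m⦌ ⟶ ⦋p + 1⦌) (k : Fin (p + 1)) (i j : Fin (m + 1))
    (hi : (α.toOrderHom i : ℕ) = k) (hj : (α.toOrderHom j : ℕ) = k + 1) :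
    (α ≫ SimplexCategory.σ k).toOrderHom i = (α ≫ SimplexCategory.σ k).toOrderHom j := by
  have e1 : α.toOrderHom i = k.castSucc := Fin.ext hi
  have e2 : α.toOrderHom j = k.succ := Fin.ext hj
  change k.predAbove (α.toOrderHom i) = k.predAbove (α.toOrderHom j)
  rw [e1, e2]
  simp

/-- The shuffle map `A_p ⊗ B_q → (A ⊗ B)_n`, `n = p + q`, before normalization. -/
def shuf (A B : SMod.{u}) (p q n : ℕ) :
    A.obj (op ⦋p⦌) →ₗ[ZMod 2] B.obj (op ⦋q⦌) →ₗ[ZMod 2] (tens A B).obj (op ⦋n⦌) :=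
  ∑ x : Shuf p q n,
    (tm A B (op ⦋n⦌)).compl₁₂ (A.map x.1.1.op).hom (B.map x.1.2.op).hom

lemma shuf_apply (A B : SMod.{u}) (p q n : ℕ) (a : A.obj (op ⦋p⦌)) (b : B.obj (op ⦋q⦌)) :
    shuf A B p q n a b = ∑ x : Shuf p q n,
      tm A B (op ⦋n⦌) ((A.map x.1.1.op).hom a) ((B.map x.1.2.op).hom b) := by
  rw [shuf, LinearMap.sum_apply, LinearMap.sum_apply]
  rfl

lemma tmul_mem_degen (A B : SMod.{u}) {n : ℕ} {m m' : SimplexCategory} (θ : ⦋n + 1⦌ ⟶ m)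
    (θ' : ⦋n + 1⦌ ⟶ m') (j : Fin (n + 1))
    (h : θ.toOrderHom j.castSucc = θ.toOrderHom j.succ)
    (h' : θ'.toOrderHom j.castSucc = θ'.toOrderHom j.succ) (a : A.obj (op m)) (b : B.obj (op m')) :
    tm A B (op ⦋n + 1⦌) ((A.map θ.op).hom a) ((B.map θ'.op).hom b) ∈
      degen (tens A B) (n + 1) := by
  obtain ⟨η, rfl⟩ := SimplexCategory.eq_σ_comp_of_not_injective' θ j h
  obtain ⟨η', rfl⟩ := SimplexCategory.eq_σ_comp_of_not_injective' θ' j h'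
  rw [op_comp, op_comp, A.map_comp, B.map_comp]
  exact σ_mem_degen (tens A B) j
    (tm A B (op ⦋n⦌) ((A.map η.op).hom a) ((B.map η'.op).hom b))

lemma shuf_degen_left (A B : SMod.{u}) {p q n : ℕ} (h : p + q = n) (a : A.obj (op ⦋p⦌))
    (ha : a ∈ degen A p) (b : B.obj (op ⦋q⦌)) : shuf A B p q n a b ∈ degen (tens A B) n := by
  cases p with
  | zero =>
    have : a = 0 := ha
    rw [this, map_zero]
    exact zero_mem _
  | succ p =>
    obtain ⟨n, rfl⟩ : ∃ n', n = n' + 1 := ⟨p + q, by omega⟩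
    have hle : degen A (p + 1) ≤
        (degen (tens A B) (n + 1)).comap ((shuf A B (p + 1) q (n + 1)).flip b) := by
      refine degen_le fun k x => ?_
      rw [Submodule.mem_comap, LinearMap.flip_apply, shuf_apply]
      refine Submodule.sum_mem _ fun y _ => ?_
      obtain ⟨j, h1, h2, h3⟩ := y.exists_step_left h k k.2
      have := tmul_mem_degen A B (y.1.1 ≫ SimplexCategory.σ k) y.1.2 j
        (comp_σ_eq _ _ _ _ h1 h2) h3 x b
      rw [op_comp, A.map_comp] at this
      exact this
    exact hle ha

lemma shuf_degen_right (A B : SMod.{u}) {p q n : ℕ} (h : p + q = n) (a : A.obj (op ⦋p⦌))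
    (b : B.obj (op ⦋q⦌)) (hb : b ∈ degen B q) : shuf A B p q n a b ∈ degen (tens A B) n := by
  cases q with
  | zero =>
    have : b = 0 := hb
    rw [this, map_zero]
    exact zero_mem _
  | succ q =>
    obtain ⟨n, rfl⟩ : ∃ n', n = n' + 1 := ⟨p + q, by omega⟩
    have hle : degen B (q + 1) ≤
        (degen (tens A B) (n + 1)).comap (shuf A B p (q + 1) (n + 1) a) := by
      refine degen_le fun k x => ?_
      rw [Submodule.mem_comap, shuf_apply]
      refine Submodule.sum_mem _ fun y _ => ?_
      obtain ⟨j, h1, h2, h3⟩ := y.exists_step_right h k k.2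
      have := tmul_mem_degen A B y.1.1 (y.1.2 ≫ SimplexCategory.σ k) j h3
        (comp_σ_eq _ _ _ _ h1 h2) a x
      rw [op_comp, B.map_comp] at this
      exact this
    exact hle hb

/-- The shuffle map `∇ : N_p(A) ⊗ N_q(B) → N_n(A ⊗ B)`, `n = p + q`. -/
def nabla (A B : SMod.{u}) {p q n : ℕ} (h : p + q = n) :
    NObj A p →ₗ[ZMod 2] NObj B q →ₗ[ZMod 2] NObj (tens A B) n :=
  quotBilin _ _ ((shuf A B p q n).compr₂ (degen (tens A B) n).mkQ)
    (fun a ha b => (Submodule.Quotient.mk_eq_zero _).2 (shuf_degen_left A B h a ha b))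
    (fun a b hb => (Submodule.Quotient.mk_eq_zero _).2 (shuf_degen_right A B h a b hb))

/-- The shuffle map `∇ : N(A) ⊗ N(B) → N(A ⊗ B)` in all degrees. -/
def nablaN (A B : SMod.{u}) :
    (N A).carrier →ₗ[ZMod 2] (N B).carrier →ₗ[ZMod 2] (N (tens A B)).carrier :=
  LinearMap.mk₂ (ZMod 2)
    (fun (x : ∀ n, NObj A n) (y : ∀ n, NObj B n) => fun n : ℕ =>
      ∑ i : ↥(Finset.HasAntidiagonal.antidiagonal n),
        nabla A B (Finset.HasAntidiagonal.mem_antidiagonal.1 i.2) (x i.1.1) (y i.1.2))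
    (fun x x' y => by
      funext n
      simp only [Pi.add_apply, map_add, LinearMap.add_apply, Finset.sum_add_distrib])
    (fun c x y => by
      funext n
      simp only [Pi.smul_apply, map_smul, LinearMap.smul_apply, Finset.smul_sum])
    (fun x y y' => by
      funext n
      simp only [Pi.add_apply, map_add, Finset.sum_add_distrib])
    (fun c x y => by
      funext n
      simp only [Pi.smul_apply, map_smul, Finset.smul_sum])

/-- `N` on morphisms. -/
def NMap {A B : SMod.{u}} (f : A ⟶ B) : (N A).carrier →ₗ[ZMod 2] (N B).carrier :=
  LinearMap.pi fun n => ((NFun n).map f).hom ∘ₗ LinearMap.proj n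

/-- The first product
`N(Tot_ℓ U) ⊗ N(Tot_ℓ V) → N(Tot_ℓ U ⊗ Tot_ℓ V) → N(Tot_ℓ (U ⊗ V))`, that is `N(χ) ∘ ∇`. -/
def totProd (ℓ : ℕ∞) (U V : CSMod.{u}) :
    (N (Tot ℓ U)).carrier →ₗ[ZMod 2] (N (Tot ℓ V)).carrier →ₗ[ZMod 2]
      (N (Tot ℓ (U.tensor V))).carrier :=
  (nablaN (Tot ℓ U) (Tot ℓ V)).compr₂ (NMap (interchange ℓ U V))

/-! ### The cosimplicial Alexander–Whitney map and the second product -/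

/-- The Alexander–Whitney map `C^k(W) ⊗ C^{k'}(W') → C^p(W ⊗ W')`, `p = k + k'`. On elements `y`, `z`
killed by all codegeneracies it sends `[y] ⊗ [z]` to
`[d^p ⋯ d^{k+1} y ⊗ d^{k-1} ⋯ d^0 z]`; here `d^p ⋯ d^{k+1}` is induced by the inclusion of the first
`k + 1` vertices `[k] → [p]` and `d^{k-1} ⋯ d^0` by that of the last `k' + 1` vertices
`[k'] → [p]`. -/
def AW (W W' : CMod.{u}) {k k' p : ℕ} (h : k + k' = p) :
    CObj W k →ₗ[ZMod 2] CObj W' k' →ₗ[ZMod 2] CObj (tens W W') p :=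
  ((tm W W' ⦋p⦌).compl₁₂
    ((W.map (SimplexCategory.subinterval 0 k (by omega))).hom ∘ₗ (codegKer W k).subtype ∘ₗ
      (normRep W k).toLinearMap)
    ((W'.map (SimplexCategory.subinterval k k' (by omega))).hom ∘ₗ (codegKer W' k').subtype ∘ₗ
      (normRep W' k').toLinearMap)).compr₂ (coim (tens W W') p).mkQ

lemma nabla_naturality {A A' B B' : SMod.{u}} (f : A ⟶ A') (g : B ⟶ B') {p q n : ℕ}
    (h : p + q = n) (x : NObj A p) (y : NObj B q) :
    ((NFun n).map (tensMap f g)).hom (nabla A B h x y) =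
      nabla A' B' h (((NFun p).map f).hom x) (((NFun q).map g).hom y) := by
  obtain ⟨x, rfl⟩ := Submodule.Quotient.mk_surjective _ x
  obtain ⟨y, rfl⟩ := Submodule.Quotient.mk_surjective _ y
  refine congrArg Submodule.Quotient.mk
    (?_ : ((tensMap f g).app (op ⦋n⦌)).hom (shuf A B p q n x y) =
      shuf A' B' p q n ((f.app _).hom x) ((g.app _).hom y))
  rw [shuf_apply, shuf_apply, map_sum]
  refine Finset.sum_congr rfl fun z _ => ?_
  exact congrArg₂ (TensorProduct.tmul (ZMod 2))
    (ConcreteCategory.congr_hom (f.naturality z.1.1.op) x)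
    (ConcreteCategory.congr_hom (g.naturality z.1.2.op) y)

/-- The cosimplicial map `N_a(U) ⊗ N_b(V) → N_t(U ⊗ V)`, `t = a + b`, given by the shuffle map. -/
def nablaC (U V : CSMod.{u}) {a b t : ℕ} (h : a + b = t) :
    tens (U.NV a) (V.NV b) ⟶ (U.tensor V).NV t where
  app p := ModuleCat.ofHom (TensorProduct.lift (nabla (U.obj p) (V.obj p) h))
  naturality p p' γ := by
    refine ModuleCat.hom_ext (TensorProduct.ext' fun x y => ?_)
    exact (nabla_naturality (U.map γ) (V.map γ) h x y).symm

open Classical in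
/-- The second product, the composite
`T_ℓ CNU ⊗ T_ℓ CNV → T_ℓ (CNU ⊗ CNV) → T_ℓ C(NU ⊗ NV) → T_ℓ CN(U ⊗ V)`
of the canonical map, of the Alexander–Whitney map and of the shuffle map. -/
def conormProd (ℓ : ℕ∞) (U V : CSMod.{u}) :
    (T ℓ (CN U)).carrier →ₗ[ZMod 2] (T ℓ (CN V)).carrier →ₗ[ZMod 2]
      (T ℓ (CN (U.tensor V))).carrier :=
  LinearMap.mk₂ (ZMod 2)
    (fun (x : ∀ k t, CObj (U.NV t) k) (y : ∀ k t, CObj (V.NV t) k) => fun p t : ℕ =>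
      if (p : ℕ∞) ≤ ℓ then
        ∑ i : ↥(Finset.HasAntidiagonal.antidiagonal p),
        ∑ j : ↥(Finset.HasAntidiagonal.antidiagonal t),
          CMap (nablaC U V (Finset.HasAntidiagonal.mem_antidiagonal.1 j.2)) p
            (AW (U.NV j.1.1) (V.NV j.1.2) (Finset.HasAntidiagonal.mem_antidiagonal.1 i.2)
              (x i.1.1 j.1.1) (y i.1.2 j.1.2))
      else 0)
    (fun x x' y => by
      funext p t
      simp only [Pi.add_apply]
      split_ifs
      · simp only [map_add, LinearMap.add_apply, Finset.sum_add_distrib]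
      · rw [add_zero])
    (fun c x y => by
      funext p t
      simp only [Pi.smul_apply]
      split_ifs
      · simp only [map_smul, LinearMap.smul_apply, Finset.smul_sum]
      · rw [smul_zero])
    (fun x y y' => by
      funext p t
      simp only [Pi.add_apply]
      split_ifs
      · simp only [map_add, Finset.sum_add_distrib]
      · rw [add_zero])
    (fun c x y => by
      funext p t
      simp only [Pi.smul_apply]
      split_ifs
      · simp only [map_smul, Finset.smul_sum]
      · rw [smul_zero])

/-! ### The map `φ_ℓ` -/

lemma inSk_of_le {ℓ : ℕ∞} {k : ℕ} (hk : (k : ℕ∞) ≤ ℓ) {n : SimplexCategory} (α : n ⟶ ⦋k⦌) :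
    InSk ℓ α := ⟨k, hk, α, 𝟙 _, Category.comp_id α⟩

/-- The value `f(ι_k ∧ ι_q) ∈ V^k_t`, `t = k + q`, where `ι_k ∧ ι_q = ∇(ι_k ⊗ ι_q)` is the sum over
all `(k,q)`-shuffles of the simplices `(α, β)` of `sk_ℓ Δ^k × Δ^q`. -/
def evalWedge (ℓ : ℕ∞) (V : CSMod.{u}) {k : ℕ} (hk : (k : ℕ∞) ≤ ℓ) (q t : ℕ) :
    (Tot ℓ V).obj (op ⦋q⦌) →ₗ[ZMod 2] (V.obj ⦋k⦌).obj (op ⦋t⦌) where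
  toFun (f : TotObj ℓ V ⦋q⦌) := ∑ x : Shuf k q t, f.1 ⦋k⦌ ⦋t⦌ ⟨x.1.1, inSk_of_le hk x.1.1⟩ x.1.2
  map_add' _ _ := Finset.sum_add_distrib
  map_smul' c f := (Finset.smul_sum (r := c)
    (f := fun x : Shuf k q t => f.1 ⦋k⦌ ⦋t⦌ ⟨x.1.1, inSk_of_le hk x.1.1⟩ x.1.2)
    (s := Finset.univ)).symm

lemma evalWedge_degen (ℓ : ℕ∞) (V : CSMod.{u}) {k : ℕ} (hk : (k : ℕ∞) ≤ ℓ) {q t : ℕ}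
    (h : k + q = t) :
    degen (Tot ℓ V) q ≤ (degen (V.obj ⦋k⦌) t).comap (evalWedge ℓ V hk q t) := by
  cases q with
  | zero => exact bot_le
  | succ q =>
    obtain ⟨t, rfl⟩ : ∃ t', t = t' + 1 := ⟨k + q, by omega⟩
    refine degen_le fun i (f : TotObj ℓ V ⦋q⦌) => ?_
    refine Submodule.sum_mem (degen (V.obj ⦋k⦌) (t + 1)) fun x _ => ?_
    obtain ⟨j, h1, h2, h3⟩ := x.exists_step_right h i i.2
    have h4 := comp_σ_eq _ _ _ _ h1 h2
    obtain ⟨⟨α, β⟩, hx⟩ := x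
    dsimp only at h1 h2 h3 h4
    obtain ⟨η, rfl⟩ := SimplexCategory.eq_σ_comp_of_not_injective' α j h3
    obtain ⟨η', hη'⟩ := SimplexCategory.eq_σ_comp_of_not_injective' _ j h4
    have e := f.2.1 ⦋k⦌ ⦋t⦌ ⦋t + 1⦌ (SimplexCategory.σ j) ⟨η, inSk_of_le hk η⟩ η'
    rw [← hη'] at e
    have e' := σ_mem_degen (V.obj ⦋k⦌) j (f.1 ⦋k⦌ ⦋t⦌ ⟨η, inSk_of_le hk η⟩ η')
    exact e.symm ▸ e'

/-- The component `N_q(Tot_ℓ V) → C^k(N_t V)`, `[f] ↦ [f(ι_k ∧ ι_q)]`, of `φ_ℓ`, for `k ≤ ℓ` and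
`t = k + q`. -/
def phiComp (ℓ : ℕ∞) (V : CSMod.{u}) {k : ℕ} (hk : (k : ℕ∞) ≤ ℓ) {q t : ℕ} (h : k + q = t) :
    NObj (Tot ℓ V) q →ₗ[ZMod 2] CObj (V.NV t) k :=
  (coim (V.NV t) k).mkQ ∘ₗ Submodule.mapQ _ _ (evalWedge ℓ V hk q t) (evalWedge_degen ℓ V hk h)

open Classical in
/-- The map `φ_ℓ : N(Tot_ℓ V) → T_ℓ CN V`, `φ_ℓ(f) = ∏_{k ≤ ℓ} f(ι_k ∧ ι_q)` for
`f ∈ N_q(Tot_ℓ V)`. -/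
def phi (ℓ : ℕ∞) (V : CSMod.{u}) : (N (Tot ℓ V)).carrier →ₗ[ZMod 2] (T ℓ (CN V)).carrier :=
  LinearMap.pi fun k => LinearMap.pi fun t =>
    if h : (k : ℕ∞) ≤ ℓ ∧ k ≤ t then
      phiComp ℓ V h.1 (Nat.add_sub_of_le h.2) ∘ₗ LinearMap.proj (t - k)
    else 0

end TotProd

end

/-! The square is reduced to one universal example. In the cosimplicial simplicial module `stdMod`,
`p ↦ F₂[Δ^p]`, the top simplices form a family `iota` with `∂ι_{p+1} = ∑ d^i ι_p`. Over `F₂` this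
says that `iota` is a cycle for the total differential `famD` (`famD_iota`); moreover all
codegeneracies kill it (`NMap_σ_iota`). Evaluation `α ⊗ f ↦ f(α, id)` is a map `ev : F₂[Δ^p] ⊗ Tot_ℓ
V → V^p`, natural in `p`, and the components of `φ_ℓ(w)` are the classes of `ev(∇(ι_p ⊗ w))`
(`phi_apply`). Naturality, the cycle property of `iota` and the Leibniz rule for `∇` make `φ_ℓ` a
chain map. The chains `ev(∇(ι_p ⊗ w))` are killed by codegeneracies, so they are the representatives
that the Alexander–Whitney map uses (`rep_phi`).

Hence both ways around the square evaluate, through `evTens`, a family of chains on `F₂[Δ^p] ⊗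
F₂[Δ^p]` against the same chain `∇(x ⊗ y)`. Through `Tot` the family is the diagonal `diagIota`
(`phi_totProd`). Through the conormalization it is `star iota iota`, the sum of the shuffle products
of front and back faces (`conormProd_phi`); this uses that fourfold shuffles are compatible with
exchanging the middle factors (`middle_nablaN`). Both families are total cycles, their `p`-th
members have degree `p`, and they agree for `p = 0`. A cone construction shows that `F₂[Δ^p] ⊗
F₂[Δ^p]` is exact in positive degrees, so induction on `p` gives a homotopy between them
(`exists_homotopy`), independent of `ℓ`, `U` and `V`. For cycles `x`, `y`, evaluating this homotopy
against `∇(x ⊗ y)` bounds the difference of the two composites.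

Two Leibniz rules remain. For `∇`, a shuffle is viewed as a lattice path whose `i`-th vertex has
coordinate sum `i`; a face of it is horizontal, vertical, or removes a corner, and the corner faces
cancel in pairs (`sum_faces`). For the Alexander–Whitney map, the cofaces are distributed over the
front and the back face (`sum_subinterval`). -/

noncomputable section

namespace TotProd

/-! ### Monotone maps as functions on `ℕ` -/

/-- The values of a morphism `[n] → [p]`, extended to `ℕ` by the value at `n`. -/
def val {n p : ℕ} (f : ⦋n⦌ ⟶ ⦋p⦌) (i : ℕ) : ℕ :=
  f.toOrderHom (⟨min i n, Nat.lt_succ_of_le (min_le_right i n)⟩ : Fin (n + 1))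

lemma val_fin {n p : ℕ} (f : ⦋n⦌ ⟶ ⦋p⦌) (i : Fin (n + 1)) : (f.toOrderHom i : ℕ) = val f i := by
  have : i = (⟨min (i : ℕ) n, Nat.lt_succ_of_le (min_le_right (i : ℕ) n)⟩ : Fin (n + 1)) :=
    Fin.ext (by dsimp only; omega)
  rw [val, ← this]

lemma val_le {n p : ℕ} (f : ⦋n⦌ ⟶ ⦋p⦌) (i : ℕ) : val f i ≤ p :=
  Nat.lt_succ_iff.1 (Fin.is_lt _)

lemma val_mono {n p : ℕ} (f : ⦋n⦌ ⟶ ⦋p⦌) {i j : ℕ} (h : i ≤ j) : val f i ≤ val f j :=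
  f.toOrderHom.monotone (by simp only [Fin.le_def]; omega)

lemma val_comp {m n p : ℕ} (g : ⦋m⦌ ⟶ ⦋n⦌) (f : ⦋n⦌ ⟶ ⦋p⦌) (i : ℕ) :
    val (g ≫ f) i = val f (val g i) := by
  exact val_fin f (g.toOrderHom (⟨min i m, Nat.lt_succ_of_le (min_le_right i m)⟩ : Fin (m + 1)))

lemma val_ext {n p : ℕ} {f g : ⦋n⦌ ⟶ ⦋p⦌} (h : ∀ i ≤ n, val f i = val g i) : f = g := by
  ext i : 3
  change Fin (n + 1) at i
  refine Fin.ext ?_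
  rw [val_fin, val_fin]
  exact h i (Nat.lt_succ_iff.1 i.2)

lemma exists_val {n p : ℕ} (a : ℕ → ℕ) (ha : ∀ i < n, a i ≤ a (i + 1)) (hp : ∀ i ≤ n, a i ≤ p) :
    ∃ f : ⦋n⦌ ⟶ ⦋p⦌, ∀ i ≤ n, val f i = a i := by
  have mono : ∀ j, ∀ i ≤ j, j ≤ n → a i ≤ a j := by
    intro j
    induction j with
    | zero => intro i hi _; obtain rfl : i = 0 := by omega
              exact le_rfl
    | succ j ih =>
      intro i hi hj
      rcases Nat.lt_or_ge i (j + 1) with h | h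
      · exact (ih i (by omega) (by omega)).trans (ha j (by omega))
      · obtain rfl : i = j + 1 := by omega
        exact le_rfl
  refine ⟨SimplexCategory.mkHom ⟨fun i => ⟨a i, Nat.lt_succ_iff.2 (hp i (by omega))⟩,
    fun i j hij => mono j i hij (by omega)⟩, fun i hi => ?_⟩
  change a (min i n) = a i
  rw [min_eq_left hi]

lemma val_δ {n : ℕ} (i : Fin (n + 2)) {l : ℕ} (hl : l ≤ n) :
    val (SimplexCategory.δ i) l = if l < i then l else l + 1 := by
  have : (⟨min l n, by omega⟩ : Fin (n + 1)) = ⟨l, by omega⟩ := Fin.ext (min_eq_left hl)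
  rw [val, this]
  change ((i.succAbove ⟨l, by omega⟩ : Fin (n + 2)) : ℕ) = _
  simp only [Fin.succAbove, Fin.lt_def, Fin.val_castSucc]
  split_ifs <;> rfl

lemma val_σ {n : ℕ} (i : Fin (n + 1)) {l : ℕ} (hl : l ≤ n + 1) :
    val (SimplexCategory.σ i) l = if l ≤ i then l else l - 1 := by
  have : (⟨min l (n + 1), by omega⟩ : Fin (n + 2)) = ⟨l, by omega⟩ := Fin.ext (min_eq_left hl)
  rw [val, this]
  change ((i.predAbove ⟨l, by omega⟩ : Fin (n + 1)) : ℕ) = _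
  simp only [Fin.predAbove, Fin.lt_def, Fin.val_castSucc]
  split_ifs <;> simp <;> omega

lemma val_subinterval {n j k : ℕ} (h : j + k ≤ n) {l : ℕ} (hl : l ≤ k) :
    val (SimplexCategory.subinterval j k h) l = l + j := by
  have : (⟨min l k, by omega⟩ : Fin (k + 1)) = ⟨l, by omega⟩ := Fin.ext (min_eq_left hl)
  rw [val, this]
  rfl

lemma Shuf.val_add {p q n : ℕ} (x : Shuf p q n) {i : ℕ} (hi : i ≤ n) :
    val x.1.1 i + val x.1.2 i = i := by
  have h := x.2 ⟨i, by omega⟩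
  rwa [val_fin, val_fin] at h

lemma exists_shuf {p q n : ℕ} (a b : ℕ → ℕ) (ha : ∀ i < n, a i ≤ a (i + 1))
    (hb : ∀ i < n, b i ≤ b (i + 1)) (hap : ∀ i ≤ n, a i ≤ p) (hbq : ∀ i ≤ n, b i ≤ q)
    (h : ∀ i ≤ n, a i + b i = i) :
    ∃ x : Shuf p q n, ∀ i ≤ n, val x.1.1 i = a i ∧ val x.1.2 i = b i := by
  obtain ⟨f, hf⟩ := exists_val a ha hap
  obtain ⟨g, hg⟩ := exists_val b hb hbq
  refine ⟨⟨(f, g), fun i => ?_⟩, fun i hi => ⟨hf i hi, hg i hi⟩⟩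
  dsimp only
  rw [val_fin, val_fin, hf _ (by omega), hg _ (by omega), h _ (by omega)]

/-- The coordinates of the `i`-th vertex add up to `i`, so the first coordinate determines the
second. -/
lemma Shuf.val_ext {p q n : ℕ} {x y : Shuf p q n} (h : ∀ i ≤ n, val x.1.1 i = val y.1.1 i) :
    x = y := by
  refine Subtype.ext (Prod.ext (TotProd.val_ext h) (TotProd.val_ext fun i hi => ?_))
  have h1 := x.val_add hi
  have h2 := y.val_add hi
  have h3 := h i hi
  omega

/-! ### The boundary of a product of simplices -/

/-- The `i`-th vertex of the path `x` is the only one with its first coordinate. -/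
def IsHor {p q n : ℕ} (z : Shuf p q (n + 1) × Fin (n + 2)) : Prop :=
  ∀ l ≤ n, val (SimplexCategory.δ z.2 ≫ z.1.1.1) l ≠ val z.1.1.1 z.2

lemma isHor_iff {p q n : ℕ} (z : Shuf p q (n + 1) × Fin (n + 2)) :
    IsHor z ↔ (∀ l < (z.2 : ℕ), val z.1.1.1 l ≠ val z.1.1.1 z.2) ∧
      (∀ l, (z.2 : ℕ) < l → l ≤ n + 1 → val z.1.1.1 l ≠ val z.1.1.1 z.2) := by
  have hz := z.2.2
  constructor
  · intro h
    refine ⟨fun l hl => ?_, fun l hl hl' => ?_⟩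
    · have := h l (by omega)
      rwa [val_comp, val_δ _ (by omega), if_pos hl] at this
    · have := h (l - 1) (by omega)
      rwa [val_comp, val_δ _ (by omega), if_neg (by omega), Nat.sub_add_cancel (by omega)] at this
  · rintro ⟨h1, h2⟩ l hl
    rw [val_comp, val_δ _ hl]
    split_ifs with h
    · exact h1 l h
    · exact h2 _ (by omega) (by omega)

/-- Exchange of the two coordinates. -/
def swapFace {p q n : ℕ} : Shuf p q (n + 1) × Fin (n + 2) ≃ Shuf q p (n + 1) × Fin (n + 2) where
  toFun z := (z.1.swap, z.2)
  invFun z := (z.1.swap, z.2)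
  left_inv _ := rfl
  right_inv _ := rfl

section

variable {M : Type*} [AddCommGroup M]

/-- The coordinate sum of a vertex is its position in the path. A face therefore remembers the
original positions of its vertices, hence the omitted position and the path everywhere else. -/
lemma face_unique {p q n : ℕ} {z z' : Shuf p q (n + 1) × Fin (n + 2)}
    (h1 : SimplexCategory.δ z.2 ≫ z.1.1.1 = SimplexCategory.δ z'.2 ≫ z'.1.1.1)
    (h2 : SimplexCategory.δ z.2 ≫ z.1.1.2 = SimplexCategory.δ z'.2 ≫ z'.1.1.2) :
    z.2 = z'.2 ∧ ∀ l ≤ n + 1, l ≠ z.2 → val z.1.1.1 l = val z'.1.1.1 l := by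
  have e1 : ∀ l ≤ n, val z.1.1.1 (val (SimplexCategory.δ z.2) l) =
      val z'.1.1.1 (val (SimplexCategory.δ z'.2) l) := fun l _ => by
    rw [← val_comp, ← val_comp, h1]
  have e2 : ∀ l ≤ n, val (SimplexCategory.δ z.2) l = val (SimplexCategory.δ z'.2) l := fun l hl => by
    have h3 : val z.1.1.2 (val (SimplexCategory.δ z.2) l) =
      val z'.1.1.2 (val (SimplexCategory.δ z'.2) l) := by rw [← val_comp, ← val_comp, h2]
    have h4 := z.1.val_add (val_le (SimplexCategory.δ z.2) l)
    have h5 := z'.1.val_add (val_le (SimplexCategory.δ z'.2) l)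
    have h6 := e1 l hl
    omega
  have hz := z.2.2
  have hz' := z'.2.2
  -- If the omitted positions differed, the two cofaces would take different values at the smaller
  -- one.
  have e3 : (z.2 : ℕ) = z'.2 := by
    rcases lt_trichotomy (z.2 : ℕ) z'.2 with h | h | h
    · have := e2 z.2 (by omega)
      rw [val_δ _ (by omega), val_δ _ (by omega), if_neg (by omega), if_pos h] at this
      omega
    · exact h
    · have := e2 z'.2 (by omega)
      rw [val_δ _ (by omega), val_δ _ (by omega), if_pos h, if_neg (by omega)] at this
      omega
  refine ⟨Fin.ext e3, fun l hl hne => ?_⟩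
  rcases lt_or_gt_of_ne hne with h | h
  · have := e1 l (by omega)
    rwa [val_δ _ (by omega), val_δ _ (by omega), if_pos h, if_pos (by omega)] at this
  · have := e1 (l - 1) (by omega)
    rwa [val_δ _ (by omega), val_δ _ (by omega), if_neg (by omega), if_neg (by omega),
      Nat.sub_add_cancel (by omega)] at this

/-- After `δ j` opens a gap at first coordinate `j`, the path has one horizontal step of length two
across the gap, or starts or ends next to it; the missing vertex goes there. If it has position `i`,
its second coordinate must be `i - j`. -/
lemma exists_insert {p q n : ℕ} (h : p + 1 + q = n + 1) (j : Fin (p + 2)) (y : Shuf p q n) :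
    ∃ z : Shuf (p + 1) q (n + 1) × Fin (n + 2), IsHor z ∧ val z.1.1.1 z.2 = j ∧
      SimplexCategory.δ z.2 ≫ z.1.1.1 = y.1.1 ≫ SimplexCategory.δ j ∧
      SimplexCategory.δ z.2 ≫ z.1.1.2 = y.1.2 := by
  classical
  have hj := j.2
  -- The insertion position is the first one where the path reaches `j`. For `j = p + 1` it never
  -- does, and the alternative `n < l` puts the new vertex at the end.
  have hex : ∃ l, n < l ∨ (j : ℕ) ≤ val y.1.1 l := ⟨n + 1, Or.inl (by omega)⟩
  obtain ⟨i, hi, hlt⟩ : ∃ i, (n < i ∨ (j : ℕ) ≤ val y.1.1 i) ∧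
      ∀ l < i, l ≤ n ∧ val y.1.1 l < j := by
    refine ⟨Nat.find hex, Nat.find_spec hex, fun l hl => ?_⟩
    have := Nat.find_min hex hl
    omega
  have hin : i ≤ n + 1 := by
    by_contra hc
    have := (hlt (n + 1) (by omega)).1
    omega
  have mono1 : ∀ l, val y.1.1 l ≤ val y.1.1 (l + 1) := fun l => val_mono _ (Nat.le_succ l)
  have mono2 : ∀ l, val y.1.2 l ≤ val y.1.2 (l + 1) := fun l => val_mono _ (Nat.le_succ l)
  have add : ∀ l ≤ n, val y.1.1 l + val y.1.2 l = l := fun l hl => y.val_add hl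
  have le1 : ∀ l, val y.1.1 l ≤ p := fun l => val_le _ l
  have le2 : ∀ l, val y.1.2 l ≤ q := fun l => val_le _ l
  -- Paths move by unit steps, so the vertex before the inserted one has first coordinate exactly `j
  -- - 1`. This makes the new sequence a path again.
  have hprev : i = 0 ∧ (j : ℕ) = 0 ∨ ∃ i', i = i' + 1 ∧ val y.1.1 i' + 1 = j := by
    rcases Nat.eq_zero_or_pos i with h0 | h0
    · have := add 0 (by omega)
      subst h0
      left
      omega
    · obtain ⟨i', rfl⟩ : ∃ i', i = i' + 1 := ⟨i - 1, by omega⟩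
      refine Or.inr ⟨i', rfl, ?_⟩
      have h1 := hlt i' (by omega)
      have h2 := add i' h1.1
      have h3 := le2 i'
      rcases hi with hi | hi
      · obtain rfl : i' = n := by omega
        omega
      · by_cases hn : i' + 1 ≤ n
        · have h4 := add (i' + 1) hn
          have h5 := mono2 i'
          omega
        · obtain rfl : i' = n := by omega
          omega
  obtain ⟨x, hx⟩ := exists_shuf (p := p + 1) (q := q) (n := n + 1)
    (fun l => if l < i then val y.1.1 l else if l = i then j else val y.1.1 (l - 1) + 1)
    (fun l => if l < i then val y.1.2 l else if l = i then i - j else val y.1.2 (l - 1))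
    (fun l hl => by
      have h1 := mono1 l
      have h2 := mono1 (l - 1)
      dsimp only
      rcases lt_trichotomy (l + 1) i with h3 | h3 | h3
      · rw [if_pos (by omega), if_pos h3]
        exact h1
      · have := hlt l (by omega)
        rw [if_pos (by omega), if_neg (by omega), if_pos h3]
        omega
      · rw [if_neg (show ¬l < i by omega), if_neg (show ¬l + 1 < i by omega),
          if_neg (show l + 1 ≠ i by omega), Nat.add_sub_cancel]
        split_ifs with h4
        · subst h4
          rcases hprev with h5 | ⟨i', rfl, h5⟩
          · omega
          · have := mono1 i'
            omega
        · rw [Nat.sub_add_cancel (by omega)] at h2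
          omega)
    (fun l hl => by
      dsimp only
      rcases lt_trichotomy (l + 1) i with h3 | h3 | h3
      · rw [if_pos (by omega), if_pos h3]
        exact mono2 l
      · have h4 := hlt l (by omega)
        have h5 := add l h4.1
        rw [if_pos (by omega), if_neg (by omega), if_pos h3]
        rcases hprev with h6 | ⟨i', h6, h7⟩
        · omega
        · obtain rfl : i' = l := by omega
          omega
      · rw [if_neg (show ¬l < i by omega), if_neg (show ¬l + 1 < i by omega),
          if_neg (show l + 1 ≠ i by omega), Nat.add_sub_cancel]
        split_ifs with h4
        · subst h4
          have h6 := add l (by omega)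
          rcases hprev with h5 | ⟨i', rfl, h5⟩
          · omega
          · have := mono2 i'
            have := add i' (by omega)
            omega
        · have h2 := mono2 (l - 1)
          rwa [Nat.sub_add_cancel (by omega)] at h2)
    (fun l hl => by
      have h1 := le1 l
      have h2 := le1 (l - 1)
      dsimp only
      split_ifs <;> omega)
    (fun l hl => by
      have h1 := le2 l
      have h2 := le2 (l - 1)
      dsimp only
      split_ifs
      · exact h1
      · rcases hprev with h5 | ⟨i', rfl, h5⟩
        · omega
        · have := add i' (by omega)
          have := le2 i'
          omega
      · exact h2)
    (fun l hl => by
      dsimp only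
      split_ifs with h1 h2
      · exact add l (by omega)
      · rcases hprev with h5 | ⟨i', rfl, h5⟩
        · omega
        · have := add i' (by omega)
          omega
      · have := add (l - 1) (by omega)
        omega)
  have hx1 : ∀ l ≤ n, val x.1.1 (val (SimplexCategory.δ (⟨i, by omega⟩ : Fin (n + 2))) l) =
      val (SimplexCategory.δ j) (val y.1.1 l) := fun l hl => by
    have h1 := le1 l
    rw [(hx _ (val_le _ _)).1, val_δ _ h1, val_δ _ hl]
    dsimp only
    by_cases h2 : l < i
    · rw [if_pos h2, if_pos h2, if_pos (hlt l h2).2]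
    · have h3 : (j : ℕ) ≤ val y.1.1 l := by
        have := val_mono y.1.1 (show i ≤ l by omega)
        omega
      rw [if_neg h2, if_neg (by omega), if_neg (by omega), if_neg (by omega), Nat.add_sub_cancel]
  refine ⟨(x, ⟨i, by omega⟩), ?_, ?_, ?_, ?_⟩
  · intro l hl
    rw [val_comp, hx1 l hl, (hx i (by omega)).1, val_δ _ (le1 l)]
    dsimp only
    split_ifs <;> omega
  · rw [(hx i (by omega)).1]
    simp
  · refine val_ext fun l hl => ?_
    rw [val_comp, val_comp]
    exact hx1 l hl
  · refine val_ext fun l hl => ?_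
    rw [val_comp, (hx _ (val_le _ _)).2, val_δ _ hl]
    dsimp only
    split_ifs <;> first | rfl | omega

open Classical in
-- Inserting a vertex with new first coordinate `j` and deleting the only vertex with that
-- coordinate are mutually inverse.
lemma sum_isHor {p q n : ℕ} (h : p + 1 + q = n + 1)
    (F : (⦋n⦌ ⟶ ⦋p + 1⦌) → (⦋n⦌ ⟶ ⦋q⦌) → M) :
    ∑ z : Shuf (p + 1) q (n + 1) × Fin (n + 2) with IsHor z,
      F (SimplexCategory.δ z.2 ≫ z.1.1.1) (SimplexCategory.δ z.2 ≫ z.1.1.2) =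
    ∑ w : Fin (p + 2) × Shuf p q n, F (w.2.1.1 ≫ SimplexCategory.δ w.1) w.2.1.2 := by
  choose z hz1 hz2 hz3 hz4 using
    fun w : Fin (p + 2) × Shuf p q n => exists_insert h w.1 w.2
  symm
  refine Finset.sum_bij (fun w _ => z w) (fun w _ => by simp [hz1]) ?_ ?_ ?_
  · rintro ⟨j, y⟩ - ⟨j', y'⟩ - e
    have e1 : j = j' := Fin.ext <| by
      have := hz2 (j, y)
      rw [e, hz2 (j', y')] at this
      exact this.symm
    subst e1
    have e2 := hz3 (j, y)
    rw [e, hz3 (j, y')] at e2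
    have e3 := (cancel_mono _).1 e2
    have e4 : y' = y := Shuf.val_ext fun i _ => by rw [e3]
    rw [e4]
  · rintro ⟨x, i⟩ hx
    simp only [Finset.mem_filter, Finset.mem_univ, true_and] at hx
    have hlt := val_le x.1.1 i
    -- The deleted vertex was the only one with its first coordinate, so the face misses that value
    -- and factors through the corresponding coface.
    obtain ⟨f, hf⟩ := SimplexCategory.eq_comp_δ_of_not_surjective'
      (SimplexCategory.δ i ≫ x.1.1) (⟨val x.1.1 i, by omega⟩ : Fin (p + 2)) (fun l hl => by
        have hl' := congrArg Fin.val hl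
        rw [val_fin] at hl'
        exact hx l (Nat.lt_succ_iff.1 l.2) hl')
    have hv : ∀ l ≤ n, val (SimplexCategory.δ (⟨val x.1.1 i, by omega⟩ : Fin (p + 2))) (val f l) =
        val x.1.1 (val (SimplexCategory.δ i) l) := fun l _ => by
      rw [← val_comp, ← val_comp, hf]
    obtain ⟨hx1, hx2⟩ := (isHor_iff _).1 hx
    dsimp only at hx1 hx2
    -- Past position `i` the index drops by one, and so does the first coordinate, since it lies
    -- strictly beyond the missing value there. The coordinate sum thus stays equal to the index.
    have hsum : ∀ l ≤ n, val f l + val (SimplexCategory.δ i ≫ x.1.2) l = l := fun l hl => by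
      have h1 := hv l hl
      have h2 := x.val_add (val_le (SimplexCategory.δ i) l)
      rw [val_δ _ (val_le f l)] at h1
      rw [val_comp]
      rw [val_δ _ hl] at h1 h2 ⊢
      dsimp only at h1
      by_cases h4 : l < i
      · rw [if_pos h4] at h1 h2 ⊢
        have := hx1 l h4
        have := val_mono x.1.1 h4.le
        split_ifs at h1 <;> omega
      · rw [if_neg h4] at h1 h2 ⊢
        have := hx2 (l + 1) (by omega) (by omega)
        have := val_mono x.1.1 (show (i : ℕ) ≤ l + 1 by omega)
        split_ifs at h1 <;> omega
    let w : Fin (p + 2) × Shuf p q n := (⟨val x.1.1 i, by omega⟩,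
      ⟨(f, SimplexCategory.δ i ≫ x.1.2), fun l => by
        dsimp only
        rw [val_fin, val_fin]
        exact hsum l (by omega)⟩)
    refine ⟨w, Finset.mem_univ _, ?_⟩
    -- The reinserted path has the same face as `x`, so the two agree away from position `i`; at `i`
    -- both have the prescribed first coordinate.
    obtain ⟨e1, e2⟩ := face_unique (z := z w) (z' := (x, i)) ((hz3 w).trans hf.symm) (hz4 w)
    refine Prod.ext (Shuf.val_ext fun l hl => ?_) e1
    by_cases hli : l = (z w).2
    · rw [hli, hz2 w, e1]
    · exact e2 l hl hli
  · intro w _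
    rw [hz3, hz4]

lemma not_isHor_zero {q n : ℕ} (z : Shuf 0 q (n + 1) × Fin (n + 2)) : ¬IsHor z := fun h => by
  have h1 := h 0 (Nat.zero_le n)
  have h2 := val_le (SimplexCategory.δ z.2 ≫ z.1.1.1) 0
  have h3 := val_le z.1.1.1 z.2
  omega

/-- The path has at least two vertices, and a vertex shares one coordinate with each of its
neighbours. -/
lemma IsHor.not_swap {p q n : ℕ} {z : Shuf p q (n + 1) × Fin (n + 2)} (h : IsHor z) :
    ¬IsHor (swapFace z) := fun h' => by
  obtain ⟨a1, a2⟩ := (isHor_iff _).1 h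
  obtain ⟨b1, b2⟩ := (isHor_iff _).1 h'
  have hz := z.2.2
  have e : ∀ l ≤ n + 1, val z.1.1.1 l + val z.1.1.2 l = l := fun l hl => z.1.val_add hl
  have e0 := e z.2 (by omega)
  change ∀ l < (z.2 : ℕ), val z.1.1.2 l ≠ val z.1.1.2 z.2 at b1
  change ∀ l, (z.2 : ℕ) < l → l ≤ n + 1 → val z.1.1.2 l ≠ val z.1.1.2 z.2 at b2
  by_cases h0 : (z.2 : ℕ) = 0
  · have c1 := a2 1 (by omega) (by omega)
    have c2 := b2 1 (by omega) (by omega)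
    have := e 1 (by omega)
    omega
  · have c1 := a1 (z.2 - 1) (by omega)
    have c2 := b1 (z.2 - 1) (by omega)
    have := e (z.2 - 1) (by omega)
    have := val_mono z.1.1.1 (Nat.sub_le (z.2 : ℕ) 1)
    have := val_mono z.1.1.2 (Nat.sub_le (z.2 : ℕ) 1)
    omega

/-- At a corner of the path, the first coordinate makes a step on exactly one side. -/
lemma corner {p q n : ℕ} {z : Shuf p q (n + 1) × Fin (n + 2)} (h : ¬IsHor z)
    (h' : ¬IsHor (swapFace z)) : ∃ i : ℕ, (z.2 : ℕ) = i + 1 ∧ i + 2 ≤ n + 1 ∧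
      val z.1.1.1 (i + 2) = val z.1.1.1 i + 1 ∧ val z.1.1.2 (i + 2) = val z.1.1.2 i + 1 := by
  rw [isHor_iff] at h h'
  have hz := z.2.2
  have e : ∀ l ≤ n + 1, val z.1.1.1 l + val z.1.1.2 l = l := fun l hl => z.1.val_add hl
  have e0 := e z.2 (by omega)
  change ¬((∀ l < (z.2 : ℕ), val z.1.1.2 l ≠ val z.1.1.2 z.2) ∧
    ∀ l, (z.2 : ℕ) < l → l ≤ n + 1 → val z.1.1.2 l ≠ val z.1.1.2 z.2) at h'
  have m1 : ∀ {a b}, a ≤ b → val z.1.1.1 a ≤ val z.1.1.1 b := fun h => val_mono _ h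
  have m2 : ∀ {a b}, a ≤ b → val z.1.1.2 a ≤ val z.1.1.2 b := fun h => val_mono _ h
  -- By monotonicity, a coordinate that recurs anywhere recurs at a neighbour. Each neighbour shares
  -- exactly one coordinate, so the two recurrences occur on opposite sides and the vertex is not an
  -- endpoint.
  have key : ∀ x y : ℕ → ℕ, (∀ {a b}, a ≤ b → x a ≤ x b) →
      ¬((∀ l < (z.2 : ℕ), x l ≠ x z.2) ∧ ∀ l, (z.2 : ℕ) < l → l ≤ n + 1 → x l ≠ x z.2) →
      (0 < (z.2 : ℕ) ∧ x (z.2 - 1) = x z.2) ∨ ((z.2 : ℕ) ≤ n ∧ x (z.2 + 1) = x z.2) := by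
    intro x y hx hn
    rw [not_and_or] at hn
    push Not at hn
    rcases hn with ⟨l, hl, hl'⟩ | ⟨l, hl, hl1, hl'⟩
    · have := hx (show l ≤ z.2 - 1 by omega)
      have := hx (show (z.2 : ℕ) - 1 ≤ z.2 by omega)
      left
      omega
    · have := hx (show (z.2 : ℕ) + 1 ≤ l by omega)
      have := hx (show (z.2 : ℕ) ≤ z.2 + 1 by omega)
      right
      omega
  have k1 := key _ (val z.1.1.2) m1 h
  have k2 := key _ (val z.1.1.1) m2 h'
  have e1 := e (z.2 - 1) (by omega)
  rcases Nat.eq_zero_or_pos (z.2 : ℕ) with h0 | h0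
  · have e2 := e (z.2 + 1) (by omega)
    omega
  · obtain ⟨i, hi⟩ : ∃ i, (z.2 : ℕ) = i + 1 := ⟨z.2 - 1, by omega⟩
    rw [hi, Nat.add_sub_cancel, show i + 1 + 1 = i + 2 from rfl] at k1 k2
    rw [hi, Nat.add_sub_cancel] at e1
    rw [hi] at e0
    by_cases hn : i + 1 ≤ n
    · have e2 := e (i + 2) (by omega)
      refine ⟨i, hi, by omega, ?_, ?_⟩ <;> omega
    · omega

open Classical in
-- Replacing a corner by the opposite vertex of its unit square is a fixed-point-free involution
-- that does not change the face, so the terms cancel in pairs modulo 2.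
lemma sum_corner {p q n : ℕ} [Module (ZMod 2) M] (F : (⦋n⦌ ⟶ ⦋p⦌) → (⦋n⦌ ⟶ ⦋q⦌) → M) :
    ∑ z : Shuf p q (n + 1) × Fin (n + 2) with ¬IsHor z ∧ ¬IsHor (swapFace z),
      F (SimplexCategory.δ z.2 ≫ z.1.1.1) (SimplexCategory.δ z.2 ≫ z.1.1.2) = 0 := by
  -- The flipped path is recorded by an equation for the sum of the old and new coordinates. As the
  -- neighbours stay fixed, this equation is symmetric in the two paths, which later gives the
  -- involution property.
  have key : ∀ z : Shuf p q (n + 1) × Fin (n + 2), ¬IsHor z → ¬IsHor (swapFace z) →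
      ∃ x : Shuf p q (n + 1), x ≠ z.1 ∧
        (∀ l ≤ n + 1, l ≠ z.2 → val x.1.1 l = val z.1.1.1 l ∧ val x.1.2 l = val z.1.1.2 l) ∧
        val x.1.1 z.2 + val z.1.1.1 z.2 = val z.1.1.1 (z.2 - 1) + val z.1.1.1 (z.2 + 1) := by
    intro z h h'
    obtain ⟨i, hi, hin, h1, h2⟩ := corner h h'
    have m1 : ∀ a, val z.1.1.1 a ≤ val z.1.1.1 (a + 1) := fun a => val_mono _ (Nat.le_succ a)
    have m2 : ∀ a, val z.1.1.2 a ≤ val z.1.1.2 (a + 1) := fun a => val_mono _ (Nat.le_succ a)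
    have l1 : ∀ a, val z.1.1.1 a ≤ p := fun a => val_le _ a
    have l2 : ∀ a, val z.1.1.2 a ≤ q := fun a => val_le _ a
    have e : ∀ l ≤ n + 1, val z.1.1.1 l + val z.1.1.2 l = l := fun l hl => z.1.val_add hl
    have e0 := e i (by omega)
    have e1 := e (i + 1) (by omega)
    have c1 := m1 i
    have c2 : val z.1.1.1 (i + 1) ≤ val z.1.1.1 (i + 2) := m1 (i + 1)
    have c3 := m2 i
    have c4 : val z.1.1.2 (i + 1) ≤ val z.1.1.2 (i + 2) := m2 (i + 1)
    -- At the corner each coordinate is `a` or `a + 1`, where `a` is its value at the preceding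
    -- vertex; `2 * a + 1 - _` exchanges these two values.
    obtain ⟨x, hx⟩ := exists_shuf (p := p) (q := q) (n := n + 1)
      (fun l => if l = i + 1 then 2 * val z.1.1.1 i + 1 - val z.1.1.1 (i + 1) else val z.1.1.1 l)
      (fun l => if l = i + 1 then 2 * val z.1.1.2 i + 1 - val z.1.1.2 (i + 1) else val z.1.1.2 l)
      (fun l hl => by
        dsimp only
        by_cases h3 : l = i
        · subst h3
          rw [if_neg (by omega), if_pos rfl]
          omega
        · by_cases h4 : l = i + 1
          · subst h4
            rw [if_pos rfl, if_neg (by omega)]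
            change _ ≤ val z.1.1.1 (i + 2)
            omega
          · rw [if_neg h4, if_neg (by omega)]
            exact m1 l)
      (fun l hl => by
        dsimp only
        by_cases h3 : l = i
        · subst h3
          rw [if_neg (by omega), if_pos rfl]
          omega
        · by_cases h4 : l = i + 1
          · subst h4
            rw [if_pos rfl, if_neg (by omega)]
            change _ ≤ val z.1.1.2 (i + 2)
            omega
          · rw [if_neg h4, if_neg (by omega)]
            exact m2 l)
      (fun l hl => by
        have := l1 l
        have := l1 (i + 2)
        dsimp only
        split_ifs <;> omega)
      (fun l hl => by
        have := l2 l
        have := l2 (i + 2)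
        dsimp only
        split_ifs <;> omega)
      (fun l hl => by
        have := e l hl
        dsimp only
        split_ifs <;> omega)
    have hx1 := (hx (i + 1) (by omega)).1
    rw [if_pos rfl] at hx1
    refine ⟨x, fun hc => ?_, fun l hl hli => ?_, ?_⟩
    · rw [hc] at hx1
      omega
    · have := hx l hl
      rwa [if_neg (by omega), if_neg (by omega)] at this
    · rw [hi, hx1, Nat.add_sub_cancel]
      change _ = _ + val z.1.1.1 (i + 2)
      omega
  have hface : ∀ (z z' : Shuf p q (n + 1) × Fin (n + 2)), z'.2 = z.2 →
      (∀ l ≤ n + 1, l ≠ z.2 →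
        val z'.1.1.1 l = val z.1.1.1 l ∧ val z'.1.1.2 l = val z.1.1.2 l) →
      SimplexCategory.δ z'.2 ≫ z'.1.1.1 = SimplexCategory.δ z.2 ≫ z.1.1.1 ∧
      SimplexCategory.δ z'.2 ≫ z'.1.1.2 = SimplexCategory.δ z.2 ≫ z.1.1.2 := by
    rintro ⟨x, i⟩ ⟨x', i'⟩ hi h
    obtain rfl : i' = i := hi
    dsimp only at h ⊢
    have hne : ∀ l ≤ n, val (SimplexCategory.δ i') l ≠ i' := fun l hl => by
      rw [val_δ _ hl]
      split_ifs <;> omega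
    exact ⟨val_ext fun l hl => by
      rw [val_comp, val_comp]; exact (h _ (val_le _ _) (hne l hl)).1, val_ext fun l hl => by
      rw [val_comp, val_comp]; exact (h _ (val_le _ _) (hne l hl)).2⟩
  -- The flip is extended to all pairs, as the identity away from corners, so that it can be chosen
  -- as a total function.
  have key2 : ∀ z : Shuf p q (n + 1) × Fin (n + 2),
      ∃ z' : Shuf p q (n + 1) × Fin (n + 2), (¬IsHor z ∧ ¬IsHor (swapFace z)) →
        z'.1 ≠ z.1 ∧ z'.2 = z.2 ∧ (∀ l ≤ n + 1, l ≠ z.2 →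
          val z'.1.1.1 l = val z.1.1.1 l ∧ val z'.1.1.2 l = val z.1.1.2 l) ∧
        val z'.1.1.1 z.2 + val z.1.1.1 z.2 = val z.1.1.1 (z.2 - 1) + val z.1.1.1 (z.2 + 1) := by
    intro z
    by_cases h : ¬IsHor z ∧ ¬IsHor (swapFace z)
    · obtain ⟨x, h1, h2, h3⟩ := key z h.1 h.2
      exact ⟨(x, z.2), fun _ => ⟨h1, rfl, h2, h3⟩⟩
    · exact ⟨z, fun h' => absurd h' h⟩
  choose g hg using key2
  have hgc : ∀ z, (¬IsHor z ∧ ¬IsHor (swapFace z)) → ¬IsHor (g z) ∧ ¬IsHor (swapFace (g z)) := by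
    intro z h
    obtain ⟨i, hi, hin, h1, h2⟩ := corner h.1 h.2
    obtain ⟨-, g2, g3, g4⟩ := hg z h
    obtain ⟨a1, a2⟩ := g3 i (by omega) (by omega)
    obtain ⟨b1, b2⟩ := g3 (i + 2) (by omega) (by omega)
    have e0 := (g z).1.val_add (show i ≤ n + 1 by omega)
    have e1 := (g z).1.val_add (show i + 1 ≤ n + 1 by omega)
    have c1 := val_mono (g z).1.1.1 (Nat.le_succ i)
    have c2 := val_mono (g z).1.1.1 (show i + 1 ≤ i + 2 by omega)
    have c3 := val_mono (g z).1.1.2 (Nat.le_succ i)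
    have c4 := val_mono (g z).1.1.2 (show i + 1 ≤ i + 2 by omega)
    simp only [Nat.succ_eq_add_one] at c1 c3
    refine ⟨fun hc => ?_, fun hc => ?_⟩
    · obtain ⟨p1, p2⟩ := (isHor_iff _).1 hc
      rw [g2, hi] at p1 p2
      have := p1 i (by omega)
      have := p2 (i + 2) (by omega) (by omega)
      omega
    · obtain ⟨p1, p2⟩ := (isHor_iff _).1 hc
      change ∀ l < ((g z).2 : ℕ), val (g z).1.1.2 l ≠ val (g z).1.1.2 (g z).2 at p1
      change ∀ l, ((g z).2 : ℕ) < l → l ≤ n + 1 → val (g z).1.1.2 l ≠ val (g z).1.1.2 (g z).2 at p2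
      rw [g2, hi] at p1 p2
      have := p1 i (by omega)
      have := p2 (i + 2) (by omega) (by omega)
      omega
  refine Finset.sum_involution (fun z _ => g z) ?_ ?_ ?_ ?_
  · intro z hz
    simp only [Finset.mem_filter, Finset.mem_univ, true_and] at hz
    obtain ⟨-, g2, g3, -⟩ := hg z hz
    obtain ⟨f1, f2⟩ := hface z (g z) g2 g3
    dsimp only
    rw [f1, f2]
    exact ZModModule.add_self _
  · intro z hz _ hc
    simp only [Finset.mem_filter, Finset.mem_univ, true_and] at hz
    exact (hg z hz).1 (by rw [hc])
  · intro z hz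
    simp only [Finset.mem_filter, Finset.mem_univ, true_and] at hz ⊢
    exact hgc z hz
  · intro z hz
    simp only [Finset.mem_filter, Finset.mem_univ, true_and] at hz
    obtain ⟨i, hi, hin, -, -⟩ := corner hz.1 hz.2
    obtain ⟨g1, g2, g3, g4⟩ := hg z hz
    obtain ⟨k1, k2, k3, k4⟩ := hg (g z) (hgc z hz)
    refine Prod.ext (Shuf.val_ext fun l hl => ?_) (k2.trans g2)
    by_cases hl' : l = z.2
    · rw [g2, hi, Nat.add_sub_cancel, (g3 i (by omega) (by omega)).1,
        (g3 (i + 1 + 1) (by omega) (by omega)).1] at k4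
      rw [hi, Nat.add_sub_cancel] at g4
      rw [hl', hi]
      omega
    · rw [(k3 l hl (by rwa [g2])).1, (g3 l hl hl').1]

open Classical in
lemma sum_faces {p q n : ℕ} [Module (ZMod 2) M] (F : (⦋n⦌ ⟶ ⦋p⦌) → (⦋n⦌ ⟶ ⦋q⦌) → M) :
    ∑ z : Shuf p q (n + 1) × Fin (n + 2),
      F (SimplexCategory.δ z.2 ≫ z.1.1.1) (SimplexCategory.δ z.2 ≫ z.1.1.2) =
    ∑ z : Shuf p q (n + 1) × Fin (n + 2) with IsHor z,
      F (SimplexCategory.δ z.2 ≫ z.1.1.1) (SimplexCategory.δ z.2 ≫ z.1.1.2) +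
    ∑ z : Shuf q p (n + 1) × Fin (n + 2) with IsHor z,
      F (SimplexCategory.δ z.2 ≫ z.1.1.2) (SimplexCategory.δ z.2 ≫ z.1.1.1) := by
  have h1 : ∑ z : Shuf q p (n + 1) × Fin (n + 2) with IsHor z,
      F (SimplexCategory.δ z.2 ≫ z.1.1.2) (SimplexCategory.δ z.2 ≫ z.1.1.1) =
      ∑ z : Shuf p q (n + 1) × Fin (n + 2) with ¬IsHor z ∧ IsHor (swapFace z),
        F (SimplexCategory.δ z.2 ≫ z.1.1.1) (SimplexCategory.δ z.2 ≫ z.1.1.2) := by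
    refine Finset.sum_equiv swapFace (fun z => ?_) (fun z _ => rfl)
    simp only [Finset.mem_filter, Finset.mem_univ, true_and]
    exact ⟨fun h => ⟨h.not_swap, h⟩, fun h => h.2⟩
  rw [h1, ← Finset.sum_filter_add_sum_filter_not Finset.univ IsHor]
  congr 1
  rw [← Finset.sum_filter_add_sum_filter_not (Finset.univ.filter fun z => ¬IsHor z)
    (fun z => IsHor (swapFace z)), Finset.filter_filter, Finset.filter_filter, sum_corner, add_zero]

end

/-! ### The shuffle map is a chain map -/

lemma neg_one_pow_zsmul {M : Type*} [AddCommGroup M] [Module (ZMod 2) M] (i : ℕ) (x : M) :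
    (-1 : ℤ) ^ i • x = x := by
  rcases Nat.even_or_odd i with h | h
  · rw [h.neg_one_pow, one_smul]
  · rw [h.neg_one_pow, neg_one_zsmul, ZModModule.neg_eq_self]

lemma bdry_eq_sum (A : SMod.{u}) (n : ℕ) (x : A.obj (op ⦋n + 1⦌)) :
    bdry A n x = ∑ i : Fin (n + 2), (A.map (SimplexCategory.δ i).op).hom x := by
  rw [bdry_apply]
  exact Finset.sum_congr rfl fun i _ => neg_one_pow_zsmul _ _

lemma cobdry_eq_sum (W : CMod.{u}) (n : ℕ) (x : W.obj ⦋n⦌) :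
    cobdry W n x = ∑ i : Fin (n + 2), (W.map (SimplexCategory.δ i)).hom x := by
  rw [cobdry_apply]
  exact Finset.sum_congr rfl fun i _ => neg_one_pow_zsmul _ _

lemma map_op_comp (A : SMod.{u}) {a b c : SimplexCategory} (f : a ⟶ b) (g : b ⟶ c)
    (x : A.obj (op c)) : (A.map (f ≫ g).op).hom x = (A.map f.op).hom ((A.map g.op).hom x) := by
  rw [op_comp, A.map_comp]
  rfl

/-- The sum over the horizontal faces. -/
def shufLeft (A B : SMod.{u}) (p q n : ℕ) (a : A.obj (op ⦋p⦌)) (b : B.obj (op ⦋q⦌)) :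
    (tens A B).obj (op ⦋n⦌) :=
  match p with
  | 0 => 0
  | p + 1 => shuf A B p q n (bdry A p a) b

/-- The sum over the vertical faces. -/
def shufRight (A B : SMod.{u}) (p q n : ℕ) (a : A.obj (op ⦋p⦌)) (b : B.obj (op ⦋q⦌)) :
    (tens A B).obj (op ⦋n⦌) :=
  match q with
  | 0 => 0
  | q + 1 => shuf A B p q n a (bdry B q b)

open Classical in
-- The horizontal faces give `∂a`, the vertical ones give `∂b`, and the corners cancel. The rule
-- thus holds before degenerate elements are divided out.
lemma bdry_shuf (A B : SMod.{u}) {p q n : ℕ} (h : p + q = n + 1) (a : A.obj (op ⦋p⦌))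
    (b : B.obj (op ⦋q⦌)) :
    bdry (tens A B) n (shuf A B p q (n + 1) a b) =
      shufLeft A B p q n a b + shufRight A B p q n a b := by
  let F : (⦋n⦌ ⟶ ⦋p⦌) → (⦋n⦌ ⟶ ⦋q⦌) → (tens A B).obj (op ⦋n⦌) := fun u v =>
    tm A B (op ⦋n⦌) ((A.map u.op).hom a) ((B.map v.op).hom b)
  have h0 : bdry (tens A B) n (shuf A B p q (n + 1) a b) =
      ∑ z : Shuf p q (n + 1) × Fin (n + 2),
        F (SimplexCategory.δ z.2 ≫ z.1.1.1) (SimplexCategory.δ z.2 ≫ z.1.1.2) := by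
    rw [Fintype.sum_prod_type, shuf_apply, map_sum]
    refine Finset.sum_congr rfl fun x _ => ?_
    rw [bdry_eq_sum]
    refine Finset.sum_congr rfl fun i _ => ?_
    dsimp only [F]
    rw [map_op_comp, map_op_comp]
    rfl
  rw [h0, sum_faces]
  congr 1
  · cases p with
    | zero =>
      refine Finset.sum_eq_zero fun z hz => absurd (Finset.mem_filter.1 hz).2 (not_isHor_zero z)
    | succ p =>
      rw [sum_isHor h, Fintype.sum_prod_type, shufLeft, bdry_eq_sum, map_sum,
        LinearMap.sum_apply]
      refine Finset.sum_congr rfl fun j _ => ?_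
      rw [shuf_apply]
      refine Finset.sum_congr rfl fun y _ => ?_
      dsimp only [F]
      rw [map_op_comp]
  · cases q with
    | zero =>
      refine Finset.sum_eq_zero fun z hz => absurd (Finset.mem_filter.1 hz).2 (not_isHor_zero z)
    | succ q =>
      rw [sum_isHor (by omega) (fun u v => F v u), Fintype.sum_prod_type, shufRight, bdry_eq_sum,
        map_sum]
      refine Finset.sum_congr rfl fun j _ => ?_
      rw [shuf_apply]
      refine Fintype.sum_equiv ⟨Shuf.swap, Shuf.swap, fun _ => rfl, fun _ => rfl⟩ _ _ fun y => ?_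
      dsimp only [F]
      rw [map_op_comp]
      rfl

/-- The shuffle map `N_p(A) ⊗ N_q(B) → N_n(A ⊗ B)`, set to zero unless `n = p + q`. -/
def nab (A B : SMod.{u}) (p q n : ℕ) :
    NObj A p →ₗ[ZMod 2] NObj B q →ₗ[ZMod 2] NObj (tens A B) n :=
  if h : p + q = n then nabla A B h else 0

lemma nab_eq (A B : SMod.{u}) {p q n : ℕ} (h : p + q = n) : nab A B p q n = nabla A B h :=
  dif_pos h

lemma nab_mk (A B : SMod.{u}) {p q n : ℕ} (h : p + q = n) (a : A.obj (op ⦋p⦌))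
    (b : B.obj (op ⦋q⦌)) : nab A B p q n (Submodule.Quotient.mk a) (Submodule.Quotient.mk b) =
      Submodule.Quotient.mk (shuf A B p q n a b) := by
  rw [nab_eq A B h]
  rfl

lemma nablaN_apply (A B : SMod.{u}) (x : ∀ n, NObj A n) (y : ∀ n, NObj B n) (n : ℕ) :
    (nablaN A B x y : ∀ n, NObj (tens A B) n) n =
      ∑ i ∈ Finset.HasAntidiagonal.antidiagonal n, nab A B i.1 i.2 n (x i.1) (y i.2) := by
  refine Eq.trans ?_ (Finset.sum_coe_sort (M := NObj (tens A B) n)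
    (Finset.HasAntidiagonal.antidiagonal n) fun i : ℕ × ℕ => nab A B i.1 i.2 n (x i.1) (y i.2))
  change ∑ i : ↥(Finset.HasAntidiagonal.antidiagonal n),
    nabla A B (Finset.HasAntidiagonal.mem_antidiagonal.1 i.2) (x i.1.1) (y i.1.2) = _
  refine Finset.sum_congr rfl fun i _ => ?_
  rw [nab_eq A B (Finset.HasAntidiagonal.mem_antidiagonal.1 i.2)]

/-- The terms of the Leibniz rule for `nab`. -/
def nabLeft (A B : SMod.{u}) (p q n : ℕ) (x : NObj A p) (y : NObj B q) : NObj (tens A B) n :=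
  match p with
  | 0 => 0
  | p + 1 => nab A B p q n (Nd A p x) y

/-- The terms of the Leibniz rule for `nab`. -/
def nabRight (A B : SMod.{u}) (p q n : ℕ) (x : NObj A p) (y : NObj B q) : NObj (tens A B) n :=
  match q with
  | 0 => 0
  | q + 1 => nab A B p q n x (Nd B q y)

lemma Nd_mk (A : SMod.{u}) (n : ℕ) (a : A.obj (op ⦋n + 1⦌)) :
    Nd A n (Submodule.Quotient.mk a) = Submodule.Quotient.mk (bdry A n a) := rfl

lemma Nd_nab (A B : SMod.{u}) {p q n : ℕ} (h : p + q = n + 1) (x : NObj A p) (y : NObj B q) :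
    Nd (tens A B) n (nab A B p q (n + 1) x y) =
      nabLeft A B p q n x y + nabRight A B p q n x y := by
  obtain ⟨a, rfl⟩ := Submodule.Quotient.mk_surjective _ x
  obtain ⟨b, rfl⟩ := Submodule.Quotient.mk_surjective _ y
  rw [nab_mk A B h, Nd_mk, bdry_shuf A B h, Submodule.Quotient.mk_add]
  congr 1
  · cases p with
    | zero => rfl
    | succ p =>
      rw [nabLeft, Nd_mk, nab_mk A B (by omega)]
      rfl
  · cases q with
    | zero => rfl
    | succ q =>
      rw [nabRight, Nd_mk, nab_mk A B (by omega)]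
      rfl

lemma d_nablaN (A B : SMod.{u}) (x : (N A).carrier) (y : (N B).carrier) :
    (N (tens A B)).d (nablaN A B x y) = nablaN A B ((N A).d x) y + nablaN A B x ((N B).d y) := by
  funext n
  change Nd (tens A B) n ((nablaN A B x y : ∀ n, NObj (tens A B) n) (n + 1)) =
    (nablaN A B ((N A).d x) y : ∀ n, NObj (tens A B) n) n +
      (nablaN A B x ((N B).d y) : ∀ n, NObj (tens A B) n) n
  rw [nablaN_apply, nablaN_apply, nablaN_apply, map_sum, Finset.sum_congr rfl fun i hi =>
    Nd_nab A B (Finset.HasAntidiagonal.mem_antidiagonal.1 hi) _ _, Finset.sum_add_distrib]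
  congr 1
  -- The term of first degree zero vanishes; lowering the first degree in the other terms reindexes
  -- them by the antidiagonal of `n`.
  · rw [Finset.Nat.sum_antidiagonal_succ]
    refine (zero_add (_ : NObj (tens A B) n)).trans ?_
    rfl
  · rw [Finset.Nat.sum_antidiagonal_succ']
    refine (zero_add (_ : NObj (tens A B) n)).trans ?_
    rfl

lemma NMap_apply {A B : SMod.{u}} (f : A ⟶ B) (x : ∀ n, NObj A n) (n : ℕ) :
    (NMap f x : ∀ n, NObj B n) n = ((NFun n).map f).hom (x n) := rfl

lemma NMap_nablaN {A A' B B' : SMod.{u}} (f : A ⟶ A') (g : B ⟶ B') (x : (N A).carrier)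
    (y : (N B).carrier) :
    NMap (tensMap f g) (nablaN A B x y) = nablaN A' B' (NMap f x) (NMap g y) := by
  funext n
  rw [NMap_apply, nablaN_apply, nablaN_apply, map_sum]
  refine Finset.sum_congr rfl fun i hi => ?_
  rw [nab_eq A B (Finset.HasAntidiagonal.mem_antidiagonal.1 hi),
    nab_eq A' B' (Finset.HasAntidiagonal.mem_antidiagonal.1 hi),
    nabla_naturality]
  rfl

lemma NMap_comp {A B C : SMod.{u}} (f : A ⟶ B) (g : B ⟶ C) (x : (N A).carrier) :
    NMap (f ≫ g) x = NMap g (NMap f x) := by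
  funext n
  rw [NMap_apply, NMap_apply, NMap_apply, (NFun n).map_comp]
  rfl

lemma NMap_id (A : SMod.{u}) (x : (N A).carrier) : NMap (𝟙 A) x = x := by
  funext n
  rw [NMap_apply, (NFun n).map_id]
  rfl

lemma NMap_d {A B : SMod.{u}} (f : A ⟶ B) (x : (N A).carrier) :
    NMap f ((N A).d x) = (N B).d (NMap f x) :=
  funext fun n => (ConcreteCategory.congr_hom ((NBdry n).naturality f) (x (n + 1))).symm

lemma NMap_mem {A B : SMod.{u}} (f : A ⟶ B) {m : ℤ} {x : (N A).carrier} (hx : x ∈ (N A).deg m) :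
    NMap f x ∈ (N B).deg m := fun n hn => by
  rw [NMap_apply, hx n hn, map_zero]

lemma nablaN_mem (A B : SMod.{u}) {m n : ℤ} {x : (N A).carrier} {y : (N B).carrier}
    (hx : x ∈ (N A).deg m) (hy : y ∈ (N B).deg n) :
    nablaN A B x y ∈ (N (tens A B)).deg (m + n) := fun k hk => by
  rw [nablaN_apply]
  refine Finset.sum_eq_zero fun i hi => ?_
  have := Finset.HasAntidiagonal.mem_antidiagonal.1 hi
  by_cases h : (i.1 : ℤ) = m
  · rw [hy i.2 (by omega), map_zero]
  · rw [hx i.1 h, map_zero, LinearMap.zero_apply]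

/-! ### Symmetry of fourfold products -/

/-- A discrete intermediate value argument: the first coordinate climbs from `0` to `P` by steps of
at most one. -/
lemma exists_val_eq {P R n : ℕ} (hn : P + R = n) (x : Shuf P R n) {l : ℕ} (hl : l ≤ P) :
    ∃ i ≤ n, val x.1.1 i = l := by
  classical
  have h0 := x.val_add (Nat.zero_le n)
  have hP : ∃ i, l ≤ val x.1.1 i := ⟨n, by
    have h1 := x.val_add le_rfl
    have h2 := val_le x.1.2 n
    omega⟩
  have hle : Nat.find hP ≤ n := Nat.find_min' hP (by
    have h1 := x.val_add le_rfl
    have h2 := val_le x.1.2 n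
    omega)
  refine ⟨Nat.find hP, hle, ?_⟩
  have h1 := Nat.find_spec hP
  rcases Nat.eq_zero_or_pos (Nat.find hP) with h | h
  · rw [h] at h1 ⊢
    omega
  · have h2 := Nat.find_min hP (Nat.sub_lt h one_pos)
    have h3 := x.val_add hle
    have h4 := x.val_add ((Nat.sub_le _ 1).trans hle)
    have h5 := val_mono x.1.2 (Nat.sub_le (Nat.find hP) 1)
    omega

/-- Where the first coordinate of `x` is constant, `f` and `g` are monotone with constant sum, hence
both constant. They therefore factor through that coordinate; the factors are obtained by composing
with a section `s` of it. -/
lemma exists_shuf_factor {p q R n : ℕ} (hn : p + q + R = n) (x : Shuf (p + q) R n)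
    (f : ⦋n⦌ ⟶ ⦋p⦌) (g : ⦋n⦌ ⟶ ⦋q⦌) (h : ∀ i ≤ n, val x.1.1 i = val f i + val g i) :
    ∃ y : Shuf p q (p + q), x.1.1 ≫ y.1.1 = f ∧ x.1.1 ≫ y.1.2 = g := by
  have hs : ∀ l, ∃ i, l ≤ p + q → i ≤ n ∧ val x.1.1 i = l := fun l => by
    by_cases hl : l ≤ p + q
    · obtain ⟨i, hi, hi'⟩ := exists_val_eq hn x hl
      exact ⟨i, fun _ => ⟨hi, hi'⟩⟩
    · exact ⟨0, fun h => absurd h hl⟩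
  choose s hs using hs
  have smono : ∀ l < p + q, s l ≤ s (l + 1) := fun l hl => by
    by_contra hc
    have := val_mono x.1.1 (show s (l + 1) ≤ s l by omega)
    rw [(hs l hl.le).2, (hs (l + 1) hl).2] at this
    omega
  obtain ⟨y, hy⟩ := exists_shuf (p := p) (q := q) (n := p + q) (fun l => val f (s l))
    (fun l => val g (s l)) (fun l hl => val_mono _ (smono l hl))
    (fun l hl => val_mono _ (smono l hl)) (fun l _ => val_le _ _) (fun l _ => val_le _ _)
    (fun l hl => by
      have h1 := hs l hl
      have h2 := h (s l) h1.1
      omega)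
  have key : ∀ i ≤ n, val f (s (val x.1.1 i)) = val f i ∧ val g (s (val x.1.1 i)) = val g i := by
    intro i hi
    obtain ⟨h1, h2⟩ := hs (val x.1.1 i) (val_le _ _)
    have h4 := h _ h1
    have h5 := h _ hi
    rcases le_total i (s (val x.1.1 i)) with h3 | h3
    · have := val_mono f h3
      have := val_mono g h3
      omega
    · have := val_mono f h3
      have := val_mono g h3
      omega
  refine ⟨y, val_ext fun i hi => ?_, val_ext fun i hi => ?_⟩
  · rw [val_comp, (hy _ (val_le _ _)).1, (key i hi).1]
  · rw [val_comp, (hy _ (val_le _ _)).2, (key i hi).2]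

/-- The shuffles of four simplices. -/
abbrev Shuf₄ (p q r s n : ℕ) : Type :=
  {w : ((⦋n⦌ ⟶ ⦋p⦌) × (⦋n⦌ ⟶ ⦋q⦌)) × (⦋n⦌ ⟶ ⦋r⦌) × (⦋n⦌ ⟶ ⦋s⦌) //
    ∀ i ≤ n, val w.1.1 i + val w.1.2 i + (val w.2.1 i + val w.2.2 i) = i}

instance (p q r s n : ℕ) : Fintype (Shuf₄ p q r s n) := Fintype.ofFinite _

/-- An iterated shuffle is the same as a lattice path in a product of four simplices. Adding
coordinates in pairs recovers the outer shuffle, and factoring through its components recovers the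
inner ones. -/
lemma sum_shuf_shuf {M : Type*} [AddCommMonoid M] {p q r s n : ℕ} (hn : p + q + (r + s) = n)
    (F : (⦋n⦌ ⟶ ⦋p⦌) → (⦋n⦌ ⟶ ⦋q⦌) → (⦋n⦌ ⟶ ⦋r⦌) → (⦋n⦌ ⟶ ⦋s⦌) → M) :
    ∑ x : Shuf (p + q) (r + s) n, ∑ y : Shuf p q (p + q), ∑ z : Shuf r s (r + s),
      F (x.1.1 ≫ y.1.1) (x.1.1 ≫ y.1.2) (x.1.2 ≫ z.1.1) (x.1.2 ≫ z.1.2) =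
    ∑ w : Shuf₄ p q r s n, F w.1.1.1 w.1.1.2 w.1.2.1 w.1.2.2 := by
  have e : ∀ x : Shuf (p + q) (r + s) n, ∀ y : Shuf p q (p + q), ∀ z : Shuf r s (r + s),
      ∀ i, val (x.1.1 ≫ y.1.1) i + val (x.1.1 ≫ y.1.2) i = val x.1.1 i ∧
        val (x.1.2 ≫ z.1.1) i + val (x.1.2 ≫ z.1.2) i = val x.1.2 i := fun x y z i => by
    rw [val_comp, val_comp, val_comp, val_comp]
    exact ⟨y.val_add (val_le _ _), z.val_add (val_le _ _)⟩
  simp_rw [← Fintype.sum_prod_type']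
  refine Fintype.sum_bijective
    (fun t : Shuf (p + q) (r + s) n × Shuf p q (p + q) × Shuf r s (r + s) =>
      (⟨((t.1.1.1 ≫ t.2.1.1.1, t.1.1.1 ≫ t.2.1.1.2), t.1.1.2 ≫ t.2.2.1.1, t.1.1.2 ≫ t.2.2.1.2),
        fun i hi => by
          obtain ⟨h1, h2⟩ := e t.1 t.2.1 t.2.2 i
          dsimp only
          rw [h1, h2]
          exact t.1.val_add hi⟩ : Shuf₄ p q r s n)) ⟨?_, ?_⟩ _ _ (fun _ => rfl)
  · rintro ⟨x, y, z⟩ ⟨x', y', z'⟩ h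
    simp only [Subtype.mk.injEq, Prod.mk.injEq] at h
    obtain ⟨⟨h1, h2⟩, h3, h4⟩ := h
    have hx : x = x' := Shuf.val_ext fun i _ => by
      rw [← (e x y z i).1, ← (e x' y' z' i).1, h1, h2]
    subst hx
    -- The components of the outer shuffle are surjective, so the composites determine the inner
    -- shuffles.
    have hy : y = y' := Shuf.val_ext fun l hl => by
      obtain ⟨i, -, rfl⟩ := exists_val_eq hn x hl
      rw [← val_comp, h1, val_comp]
    have hz : z = z' := Shuf.val_ext fun l hl => by
      obtain ⟨i, -, rfl⟩ := exists_val_eq (by omega) x.swap hl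
      change val z.1.1 (val x.1.2 i) = val z'.1.1 (val x.1.2 i)
      rw [← val_comp, h3, val_comp]
    rw [hy, hz]
  · rintro ⟨⟨⟨a, b⟩, c, d⟩, h⟩
    obtain ⟨x, hx⟩ := exists_shuf (p := p + q) (q := r + s) (n := n) (fun i => val a i + val b i)
      (fun i => val c i + val d i)
      (fun i _ => add_le_add (val_mono a (Nat.le_succ i)) (val_mono b (Nat.le_succ i)))
      (fun i _ => add_le_add (val_mono c (Nat.le_succ i)) (val_mono d (Nat.le_succ i)))
      (fun i _ => add_le_add (val_le _ _) (val_le _ _))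
      (fun i _ => add_le_add (val_le _ _) (val_le _ _)) h
    obtain ⟨y, hy1, hy2⟩ := exists_shuf_factor hn x a b fun i hi => (hx i hi).1
    obtain ⟨z, hz1, hz2⟩ := exists_shuf_factor (by omega) x.swap c d fun i hi => (hx i hi).2
    change x.1.2 ≫ z.1.1 = c at hz1
    change x.1.2 ≫ z.1.2 = d at hz2
    exact ⟨(x, y, z), Subtype.ext (by simp only [hy1, hy2, hz1, hz2])⟩

/-- Exchange of the two middle factors. -/
def middle (A B C D : SMod.{u}) : tens (tens A B) (tens C D) ⟶ tens (tens A C) (tens B D) where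
  app c := ModuleCat.ofHom (TensorProduct.tensorTensorTensorComm (ZMod 2) (A.obj c) (B.obj c)
    (C.obj c) (D.obj c)).toLinearMap
  naturality c c' f := by
    refine ModuleCat.hom_ext (TensorProduct.ext_fourfold' fun w x y z => rfl)

lemma shuf_shuf (A B C D : SMod.{u}) {p q r s n : ℕ} (hn : p + q + (r + s) = n)
    (a : A.obj (op ⦋p⦌)) (b : B.obj (op ⦋q⦌)) (c : C.obj (op ⦋r⦌)) (d : D.obj (op ⦋s⦌)) :
    shuf (tens A B) (tens C D) (p + q) (r + s) n (shuf A B p q (p + q) a b)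
      (shuf C D r s (r + s) c d) = ∑ w : Shuf₄ p q r s n,
        tm (tens A B) (tens C D) (op ⦋n⦌)
          (tm A B (op ⦋n⦌) ((A.map w.1.1.1.op).hom a) ((B.map w.1.1.2.op).hom b))
          (tm C D (op ⦋n⦌) ((C.map w.1.2.1.op).hom c) ((D.map w.1.2.2.op).hom d)) := by
  rw [← sum_shuf_shuf hn fun w₁ w₂ w₃ w₄ => tm (tens A B) (tens C D) (op ⦋n⦌)
    (tm A B (op ⦋n⦌) ((A.map w₁.op).hom a) ((B.map w₂.op).hom b))
    (tm C D (op ⦋n⦌) ((C.map w₃.op).hom c) ((D.map w₄.op).hom d)), shuf_apply]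
  refine Finset.sum_congr rfl fun x _ => ?_
  rw [shuf_apply, shuf_apply, map_sum, map_sum, map_sum, LinearMap.sum_apply]
  refine Finset.sum_congr rfl fun y _ => ?_
  rw [map_sum]
  refine Finset.sum_congr rfl fun z _ => ?_
  rw [map_op_comp, map_op_comp, map_op_comp, map_op_comp]
  rfl

/-- In the description by fourfold paths the four factors play equal roles, so exchanging the middle
ones only reindexes the sum. -/
lemma middle_shuf (A B C D : SMod.{u}) {p q r s n : ℕ} (hn : p + q + (r + s) = n)
    (a : A.obj (op ⦋p⦌)) (b : B.obj (op ⦋q⦌)) (c : C.obj (op ⦋r⦌)) (d : D.obj (op ⦋s⦌)) :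
    ((middle A B C D).app (op ⦋n⦌)).hom (shuf (tens A B) (tens C D) (p + q) (r + s) n
      (shuf A B p q (p + q) a b) (shuf C D r s (r + s) c d)) =
    shuf (tens A C) (tens B D) (p + r) (q + s) n
      (shuf A C p r (p + r) a c) (shuf B D q s (q + s) b d) := by
  rw [shuf_shuf A B C D hn, shuf_shuf A C B D (by omega), map_sum]
  refine Fintype.sum_equiv ⟨fun w => ⟨((w.1.1.1, w.1.2.1), w.1.1.2, w.1.2.2), fun i hi => by
    have := w.2 i hi; dsimp only; omega⟩, fun w => ⟨((w.1.1.1, w.1.2.1), w.1.1.2, w.1.2.2),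
    fun i hi => by have := w.2 i hi; dsimp only; omega⟩, fun _ => rfl, fun _ => rfl⟩ _ _ fun w => ?_
  rfl

lemma middle_nab (A B C D : SMod.{u}) {p q r s n : ℕ} (hn : p + q + (r + s) = n)
    (a : NObj A p) (b : NObj B q) (c : NObj C r) (d : NObj D s) :
    ((NFun n).map (middle A B C D)).hom (nab (tens A B) (tens C D) (p + q) (r + s) n
      (nab A B p q (p + q) a b) (nab C D r s (r + s) c d)) =
    nab (tens A C) (tens B D) (p + r) (q + s) n
      (nab A C p r (p + r) a c) (nab B D q s (q + s) b d) := by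
  obtain ⟨a, rfl⟩ := Submodule.Quotient.mk_surjective _ a
  obtain ⟨b, rfl⟩ := Submodule.Quotient.mk_surjective _ b
  obtain ⟨c, rfl⟩ := Submodule.Quotient.mk_surjective _ c
  obtain ⟨d, rfl⟩ := Submodule.Quotient.mk_surjective _ d
  rw [nab_mk A B rfl, nab_mk C D rfl, nab_mk A C rfl, nab_mk B D rfl, nab_mk _ _ hn,
    nab_mk _ _ (by omega), ← middle_shuf A B C D hn]
  rfl

/-- The intermediate degrees are written as sums of the four individual degrees, so that regrouping
the factors needs no transport between equal degrees. -/
lemma nablaN_nablaN (A B C D : SMod.{u}) (a : (N A).carrier) (b : (N B).carrier)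
    (c : (N C).carrier) (d : (N D).carrier) (n : ℕ) :
    (nablaN (tens A B) (tens C D) (nablaN A B a b) (nablaN C D c d) : ∀ n, NObj _ n) n =
      ∑ i ∈ Finset.HasAntidiagonal.antidiagonal n,
        ∑ j ∈ Finset.HasAntidiagonal.antidiagonal i.1 ×ˢ Finset.HasAntidiagonal.antidiagonal i.2,
          nab (tens A B) (tens C D) (j.1.1 + j.1.2) (j.2.1 + j.2.2) n
            (nab A B j.1.1 j.1.2 (j.1.1 + j.1.2) (a j.1.1) (b j.1.2))
            (nab C D j.2.1 j.2.2 (j.2.1 + j.2.2) (c j.2.1) (d j.2.2)) := by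
  rw [nablaN_apply]
  refine Finset.sum_congr rfl fun i _ => ?_
  rw [nablaN_apply, nablaN_apply, LinearMap.map_sum₂, Finset.sum_product]
  refine Finset.sum_congr rfl fun j hj => ?_
  rw [map_sum]
  refine Finset.sum_congr rfl fun k hk => ?_
  obtain ⟨i₁, i₂⟩ := i
  obtain rfl := Finset.HasAntidiagonal.mem_antidiagonal.1 hj
  obtain rfl := Finset.HasAntidiagonal.mem_antidiagonal.1 hk
  rfl

lemma middle_nablaN (A B C D : SMod.{u}) (a : (N A).carrier) (b : (N B).carrier)
    (c : (N C).carrier) (d : (N D).carrier) :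
    NMap (middle A B C D) (nablaN (tens A B) (tens C D) (nablaN A B a b) (nablaN C D c d)) =
      nablaN (tens A C) (tens B D) (nablaN A C a c) (nablaN B D b d) := by
  funext n
  rw [NMap_apply, nablaN_nablaN, nablaN_nablaN, map_sum]
  simp_rw [map_sum]
  rw [Finset.sum_sigma', Finset.sum_sigma']
  refine Finset.sum_bij'
    (fun t _ => ⟨(t.2.1.1 + t.2.2.1, t.2.1.2 + t.2.2.2),
      ((t.2.1.1, t.2.2.1), (t.2.1.2, t.2.2.2))⟩)
    (fun t _ => ⟨(t.2.1.1 + t.2.2.1, t.2.1.2 + t.2.2.2),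
      ((t.2.1.1, t.2.2.1), (t.2.1.2, t.2.2.2))⟩) ?_ ?_ ?_ ?_ ?_
  · rintro ⟨⟨i₁, i₂⟩, ⟨j₁, j₂⟩, k₁, k₂⟩ h
    simp only [Finset.mem_sigma, Finset.mem_product,
      Finset.HasAntidiagonal.mem_antidiagonal] at h ⊢
    exact ⟨by omega, trivial, trivial⟩
  · rintro ⟨⟨i₁, i₂⟩, ⟨j₁, j₂⟩, k₁, k₂⟩ h
    simp only [Finset.mem_sigma, Finset.mem_product,
      Finset.HasAntidiagonal.mem_antidiagonal] at h ⊢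
    exact ⟨by omega, trivial, trivial⟩
  · rintro ⟨⟨i₁, i₂⟩, ⟨j₁, j₂⟩, k₁, k₂⟩ h
    simp only [Finset.mem_sigma, Finset.mem_product,
      Finset.HasAntidiagonal.mem_antidiagonal] at h
    obtain ⟨-, rfl, rfl⟩ := h
    rfl
  · rintro ⟨⟨i₁, i₂⟩, ⟨j₁, j₂⟩, k₁, k₂⟩ h
    simp only [Finset.mem_sigma, Finset.mem_product,
      Finset.HasAntidiagonal.mem_antidiagonal] at h
    obtain ⟨-, rfl, rfl⟩ := h
    rfl
  · rintro ⟨⟨i₁, i₂⟩, ⟨j₁, j₂⟩, k₁, k₂⟩ h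
    simp only [Finset.mem_sigma, Finset.mem_product,
      Finset.HasAntidiagonal.mem_antidiagonal] at h
    exact middle_nab A B C D (by dsimp only; omega) _ _ _ _

/-! ### Families of chains on a cosimplicial simplicial module -/

/-- The alternating sum of the cofaces on `N(V^p)`. -/
def codiff (V : CSMod.{u}) (p : ℕ) (x : (N (V.obj ⦋p⦌)).carrier) : (N (V.obj ⦋p + 1⦌)).carrier :=
  ∑ i : Fin (p + 2), NMap (V.map (SimplexCategory.δ i)) x

/-- The cosimplicial part of the differential of a family of chains `X_p ∈ N(V^p)`. -/
def prevD (V : CSMod.{u}) (X : ∀ p, (N (V.obj ⦋p⦌)).carrier) (p : ℕ) : (N (V.obj ⦋p⦌)).carrier :=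
  match p with
  | 0 => 0
  | p + 1 => codiff V p (X p)

/-- The total differential of a family of chains `X_p ∈ N(V^p)`. -/
def famD (V : CSMod.{u}) (X : ∀ p, (N (V.obj ⦋p⦌)).carrier) (p : ℕ) : (N (V.obj ⦋p⦌)).carrier :=
  (N (V.obj ⦋p⦌)).d (X p) + prevD V X p

lemma NMap_map_map (V : CSMod.{u}) {p q r : SimplexCategory} (f : p ⟶ q) (g : q ⟶ r)
    (x : (N (V.obj p)).carrier) : NMap (V.map g) (NMap (V.map f) x) = NMap (V.map (f ≫ g)) x := by
  rw [V.map_comp, NMap_comp]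

lemma NMap_tensor_map (U V : CSMod.{u}) {p q : SimplexCategory} (f : p ⟶ q)
    (x : (N (U.obj p)).carrier) (y : (N (V.obj p)).carrier) :
    NMap ((U.tensor V).map f) (nablaN (U.obj p) (V.obj p) x y) =
      nablaN (U.obj q) (V.obj q) (NMap (U.map f) x) (NMap (V.map f) y) :=
  NMap_nablaN _ _ _ _

/-- The product `N(U^k) ⊗ N(V^k') → N(U^p ⊗ V^p)` of the Alexander–Whitney map and the shuffle map,
set to zero unless `p = k + k'`. -/
def aw (U V : CSMod.{u}) (k k' p : ℕ) :
    (N (U.obj ⦋k⦌)).carrier →ₗ[ZMod 2] (N (V.obj ⦋k'⦌)).carrier →ₗ[ZMod 2]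
      (N ((U.tensor V).obj ⦋p⦌)).carrier :=
  if h : k + k' = p then
    (nablaN (U.obj ⦋p⦌) (V.obj ⦋p⦌)).compl₁₂
      (NMap (U.map (SimplexCategory.subinterval 0 k (by omega))))
      (NMap (V.map (SimplexCategory.subinterval k k' (by omega))))
  else 0

lemma aw_apply (U V : CSMod.{u}) {k k' p : ℕ} (h : k + k' = p) (x : (N (U.obj ⦋k⦌)).carrier)
    (y : (N (V.obj ⦋k'⦌)).carrier) : aw U V k k' p x y = nablaN (U.obj ⦋p⦌) (V.obj ⦋p⦌)
      (NMap (U.map (SimplexCategory.subinterval 0 k (by omega))) x)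
      (NMap (V.map (SimplexCategory.subinterval k k' (by omega))) y) := by
  rw [aw, dif_pos h]
  rfl

lemma d_aw (U V : CSMod.{u}) {k k' p : ℕ} (h : k + k' = p) (x : (N (U.obj ⦋k⦌)).carrier)
    (y : (N (V.obj ⦋k'⦌)).carrier) :
    (N ((U.tensor V).obj ⦋p⦌)).d (aw U V k k' p x y) =
      aw U V k k' p ((N (U.obj ⦋k⦌)).d x) y + aw U V k k' p x ((N (V.obj ⦋k'⦌)).d y) := by
  rw [aw_apply U V h, aw_apply U V h, aw_apply U V h, NMap_d, NMap_d]
  exact d_nablaN _ _ _ _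

/-- For `i ≤ k` the coface acts on the front face and shifts the back face; for `i > k` it fixes the
front face and acts on the back face. On the right the last coface of the front and the zeroth
coface of the back give one extra term each; these are equal and cancel modulo 2. -/
lemma sum_subinterval {M : Type*} [AddCommGroup M] [Module (ZMod 2) M] (k k' : ℕ)
    (G : (⦋k⦌ ⟶ ⦋k + k' + 1⦌) → (⦋k'⦌ ⟶ ⦋k + k' + 1⦌) → M) :
    ∑ i : Fin (k + k' + 2), G
      (SimplexCategory.subinterval (n := k + k') 0 k (by omega) ≫ SimplexCategory.δ i)
      (SimplexCategory.subinterval (n := k + k') k k' (by omega) ≫ SimplexCategory.δ i) =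
    ∑ i : Fin (k + 2), G
      (SimplexCategory.δ i ≫ SimplexCategory.subinterval 0 (k + 1) (by omega))
      (SimplexCategory.subinterval (k + 1) k' (by omega)) +
    ∑ i : Fin (k' + 2), G
      (SimplexCategory.subinterval 0 k (by omega))
      (SimplexCategory.δ i ≫ SimplexCategory.subinterval k (k' + 1) (by omega)) := by
  rw [Fin.sum_univ_castSucc (n := k + 1), Fin.sum_univ_succ (n := k' + 1)]
  have e : k + 1 + (k' + 1) = k + k' + 2 := by omega
  rw [← Fin.sum_congr' _ e, Fin.sum_univ_add]
  have h1 : SimplexCategory.δ (Fin.last (k + 1)) ≫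
      SimplexCategory.subinterval (n := k + k' + 1) 0 (k + 1) (by omega) =
      SimplexCategory.subinterval (n := k + k' + 1) 0 k (by omega) := val_ext fun l hl => by
    rw [val_comp, val_subinterval _ (val_le _ _), val_δ _ hl, val_subinterval _ hl, Fin.val_last,
      if_pos (by omega)]
  have h2 : SimplexCategory.δ (0 : Fin (k' + 2)) ≫
      SimplexCategory.subinterval (n := k + k' + 1) k (k' + 1) (by omega) =
      SimplexCategory.subinterval (n := k + k' + 1) (k + 1) k' (by omega) := val_ext fun l hl => by
    rw [val_comp, val_subinterval _ (val_le _ _), val_δ _ hl, val_subinterval _ hl, Fin.val_zero,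
      if_neg (by omega)]
    omega
  have cancel : ∀ a b c : M, a + c + (c + b) = a + b := fun a b c => by
    rw [add_assoc, ← add_assoc c c b, ZModModule.add_self, zero_add]
  rw [h1, h2, cancel]
  congr 1
  · refine Finset.sum_congr rfl fun i _ => ?_
    congr 1
    · refine val_ext fun l hl => ?_
      rw [val_comp, val_comp, val_subinterval _ hl, val_δ _ (by omega),
        val_subinterval _ (val_le _ _), val_δ _ hl]
      simp
    · refine val_ext fun l hl => ?_
      rw [val_comp, val_subinterval _ hl, val_δ _ (by omega), val_subinterval _ hl, if_neg]
      · omega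
      · have := i.2
        simp
        omega
  · refine Finset.sum_congr rfl fun i _ => ?_
    congr 1
    · refine val_ext fun l hl => ?_
      rw [val_comp, val_subinterval _ hl, val_δ _ (by omega), val_subinterval _ hl, if_pos]
      simp
      omega
    · refine val_ext fun l hl => ?_
      rw [val_comp, val_comp, val_subinterval _ hl, val_δ _ (by omega),
        val_subinterval _ (val_le _ _), val_δ _ hl]
      simp only [Fin.val_cast, Fin.val_natAdd, Fin.val_succ]
      split_ifs <;> omega

lemma NMap_codiff (U : CSMod.{u}) {k : ℕ} {q : SimplexCategory} (f : ⦋k + 1⦌ ⟶ q)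
    (x : (N (U.obj ⦋k⦌)).carrier) :
    NMap (U.map f) (codiff U k x) = ∑ i : Fin (k + 2), NMap (U.map (SimplexCategory.δ i ≫ f)) x := by
  rw [codiff, map_sum]
  exact Finset.sum_congr rfl fun i _ => NMap_map_map U _ _ _

lemma codiff_nablaN (U V : CSMod.{u}) {p : ℕ} (x : (N (U.obj ⦋p⦌)).carrier)
    (y : (N (V.obj ⦋p⦌)).carrier) :
    codiff (U.tensor V) p (nablaN (U.obj ⦋p⦌) (V.obj ⦋p⦌) x y) = ∑ i : Fin (p + 2),
      nablaN (U.obj ⦋p + 1⦌) (V.obj ⦋p + 1⦌) (NMap (U.map (SimplexCategory.δ i)) x)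
        (NMap (V.map (SimplexCategory.δ i)) y) :=
  Finset.sum_congr rfl fun _ _ => NMap_tensor_map U V _ _ _

lemma codiff_aw (U V : CSMod.{u}) {k k' p : ℕ} (h : k + k' = p) (x : (N (U.obj ⦋k⦌)).carrier)
    (y : (N (V.obj ⦋k'⦌)).carrier) :
    codiff (U.tensor V) p (aw U V k k' p x y) =
      aw U V (k + 1) k' (p + 1) (codiff U k x) y + aw U V k (k' + 1) (p + 1) x (codiff V k' y) := by
  subst h
  rw [aw_apply U V rfl, aw_apply U V (by omega), aw_apply U V (by omega), codiff_nablaN,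
    NMap_codiff, NMap_codiff, map_sum, map_sum, LinearMap.sum_apply]
  refine Eq.trans (Finset.sum_congr rfl fun i _ => ?_) (sum_subinterval k k' fun u v =>
    nablaN (U.obj ⦋k + k' + 1⦌) (V.obj ⦋k + k' + 1⦌) (NMap (U.map u) x) (NMap (V.map v) y))
  exact congrArg₂ (fun a b => nablaN (U.obj ⦋k + k' + 1⦌) (V.obj ⦋k + k' + 1⦌) a b)
    (NMap_map_map U _ _ _) (NMap_map_map V _ _ _)

/-- The product of two families of chains. -/
def star (U V : CSMod.{u}) (X : ∀ p, (N (U.obj ⦋p⦌)).carrier) (Y : ∀ p, (N (V.obj ⦋p⦌)).carrier)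
    (p : ℕ) : (N ((U.tensor V).obj ⦋p⦌)).carrier :=
  ∑ i ∈ Finset.HasAntidiagonal.antidiagonal p, aw U V i.1 i.2 p (X i.1) (Y i.2)

lemma codiff_sum (V : CSMod.{u}) (p : ℕ) {ι : Type*} (s : Finset ι)
    (x : ι → (N (V.obj ⦋p⦌)).carrier) : codiff V p (∑ i ∈ s, x i) = ∑ i ∈ s, codiff V p (x i) := by
  simp_rw [codiff, map_sum]
  exact Finset.sum_comm

/-- The simplicial part is the Leibniz rule for the shuffle map, the cosimplicial part the one for
the Alexander–Whitney map. It holds on the level of chains, without dividing by cofaces. -/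
lemma famD_star (U V : CSMod.{u}) (X : ∀ p, (N (U.obj ⦋p⦌)).carrier)
    (Y : ∀ p, (N (V.obj ⦋p⦌)).carrier) (p : ℕ) :
    famD (U.tensor V) (star U V X Y) p = star U V (famD U X) Y p + star U V X (famD V Y) p := by
  have h1 : prevD (U.tensor V) (star U V X Y) p =
      star U V (prevD U X) Y p + star U V X (prevD V Y) p := by
    cases p with
    | zero =>
      simp only [star, Finset.Nat.antidiagonal_zero, Finset.sum_singleton]
      change 0 = aw U V 0 0 0 0 (Y 0) + aw U V 0 0 0 (X 0) 0
      rw [map_zero, map_zero, LinearMap.zero_apply, add_zero]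
    | succ p =>
      rw [star, star, Finset.Nat.sum_antidiagonal_succ, Finset.Nat.sum_antidiagonal_succ']
      change codiff (U.tensor V) p (star U V X Y p) =
        aw U V 0 (p + 1) (p + 1) 0 (Y (p + 1)) + _ + (aw U V (p + 1) 0 (p + 1) (X (p + 1)) 0 + _)
      rw [map_zero, map_zero, LinearMap.zero_apply, zero_add, zero_add, star, codiff_sum,
        ← Finset.sum_add_distrib]
      exact Finset.sum_congr rfl fun i hi =>
        codiff_aw U V (Finset.HasAntidiagonal.mem_antidiagonal.1 hi) _ _
  rw [famD, h1, star, map_sum, Finset.sum_congr rfl fun i hi =>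
    d_aw U V (Finset.HasAntidiagonal.mem_antidiagonal.1 hi) _ _, Finset.sum_add_distrib,
    add_add_add_comm]
  simp only [star, famD, map_add, LinearMap.add_apply, Finset.sum_add_distrib]

/-! ### Normalized representatives -/

/-- In `s^j ∑ d^i x` the terms `i = j` and `i = j + 1` both equal `x` and cancel modulo 2; in every
other term a codegeneracy can be moved past the coface onto `x`. -/
lemma cobdry_mem_codegKer (W : CMod.{u}) {k : ℕ} {x : W.obj ⦋k⦌} (hx : x ∈ codegKer W k) :
    cobdry W k x ∈ codegKer W (k + 1) := by
  refine mem_codegKer.2 fun j => ?_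
  rw [cobdry_eq_sum, map_sum]
  have hcomp : ∀ i, (W.map (SimplexCategory.σ j)).hom ((W.map (SimplexCategory.δ i)).hom x) =
      (W.map (SimplexCategory.δ i ≫ SimplexCategory.σ j)).hom x := fun i => by
    rw [W.map_comp]
    rfl
  simp_rw [hcomp]
  have hne : j.castSucc ≠ j.succ := (Fin.castSucc_lt_succ).ne
  rw [← Finset.add_sum_erase _ _ (Finset.mem_univ j.castSucc),
    ← Finset.add_sum_erase _ _ (Finset.mem_erase.2 ⟨hne.symm, Finset.mem_univ j.succ⟩), ← add_assoc,
    SimplexCategory.δ_comp_σ_self, SimplexCategory.δ_comp_σ_succ, ZModModule.add_self, zero_add]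
  refine Finset.sum_eq_zero fun i hi => ?_
  have hi1 : (i : ℕ) ≠ j := fun e => (Finset.mem_erase.1 (Finset.mem_erase.1 hi).2).1 (Fin.ext e)
  have hi2 : (i : ℕ) ≠ j + 1 := fun e => (Finset.mem_erase.1 hi).1 (Fin.ext e)
  have hi3 := i.2
  have hj := j.2
  cases k with
  -- For `k = 0` there are only the two cofaces already cancelled.
  | zero => omega
  | succ k =>
    have hx' := mem_codegKer.1 hx
    obtain ⟨i', j', e⟩ : ∃ (i' : Fin (k + 2)) (j' : Fin (k + 1)),
        SimplexCategory.δ i ≫ SimplexCategory.σ j =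
          SimplexCategory.σ j' ≫ SimplexCategory.δ i' := by
      rcases lt_or_gt_of_ne hi1 with h | h
      · refine ⟨⟨i, by omega⟩, ⟨j - 1, by omega⟩, val_ext fun l hl => ?_⟩
        have hl' : val (SimplexCategory.σ (⟨j - 1, by omega⟩ : Fin (k + 1))) l ≤ k := val_le _ _
        rw [val_comp, val_comp, val_σ _ (val_le _ _), val_δ _ hl, val_δ _ hl']
        rw [val_σ _ hl] at hl' ⊢
        dsimp only
        split_ifs <;> omega
      · refine ⟨⟨i - 1, by omega⟩, ⟨j, by omega⟩, val_ext fun l hl => ?_⟩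
        have hl' : val (SimplexCategory.σ (⟨j, by omega⟩ : Fin (k + 1))) l ≤ k := val_le _ _
        rw [val_comp, val_comp, val_σ _ (val_le _ _), val_δ _ hl, val_δ _ hl']
        rw [val_σ _ hl] at hl' ⊢
        dsimp only
        split_ifs <;> omega
    rw [e, W.map_comp]
    change (W.map (SimplexCategory.δ i')).hom ((W.map (SimplexCategory.σ j')).hom x) = 0
    rw [hx', map_zero]

lemma map_mem_codegKer {W W' : CMod.{u}} (f : W ⟶ W') {k : ℕ} {x : W.obj ⦋k⦌}
    (hx : x ∈ codegKer W k) : (f.app ⦋k⦌).hom x ∈ codegKer W' k := by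
  cases k with
  | zero => trivial
  | succ k =>
    refine mem_codegKer.2 fun i => ?_
    have h := ConcreteCategory.congr_hom (f.naturality (SimplexCategory.σ i)) x
    change (f.app ⦋k⦌).hom ((W.map (SimplexCategory.σ i)).hom x) =
      (W'.map (SimplexCategory.σ i)).hom ((f.app ⦋k + 1⦌).hom x) at h
    rw [← h, mem_codegKer.1 hx, map_zero]

/-- The chain `x ∈ N(V^p)` is killed by all codegeneracies. -/
def IsNorm (V : CSMod.{u}) (p : ℕ) (x : ∀ n, NObj (V.obj ⦋p⦌) n) : Prop :=
  ∀ t, x t ∈ codegKer (V.NV t) p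

lemma codiff_apply (V : CSMod.{u}) (p : ℕ) (x : ∀ n, NObj (V.obj ⦋p⦌) n) (t : ℕ) :
    (codiff V p x : ∀ n, NObj (V.obj ⦋p + 1⦌) n) t = cobdry (V.NV t) p (x t) := by
  rw [cobdry_eq_sum, codiff, Finset.sum_apply]
  rfl

lemma IsNorm.famD {V : CSMod.{u}} {X : ∀ p, (N (V.obj ⦋p⦌)).carrier} (h : ∀ p, IsNorm V p (X p))
    (p : ℕ) : IsNorm V p (famD V X p) := fun t => by
  refine add_mem ?_ ?_
  · exact map_mem_codegKer (V.NVd t) (h p (t + 1))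
  · cases p with
    | zero => trivial
    | succ p =>
      change (codiff V p (X p) : ∀ n, NObj (V.obj ⦋p + 1⦌) n) t ∈ _
      rw [codiff_apply]
      exact cobdry_mem_codegKer _ (h p t)

/-- The classes of a family of chains. -/
def toC (V : CSMod.{u}) (X : ∀ p, (N (V.obj ⦋p⦌)).carrier) (p t : ℕ) : CObj (V.NV t) p :=
  Submodule.Quotient.mk ((X p : ∀ n, NObj (V.obj ⦋p⦌) n) t)

/-- The family of normalized representatives. -/
def rep (V : CSMod.{u}) (x : ∀ p t, CObj (V.NV t) p) (p : ℕ) : (N (V.obj ⦋p⦌)).carrier :=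
  fun t => (normRep (V.NV t) p (x p t)).1

lemma isNorm_rep (V : CSMod.{u}) (x : ∀ p t, CObj (V.NV t) p) (p : ℕ) :
    IsNorm V p (rep V x p) := fun t => (normRep (V.NV t) p (x p t)).2

lemma mk_normRep (W : CMod.{u}) (k : ℕ) (x : CObj W k) :
    (Submodule.Quotient.mk (normRep W k x).1 : CObj W k) = x :=
  (normRep W k).symm_apply_apply x

lemma normRep_mk (W : CMod.{u}) (k : ℕ) {x : W.obj ⦋k⦌} (hx : x ∈ codegKer W k) :
    (normRep W k (Submodule.Quotient.mk x)).1 = x :=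
  congrArg Subtype.val ((normRep W k).apply_symm_apply ⟨x, hx⟩)

lemma toC_rep (V : CSMod.{u}) (x : ∀ p t, CObj (V.NV t) p) (p t : ℕ) :
    toC V (rep V x) p t = x p t := mk_normRep _ _ _

/-- Any representatives compute the differential, and they are needed only in columns up to `ℓ`:
column `p` of the differential depends on columns `p` and `p - 1` alone. -/
lemma T_d_apply (ℓ : ℕ∞) (V : CSMod.{u}) (X : ∀ p, (N (V.obj ⦋p⦌)).carrier)
    (x : ∀ p t, CObj (V.NV t) p) (hx : ∀ p : ℕ, (p : ℕ∞) ≤ ℓ → ∀ t, x p t = toC V X p t) {p : ℕ}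
    (hp : (p : ℕ∞) ≤ ℓ) (t : ℕ) :
    ((T ℓ (CN V)).d x : ∀ p t, CObj (V.NV t) p) p t = toC V (famD V X) p t := by
  change ((if (p : ℕ∞) ≤ ℓ then _ else _ : _ →ₗ[ZMod 2] _) x) = _
  rw [if_pos hp]
  change CMap (V.NVd t) p (x p (t + 1)) + (CN V).hIn p t x = _
  rw [hx p hp]
  refine congrArg₂ (· + ·) (rfl : _ = toC V (fun p => (N (V.obj ⦋p⦌)).d (X p)) p t)
    (?_ : _ = toC V (prevD V X) p t)
  cases p with
  | zero => rfl
  | succ p =>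
    have hp' : (p : ℕ∞) ≤ ℓ := le_trans (by exact_mod_cast Nat.le_succ p) hp
    change CBdry (V.NV t) p (x p t) = Submodule.Quotient.mk
      ((codiff V p (X p) : ∀ n, NObj (V.obj ⦋p + 1⦌) n) t)
    rw [hx p hp', codiff_apply]
    rfl

lemma T_d_eq_zero (ℓ : ℕ∞) (V : CSMod.{u}) (x : ∀ p t, CObj (V.NV t) p) {p : ℕ}
    (hp : ¬(p : ℕ∞) ≤ ℓ) (t : ℕ) :
    ((T ℓ (CN V)).d x : ∀ p t, CObj (V.NV t) p) p t = 0 := by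
  change ((if (p : ℕ∞) ≤ ℓ then _ else _ : _ →ₗ[ZMod 2] _) x) = _
  rw [if_neg hp]
  rfl

lemma rep_eq {V : CSMod.{u}} {x : ∀ p t, CObj (V.NV t) p} {p : ℕ}
    {X : (N (V.obj ⦋p⦌)).carrier} (hX : IsNorm V p X)
    (h : ∀ t, x p t = Submodule.Quotient.mk ((X : ∀ n, NObj (V.obj ⦋p⦌) n) t)) :
    rep V x p = X := funext fun t => by
  change (normRep (V.NV t) p (x p t)).1 = _
  rw [h t, normRep_mk _ _ (hX t)]

/-- The total differential preserves chains killed by codegeneracies, so it commutes with taking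
normalized representatives. This lets the Leibniz rule for `star` descend to the product defined by
such representatives. -/
lemma rep_T_d (ℓ : ℕ∞) (V : CSMod.{u}) (x : ∀ p t, CObj (V.NV t) p) {p : ℕ}
    (hp : (p : ℕ∞) ≤ ℓ) : rep V ((T ℓ (CN V)).d x) p = famD V (rep V x) p :=
  rep_eq (IsNorm.famD (isNorm_rep V x) p) fun t =>
    T_d_apply ℓ V (rep V x) x (fun p _ t => (toC_rep V x p t).symm) hp t

/-! ### The product on the conormalized side -/

lemma CMap_nablaC_AW (U V : CSMod.{u}) {k k' p a b t : ℕ} (hp : k + k' = p) (ht : a + b = t)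
    (x : CObj (U.NV a) k) (y : CObj (V.NV b) k') :
    CMap (nablaC U V ht) p (AW (U.NV a) (V.NV b) hp x y) =
      Submodule.Quotient.mk (nabla (U.obj ⦋p⦌) (V.obj ⦋p⦌) ht
        (((NFun a).map (U.map (SimplexCategory.subinterval 0 k (by omega)))).hom
          (normRep (U.NV a) k x).1)
        (((NFun b).map (V.map (SimplexCategory.subinterval k k' (by omega)))).hom
          (normRep (V.NV b) k' y).1)) := rfl

lemma conormProd_apply (ℓ : ℕ∞) (U V : CSMod.{u}) (x : ∀ p t, CObj (U.NV t) p)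
    (y : ∀ p t, CObj (V.NV t) p) {p : ℕ} (hp : (p : ℕ∞) ≤ ℓ) (t : ℕ) :
    (conormProd ℓ U V x y : ∀ p t, CObj ((U.tensor V).NV t) p) p t =
      toC (U.tensor V) (star U V (rep U x) (rep V y)) p t := by
  change (if (p : ℕ∞) ≤ ℓ then _ else _) = _
  rw [if_pos hp, toC, star, Finset.sum_apply, ← Submodule.mkQ_apply, map_sum]
  refine Eq.trans ?_ (Finset.sum_coe_sort (M := CObj ((U.tensor V).NV t) p)
    (Finset.HasAntidiagonal.antidiagonal p) fun i : ℕ × ℕ =>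
      (coim ((U.tensor V).NV t) p).mkQ ((aw U V i.1 i.2 p (rep U x i.1) (rep V y i.2) :
        ∀ n, NObj ((U.tensor V).obj ⦋p⦌) n) t))
  refine Finset.sum_congr rfl fun i _ => ?_
  rw [aw_apply U V (Finset.HasAntidiagonal.mem_antidiagonal.1 i.2)]
  change _ = (coim ((U.tensor V).NV t) p).mkQ (∑ j : ↥(Finset.HasAntidiagonal.antidiagonal t), _)
  rw [map_sum]
  exact Finset.sum_congr rfl fun j _ => CMap_nablaC_AW U V _ _ _ _

lemma conormProd_eq_zero (ℓ : ℕ∞) (U V : CSMod.{u}) (x : ∀ p t, CObj (U.NV t) p)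
    (y : ∀ p t, CObj (V.NV t) p) {p : ℕ} (hp : ¬(p : ℕ∞) ≤ ℓ) (t : ℕ) :
    (conormProd ℓ U V x y : ∀ p t, CObj ((U.tensor V).NV t) p) p t = 0 := if_neg hp

lemma star_congr (U V : CSMod.{u}) {X X' : ∀ p, (N (U.obj ⦋p⦌)).carrier}
    {Y Y' : ∀ p, (N (V.obj ⦋p⦌)).carrier} {p : ℕ} (hX : ∀ q ≤ p, X q = X' q)
    (hY : ∀ q ≤ p, Y q = Y' q) : star U V X Y p = star U V X' Y' p := by
  refine Finset.sum_congr rfl fun i hi => ?_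
  have := Finset.HasAntidiagonal.mem_antidiagonal.1 hi
  rw [hX _ (by omega), hY _ (by omega)]

lemma cast_le_of_le {ℓ : ℕ∞} {p q : ℕ} (hp : (p : ℕ∞) ≤ ℓ) (h : q ≤ p) : (q : ℕ∞) ≤ ℓ :=
  le_trans (by exact_mod_cast h) hp

lemma conormProd_isPairing (ℓ : ℕ∞) (U V : CSMod.{u}) :
    IsPairing (T ℓ (CN U)) (T ℓ (CN V)) (T ℓ (CN (U.tensor V))) (conormProd ℓ U V) where
  mem m n x y hx hy p t h := by
    by_cases hp : (p : ℕ∞) ≤ ℓ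
    · refine (if_pos hp).trans (Finset.sum_eq_zero fun i _ => Finset.sum_eq_zero fun j _ => ?_)
      have hi := Finset.HasAntidiagonal.mem_antidiagonal.1 i.2
      have hj := Finset.HasAntidiagonal.mem_antidiagonal.1 j.2
      by_cases h1 : (j.1.1 : ℤ) - i.1.1 = m
      · rw [hy i.1.2 j.1.2 fun h2 => h ⟨hp, by omega⟩, map_zero, map_zero]
      · rw [hx i.1.1 j.1.1 fun h2 => h1 h2.2, map_zero, LinearMap.zero_apply, map_zero]
    · exact conormProd_eq_zero ℓ U V x y hp t
  leibniz m n x y _ _ := by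
    funext p t
    by_cases hp : (p : ℕ∞) ≤ ℓ
    · change _ = (conormProd ℓ U V _ y : ∀ p t, CObj ((U.tensor V).NV t) p) p t +
        (conormProd ℓ U V x _ : ∀ p t, CObj ((U.tensor V).NV t) p) p t
      rw [T_d_apply ℓ (U.tensor V) _ _
        (fun p hp t => conormProd_apply ℓ U V x y hp t) hp, conormProd_apply ℓ U V _ y hp,
        conormProd_apply ℓ U V x _ hp, toC, famD_star]
      -- Column `p` of the product involves only columns `q ≤ p ≤ ℓ` of the factors, so the
      -- truncation does no harm.
      have h1 := star_congr U V (p := p) (fun q hq => rep_T_d ℓ U x (cast_le_of_le hp hq))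
        fun q _ => (rfl : rep V y q = _)
      have h2 := star_congr U V (p := p) (fun q _ => (rfl : rep U x q = _))
        fun q hq => rep_T_d ℓ V y (cast_le_of_le hp hq)
      rw [toC, toC, h1, h2]
      rfl
    · change _ = (conormProd ℓ U V _ y : ∀ p t, CObj ((U.tensor V).NV t) p) p t +
        (conormProd ℓ U V x _ : ∀ p t, CObj ((U.tensor V).NV t) p) p t
      rw [T_d_eq_zero ℓ _ _ hp, conormProd_eq_zero ℓ U V _ y hp, conormProd_eq_zero ℓ U V x _ hp,
        add_zero]

/-! ### Elements concentrated in one degree -/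

/-- The chain with the single component `x` in degree `n`. -/
def conc (A : SMod.{u}) (n : ℕ) (x : NObj A n) : (N A).carrier := fun m =>
  if h : n = m then h ▸ x else 0

lemma conc_self (A : SMod.{u}) (n : ℕ) (x : NObj A n) :
    (conc A n x : ∀ n, NObj A n) n = x := dif_pos rfl

lemma conc_ne (A : SMod.{u}) {n m : ℕ} (x : NObj A n) (h : n ≠ m) :
    (conc A n x : ∀ n, NObj A n) m = 0 := dif_neg h

lemma conc_mem (A : SMod.{u}) (n : ℕ) (x : NObj A n) : conc A n x ∈ (N A).deg n := fun m hm =>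
  conc_ne A x fun h => hm (by rw [h])

lemma eq_conc {A : SMod.{u}} {n : ℕ} {x : (N A).carrier} (hx : x ∈ (N A).deg n) :
    x = conc A n ((x : ∀ n, NObj A n) n) := funext fun m => by
  by_cases h : n = m
  · subst h
    rw [conc_self]
  · rw [conc_ne A _ h, hx m fun e => h (by exact_mod_cast e.symm)]

lemma NMap_conc {A B : SMod.{u}} (f : A ⟶ B) (n : ℕ) (x : NObj A n) :
    NMap f (conc A n x) = conc B n (((NFun n).map f).hom x) := by
  rw [eq_conc (NMap_mem f (conc_mem A n x)), NMap_apply, conc_self]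

lemma d_conc (A : SMod.{u}) (n : ℕ) (x : NObj A (n + 1)) :
    (N A).d (conc A (n + 1) x) = conc A n (Nd A n x) := by
  have h := (N A).d_mem _ _ (conc_mem A (n + 1) x)
  rw [show ((n + 1 : ℕ) : ℤ) - 1 = (n : ℕ) by push_cast; ring] at h
  rw [eq_conc h]
  change conc A n (Nd A n ((conc A (n + 1) x : ∀ n, NObj A n) (n + 1))) = _
  rw [conc_self]

lemma d_conc_zero (A : SMod.{u}) (x : NObj A 0) : (N A).d (conc A 0 x) = 0 := funext fun n => by
  change Nd A n ((conc A 0 x : ∀ n, NObj A n) (n + 1)) = 0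
  rw [conc_ne A x (Nat.succ_ne_zero n).symm, map_zero]

lemma conc_sum (A : SMod.{u}) (n : ℕ) {ι : Type*} (s : Finset ι) (x : ι → NObj A n) :
    conc A n (∑ i ∈ s, x i) = ∑ i ∈ s, conc A n (x i) := funext fun m => by
  rw [Finset.sum_apply]
  by_cases h : n = m
  · subst h
    simp_rw [conc_self]
  · simp_rw [conc_ne A _ h]
    exact Finset.sum_const_zero.symm

/-! ### The free cosimplicial simplicial module on the standard simplices -/

/-- The cosimplicial simplicial module `p ↦ F₂[Δ^p]`. -/
def stdMod : CSMod.{u} where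
  obj p :=
    { obj n := ModuleCat.of (ZMod 2) (ULift.{u} (n.unop ⟶ p) →₀ ZMod 2)
      map θ := ModuleCat.ofHom (Finsupp.lmapDomain (ZMod 2) (ZMod 2)
        fun α => ULift.up (θ.unop ≫ α.down))
      map_id n := by
        refine ModuleCat.hom_ext (Finsupp.lhom_ext fun α c => ?_)
        refine (Finsupp.mapDomain_single).trans ?_
        rw [unop_id, Category.id_comp]
        rfl
      map_comp θ θ' := by
        refine ModuleCat.hom_ext (Finsupp.lhom_ext fun α c => ?_)
        simp }
  map γ :=
    { app n := ModuleCat.ofHom (Finsupp.lmapDomain (ZMod 2) (ZMod 2)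
        fun α => ULift.up (α.down ≫ γ))
      naturality n n' θ := by
        refine ModuleCat.hom_ext (Finsupp.lhom_ext fun α c => ?_)
        simp }
  map_id p := by
    refine NatTrans.ext (funext fun n => ModuleCat.hom_ext (Finsupp.lhom_ext fun α c => ?_))
    refine (Finsupp.mapDomain_single).trans ?_
    rw [Category.comp_id]
    rfl
  map_comp γ γ' := by
    refine NatTrans.ext (funext fun n => ModuleCat.hom_ext (Finsupp.lhom_ext fun α c => ?_))
    simp

/-- The basis element of `F₂[Δ^p]` given by the simplex `α`. -/
def bas {n p : SimplexCategory} (α : n ⟶ p) : (stdMod.{u}.obj p).obj (op n) :=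
  Finsupp.single (ULift.up α) 1

lemma stdMod_hom_ext {n p : SimplexCategory} {M : Type*} [AddCommGroup M] [Module (ZMod 2) M]
    {f g : (stdMod.{u}.obj p).obj (op n) →ₗ[ZMod 2] M} (h : ∀ α : n ⟶ p, f (bas α) = g (bas α)) :
    f = g :=
  Finsupp.lhom_ext' fun α => LinearMap.ext_ring (h α.down)

lemma map_bas {n n' p : SimplexCategory} (θ : n' ⟶ n) (α : n ⟶ p) :
    ((stdMod.{u}.obj p).map θ.op).hom (bas α) = bas (θ ≫ α) := Finsupp.mapDomain_single

lemma map_app_bas {n p p' : SimplexCategory} (γ : p ⟶ p') (α : n ⟶ p) :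
    ((stdMod.{u}.map γ).app (op n)).hom (bas α) = bas (α ≫ γ) := Finsupp.mapDomain_single

/-- A linear map out of `F₂[Δ^p]_n`. -/
def basLift {n p : SimplexCategory} {M : Type*} [AddCommGroup M] [Module (ZMod 2) M]
    (f : (n ⟶ p) → M) : (stdMod.{u}.obj p).obj (op n) →ₗ[ZMod 2] M :=
  Finsupp.linearCombination (ZMod 2) fun α : ULift.{u} (n ⟶ p) => f α.down

lemma basLift_bas {n p : SimplexCategory} {M : Type*} [AddCommGroup M] [Module (ZMod 2) M]
    (f : (n ⟶ p) → M) (α : n ⟶ p) : basLift.{u} f (bas α) = f α :=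
  (Finsupp.linearCombination_single _ _ _).trans (one_smul _ _)

/-- The class of the top simplex of `Δ^p` in `N(F₂[Δ^p])`. -/
def iota (p : ℕ) : (N (stdMod.{u}.obj ⦋p⦌)).carrier :=
  conc _ p (Submodule.Quotient.mk (bas (𝟙 ⦋p⦌)))

lemma NMap_iota {p : ℕ} {q : SimplexCategory} (γ : ⦋p⦌ ⟶ q) :
    NMap (stdMod.{u}.map γ) (iota p) = conc _ p (Submodule.Quotient.mk (bas γ)) := by
  rw [iota, NMap_conc]
  refine congrArg _ (congrArg Submodule.Quotient.mk ((map_app_bas γ (𝟙 _)).trans ?_))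
  rw [Category.id_comp]

/-- As a simplex of `Δ^p`, the map `σ j` is the `j`-th degeneracy of the top simplex, hence zero in
the normalized complex. -/
lemma NMap_σ_iota {p : ℕ} (j : Fin (p + 1)) :
    NMap (stdMod.{u}.map (SimplexCategory.σ j)) (iota (p + 1)) = 0 := by
  rw [NMap_iota, (Submodule.Quotient.mk_eq_zero _).2]
  · exact funext fun m => by
      by_cases h : p + 1 = m
      · subst h
        rw [conc_self]
        rfl
      · exact conc_ne _ _ h
  · have h := σ_mem_degen (stdMod.{u}.obj ⦋p⦌) j (bas (𝟙 _))
    rwa [map_bas, Category.comp_id] at h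

/-- The simplicial faces of the top simplex of `Δ^{p+1}` are exactly the cofaces of the top simplex
of `Δ^p`. -/
lemma famD_iota (p : ℕ) : famD stdMod.{u} iota p = 0 := by
  cases p with
  | zero => exact (add_zero _).trans (d_conc_zero _ _)
  | succ p =>
    have h : (N (stdMod.{u}.obj ⦋p + 1⦌)).d (iota (p + 1)) = codiff stdMod p (iota p) := by
      rw [iota, d_conc, Nd_mk, bdry_eq_sum, codiff, ← Submodule.mkQ_apply, map_sum, conc_sum]
      refine Finset.sum_congr rfl fun i _ => ?_
      rw [NMap_iota, map_bas, Category.comp_id]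
      rfl
    change _ + codiff stdMod p (iota p) = 0
    rw [h]
    exact ZModModule.add_self _

/-! ### Evaluation of families of chains -/

section act

variable {ℓ : ℕ∞} {X V : CSMod.{u}} {A : SMod.{u}}
  (ev : ∀ p : ℕ, (p : ℕ∞) ≤ ℓ → (tens (X.obj ⦋p⦌) A ⟶ V.obj ⦋p⦌))

open Classical in
/-- The family of chains obtained from a family on `X`, a chain on `A` and maps `X^p ⊗ A → V^p`. -/
def act (c : ∀ p, (N (X.obj ⦋p⦌)).carrier) (w : (N A).carrier) (p : ℕ) :
    (N (V.obj ⦋p⦌)).carrier :=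
  if hp : (p : ℕ∞) ≤ ℓ then NMap (ev p hp) (nablaN (X.obj ⦋p⦌) A (c p) w) else 0

lemma act_apply (c : ∀ p, (N (X.obj ⦋p⦌)).carrier) (w : (N A).carrier) {p : ℕ}
    (hp : (p : ℕ∞) ≤ ℓ) : act ev c w p = NMap (ev p hp) (nablaN (X.obj ⦋p⦌) A (c p) w) :=
  dif_pos hp

lemma NMap_map_ev
    (hev : ∀ (p q : ℕ) (hp : (p : ℕ∞) ≤ ℓ) (hq : (q : ℕ∞) ≤ ℓ) (γ : ⦋p⦌ ⟶ ⦋q⦌),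
      tensMap (X.map γ) (𝟙 A) ≫ ev q hq = ev p hp ≫ V.map γ)
    {p q : ℕ} (hp : (p : ℕ∞) ≤ ℓ) (hq : (q : ℕ∞) ≤ ℓ) (γ : ⦋p⦌ ⟶ ⦋q⦌)
    (x : (N (X.obj ⦋p⦌)).carrier) (w : (N A).carrier) :
    NMap (V.map γ) (NMap (ev p hp) (nablaN (X.obj ⦋p⦌) A x w)) =
      NMap (ev q hq) (nablaN (X.obj ⦋q⦌) A (NMap (X.map γ) x) w) := by
  rw [← NMap_comp, ← hev p q hp hq γ, NMap_comp, NMap_nablaN, NMap_id]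

/-- Naturality of the evaluation in `p` moves the cofaces onto the family `c`; the Leibniz rule for
the shuffle map does the rest. When both `c` and `w` are cycles the result is a cycle in the columns
up to `ℓ`. -/
lemma famD_act
    (hev : ∀ (p q : ℕ) (hp : (p : ℕ∞) ≤ ℓ) (hq : (q : ℕ∞) ≤ ℓ) (γ : ⦋p⦌ ⟶ ⦋q⦌),
      tensMap (X.map γ) (𝟙 A) ≫ ev q hq = ev p hp ≫ V.map γ)
    (c : ∀ p, (N (X.obj ⦋p⦌)).carrier) (w : (N A).carrier) {p : ℕ}
    (hp : (p : ℕ∞) ≤ ℓ) : famD V (act ev c w) p =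
      NMap (ev p hp) (nablaN (X.obj ⦋p⦌) A (famD X c p) w) +
        NMap (ev p hp) (nablaN (X.obj ⦋p⦌) A (c p) ((N A).d w)) := by
  have h1 : prevD V (act ev c w) p =
      NMap (ev p hp) (nablaN (X.obj ⦋p⦌) A (prevD X c p) w) := by
    cases p with
    | zero =>
      change 0 = NMap (ev 0 hp) (nablaN (X.obj ⦋0⦌) A 0 w)
      rw [map_zero, LinearMap.zero_apply, map_zero]
    | succ p =>
      have hp' := cast_le_of_le hp (Nat.le_succ p)
      change codiff V p (act ev c w p) = NMap (ev (p + 1) hp) (nablaN _ A (codiff X p (c p)) w)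
      rw [act_apply ev c w hp', codiff, codiff, map_sum, LinearMap.sum_apply, map_sum]
      exact Finset.sum_congr rfl fun i _ => NMap_map_ev ev hev hp' hp _ _ _
  rw [famD, h1, act_apply ev c w hp, ← NMap_d, d_nablaN, famD, map_add, map_add,
    LinearMap.add_apply, map_add]
  exact add_right_comm _ _ _

end act

/-! ### The map `φ_ℓ` as an evaluation -/

/-- The value of a map `sk_ℓ Δ^• × Δ^n → V` at `(α, id)`. -/
def evalAt (ℓ : ℕ∞) (V : CSMod.{u}) {p : ℕ} (hp : (p : ℕ∞) ≤ ℓ) {n : SimplexCategory}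
    (α : n ⟶ ⦋p⦌) : (Tot ℓ V).obj (op n) →ₗ[ZMod 2] (V.obj ⦋p⦌).obj (op n) where
  toFun (f : TotObj ℓ V n) := f.1 ⦋p⦌ n ⟨α, inSk_of_le hp α⟩ (𝟙 n)
  map_add' _ _ := rfl
  map_smul' _ _ := rfl

/-- The evaluation map `F₂[Δ^p] ⊗ Tot_ℓ V → V^p`, `α ⊗ f ↦ f(α, id)`. -/
def ev (ℓ : ℕ∞) (V : CSMod.{u}) (p : ℕ) (hp : (p : ℕ∞) ≤ ℓ) :
    tens (stdMod.{u}.obj ⦋p⦌) (Tot ℓ V) ⟶ V.obj ⦋p⦌ where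
  app n := ModuleCat.ofHom (TensorProduct.lift
    (basLift (n := n.unop) (p := ⦋p⦌) fun α => evalAt ℓ V hp α))
  naturality n n' θ := by
    refine ModuleCat.hom_ext (TensorProduct.ext (stdMod_hom_ext fun α =>
      LinearMap.ext fun (f : TotObj ℓ V n.unop) => ?_))
    change basLift (fun α => evalAt ℓ V hp α)
      (((stdMod.{u}.obj ⦋p⦌).map θ.unop.op).hom (bas α)) (((Tot ℓ V).map θ).hom f) =
      ((V.obj ⦋p⦌).map θ).hom (basLift (fun α => evalAt ℓ V hp α) (bas α) f)
    rw [map_bas, basLift_bas, basLift_bas]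
    refine Eq.trans ?_ (f.2.1 ⦋p⦌ n.unop n'.unop θ.unop ⟨α, inSk_of_le hp α⟩ (𝟙 _))
    exact congrArg (f.1 _ _ _) ((Category.id_comp _).trans (Category.comp_id _).symm)

lemma ev_bas (ℓ : ℕ∞) (V : CSMod.{u}) {p : ℕ} (hp : (p : ℕ∞) ≤ ℓ) {n : SimplexCategory}
    (α : n ⟶ ⦋p⦌) (f : TotObj ℓ V n) :
    ((ev ℓ V p hp).app (op n)).hom (tm (stdMod.{u}.obj ⦋p⦌) (Tot ℓ V) (op n) (bas α) f) =
      f.1 ⦋p⦌ n ⟨α, inSk_of_le hp α⟩ (𝟙 n) := by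
  change basLift (fun α => evalAt ℓ V hp α) (bas α) f = _
  rw [basLift_bas]
  rfl

lemma ev_naturality (ℓ : ℕ∞) (V : CSMod.{u}) (p q : ℕ) (hp : (p : ℕ∞) ≤ ℓ) (hq : (q : ℕ∞) ≤ ℓ)
    (γ : ⦋p⦌ ⟶ ⦋q⦌) :
    tensMap (stdMod.{u}.map γ) (𝟙 (Tot ℓ V)) ≫ ev ℓ V q hq = ev ℓ V p hp ≫ V.map γ := by
  refine NatTrans.ext (funext fun n => ModuleCat.hom_ext (TensorProduct.ext (stdMod_hom_ext
    fun α => LinearMap.ext fun (f : TotObj ℓ V n.unop) => ?_)))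
  change ((ev ℓ V q hq).app (op n.unop)).hom (tm (stdMod.{u}.obj ⦋q⦌) (Tot ℓ V) (op n.unop)
    (((stdMod.{u}.map γ).app (op n.unop)).hom (bas α)) f) =
    ((V.map γ).app n).hom (((ev ℓ V p hp).app (op n.unop)).hom
      (tm (stdMod.{u}.obj ⦋p⦌) (Tot ℓ V) (op n.unop) (bas α) f))
  rw [map_app_bas, ev_bas, ev_bas]
  exact f.2.2 ⦋p⦌ ⦋q⦌ n.unop γ ⟨α, inSk_of_le hp α⟩ (𝟙 _)

/-- A simplicial operator `β` acts on `Tot_ℓ V` by composition in the second variable, so evaluating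
`β^* f` at `(α, id)` gives `f(α, β)`. -/
lemma ev_shuf (ℓ : ℕ∞) (V : CSMod.{u}) {p : ℕ} (hp : (p : ℕ∞) ≤ ℓ) (q t : ℕ)
    (f : (Tot ℓ V).obj (op ⦋q⦌)) :
    ((ev ℓ V p hp).app (op ⦋t⦌)).hom
      (shuf (stdMod.{u}.obj ⦋p⦌) (Tot ℓ V) p q t (bas (𝟙 ⦋p⦌)) f) = evalWedge ℓ V hp q t f := by
  rw [shuf_apply, map_sum]
  refine Finset.sum_congr rfl fun x _ => ?_
  rw [map_bas, Category.comp_id]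
  refine (ev_bas ℓ V hp _ _).trans ?_
  exact congrArg (Subtype.val f ⦋p⦌ ⦋t⦌ ⟨x.1.1, inSk_of_le hp x.1.1⟩) (Category.id_comp x.1.2)

lemma phi_apply (ℓ : ℕ∞) (V : CSMod.{u}) (w : (N (Tot ℓ V)).carrier) {p : ℕ}
    (hp : (p : ℕ∞) ≤ ℓ) (t : ℕ) : (phi ℓ V w : ∀ p t, CObj (V.NV t) p) p t =
      toC V (act (ev ℓ V) iota w) p t := by
  rw [toC, act_apply (ev ℓ V) iota w hp, NMap_apply, nablaN_apply]
  change (if h : (p : ℕ∞) ≤ ℓ ∧ p ≤ t then phiComp ℓ V h.1 (Nat.add_sub_of_le h.2) ∘ₗ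
      LinearMap.proj (t - p) else 0 : _ →ₗ[ZMod 2] CObj (V.NV t) p) w = _
  by_cases ht : p ≤ t
  · obtain ⟨q, rfl⟩ : ∃ q, t = p + q := ⟨t - p, by omega⟩
    -- Since `iota p` lives in degree `p` alone, only one term of the shuffle product survives.
    rw [dif_pos ⟨hp, ht⟩, Finset.sum_eq_single (p, q)]
    · rw [iota, conc_self]
      -- Generalizing the degree to `q'` identifies `p + q - p` with `q` without rewriting inside
      -- dependent types.
      have key : ∀ (q' : ℕ) (h : p + q' = p + q), phiComp ℓ V hp h
          ((w : ∀ n, NObj (Tot ℓ V) n) q') = Submodule.Quotient.mk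
          (((NFun (p + q)).map (ev ℓ V p hp)).hom (nab (stdMod.{u}.obj ⦋p⦌) (Tot ℓ V) p q (p + q)
            (Submodule.Quotient.mk (bas (𝟙 ⦋p⦌))) ((w : ∀ n, NObj (Tot ℓ V) n) q))) := by
        intro q' h
        obtain rfl : q' = q := by omega
        obtain ⟨f, hf⟩ := Submodule.Quotient.mk_surjective _ ((w : ∀ n, NObj (Tot ℓ V) n) q')
        rw [← hf, nab_mk _ _ h]
        exact congrArg (fun x => Submodule.Quotient.mk (Submodule.Quotient.mk x))
          (ev_shuf ℓ V hp q' (p + q') f).symm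
      exact key _ (by omega)
    · rintro ⟨i, j⟩ hi hne
      have := Finset.HasAntidiagonal.mem_antidiagonal.1 hi
      dsimp only at this ⊢
      rw [iota, conc_ne _ _ (fun h => hne (Prod.ext h.symm (by dsimp only; omega))), map_zero,
        LinearMap.zero_apply]
    · exact fun h => absurd (Finset.HasAntidiagonal.mem_antidiagonal.2 (rfl : (p, q).1 + (p, q).2 = p + q)) h
  · rw [dif_neg (fun h => ht h.2), Finset.sum_eq_zero, map_zero]
    · rfl
    · rintro ⟨i, j⟩ hi
      have := Finset.HasAntidiagonal.mem_antidiagonal.1 hi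
      dsimp only at this ⊢
      rw [iota, conc_ne _ _ (by omega), map_zero, LinearMap.zero_apply]

lemma phi_eq_zero (ℓ : ℕ∞) (V : CSMod.{u}) (w : (N (Tot ℓ V)).carrier) {p t : ℕ}
    (h : ¬((p : ℕ∞) ≤ ℓ ∧ p ≤ t)) : (phi ℓ V w : ∀ p t, CObj (V.NV t) p) p t = 0 := by
  change (if h : (p : ℕ∞) ≤ ℓ ∧ p ≤ t then phiComp ℓ V h.1 (Nat.add_sub_of_le h.2) ∘ₗ
      LinearMap.proj (t - p) else 0 : _ →ₗ[ZMod 2] CObj (V.NV t) p) w = _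
  rw [dif_neg h]
  rfl

/-- In the Leibniz rule for the evaluation of `iota` against `x`, the term with `famD iota`
vanishes, which leaves the evaluation against `∂x`. -/
lemma phi_isChainMap (ℓ : ℕ∞) (V : CSMod.{u}) :
    IsChainMap (N (Tot ℓ V)) (T ℓ (CN V)) (phi ℓ V) where
  mem m x hx p t h := by
    by_cases h1 : (p : ℕ∞) ≤ ℓ ∧ p ≤ t
    · refine (dif_pos h1 (c := (p : ℕ∞) ≤ ℓ ∧ p ≤ t) |> fun e => LinearMap.congr_fun e x).trans ?_
      change phiComp ℓ V h1.1 (Nat.add_sub_of_le h1.2) ((x : ∀ n, NObj (Tot ℓ V) n) (t - p)) = 0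
      rw [hx (t - p) (fun e => h ⟨h1.1, by omega⟩), map_zero]
    · exact phi_eq_zero ℓ V x h1
  comm m x _ := by
    funext p t
    by_cases hp : (p : ℕ∞) ≤ ℓ
    · rw [phi_apply ℓ V _ hp, T_d_apply ℓ V (act (ev ℓ V) iota x) _
        (fun p hp t => phi_apply ℓ V x hp t) hp, toC, toC, famD_act _ (ev_naturality ℓ V) _ _ hp,
        famD_iota, map_zero, LinearMap.zero_apply, map_zero, zero_add, act_apply _ _ _ hp]
    · rw [phi_eq_zero ℓ V _ (fun h => hp h.1), T_d_eq_zero ℓ V _ hp]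

/-- By naturality a codegeneracy acts on the evaluation through `iota`, which it kills. -/
lemma isNorm_act_iota (ℓ : ℕ∞) (V : CSMod.{u}) (w : (N (Tot ℓ V)).carrier) {p : ℕ}
    (hp : (p : ℕ∞) ≤ ℓ) : IsNorm V p (act (ev ℓ V) iota w p) := fun t => by
  cases p with
  | zero => trivial
  | succ p =>
    refine mem_codegKer.2 fun i => ?_
    rw [act_apply _ _ _ hp]
    have h := NMap_map_ev (ev ℓ V) (ev_naturality ℓ V) hp (cast_le_of_le hp (Nat.le_succ p))
      (SimplexCategory.σ i) (iota (p + 1)) w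
    rw [NMap_σ_iota, map_zero, LinearMap.zero_apply, map_zero] at h
    exact congrFun h t

lemma rep_phi (ℓ : ℕ∞) (V : CSMod.{u}) (w : (N (Tot ℓ V)).carrier) {p : ℕ}
    (hp : (p : ℕ∞) ≤ ℓ) : rep V (phi ℓ V w) p = act (ev ℓ V) iota w p :=
  rep_eq (isNorm_act_iota ℓ V w hp) fun t => phi_apply ℓ V w hp t

lemma totProd_isPairing (ℓ : ℕ∞) (U V : CSMod.{u}) :
    IsPairing (N (Tot ℓ U)) (N (Tot ℓ V)) (N (Tot ℓ (U.tensor V))) (totProd ℓ U V) where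
  mem m n x y hx hy := NMap_mem _ (nablaN_mem _ _ hx hy)
  leibniz m n x y _ _ := by
    change (N (Tot ℓ (U.tensor V))).d (NMap (interchange ℓ U V) (nablaN _ _ x y)) =
      NMap (interchange ℓ U V) (nablaN _ _ _ y) + NMap (interchange ℓ U V) (nablaN _ _ x _)
    rw [← NMap_d, d_nablaN, map_add]

/-! ### Evaluation of tensor products -/

/-- The evaluation map `(F₂[Δ^p] ⊗ F₂[Δ^p]) ⊗ (Tot_ℓ U ⊗ Tot_ℓ V) → U^p ⊗ V^p`. -/
def evTens (ℓ : ℕ∞) (U V : CSMod.{u}) (p : ℕ) (hp : (p : ℕ∞) ≤ ℓ) :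
    tens ((stdMod.{u}.tensor stdMod).obj ⦋p⦌) (tens (Tot ℓ U) (Tot ℓ V)) ⟶
      (U.tensor V).obj ⦋p⦌ :=
  middle (stdMod.{u}.obj ⦋p⦌) (stdMod.{u}.obj ⦋p⦌) (Tot ℓ U) (Tot ℓ V) ≫
    tensMap (ev ℓ U p hp) (ev ℓ V p hp)

lemma evTens_naturality (ℓ : ℕ∞) (U V : CSMod.{u}) (p q : ℕ) (hp : (p : ℕ∞) ≤ ℓ)
    (hq : (q : ℕ∞) ≤ ℓ) (γ : ⦋p⦌ ⟶ ⦋q⦌) :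
    tensMap ((stdMod.{u}.tensor stdMod).map γ) (𝟙 (tens (Tot ℓ U) (Tot ℓ V))) ≫
      evTens ℓ U V q hq = evTens ℓ U V p hp ≫ (U.tensor V).map γ := by
  refine NatTrans.ext (funext fun n => ModuleCat.hom_ext (TensorProduct.ext_fourfold'
    fun x y f g => ?_))
  exact congrArg₂ (TensorProduct.tmul (ZMod 2))
    (ConcreteCategory.congr_hom (NatTrans.congr_app (ev_naturality ℓ U p q hp hq γ) n)
      (TensorProduct.tmul (ZMod 2) x f))
    (ConcreteCategory.congr_hom (NatTrans.congr_app (ev_naturality ℓ V p q hp hq γ) n)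
      (TensorProduct.tmul (ZMod 2) y g))

lemma evTens_nablaN (ℓ : ℕ∞) (U V : CSMod.{u}) {p : ℕ} (hp : (p : ℕ∞) ≤ ℓ)
    (a b : (N (stdMod.{u}.obj ⦋p⦌)).carrier) (x : (N (Tot ℓ U)).carrier)
    (y : (N (Tot ℓ V)).carrier) :
    NMap (evTens ℓ U V p hp) (nablaN _ _ (nablaN _ _ a b) (nablaN _ _ x y)) =
      nablaN _ _ (NMap (ev ℓ U p hp) (nablaN _ _ a x)) (NMap (ev ℓ V p hp) (nablaN _ _ b y)) := by
  rw [evTens, NMap_comp, middle_nablaN, NMap_nablaN]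

/-- Naturality of evaluation carries the front and back face operators over to the top simplices;
exchanging the middle factors then separates the simplices from the chains on `Tot`. -/
lemma aw_act (ℓ : ℕ∞) (U V : CSMod.{u}) {k k' p : ℕ} (h : k + k' = p) (hp : (p : ℕ∞) ≤ ℓ)
    (x : (N (Tot ℓ U)).carrier) (y : (N (Tot ℓ V)).carrier) :
    aw U V k k' p (act (ev ℓ U) iota x k) (act (ev ℓ V) iota y k') =
      NMap (evTens ℓ U V p hp) (nablaN _ _ (aw stdMod.{u} stdMod k k' p (iota k) (iota k'))
        (nablaN _ _ x y)) := by
  have hk := cast_le_of_le hp (show k ≤ p by omega)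
  have hk' := cast_le_of_le hp (show k' ≤ p by omega)
  rw [aw_apply U V h, aw_apply stdMod stdMod h, act_apply _ _ _ hk, act_apply _ _ _ hk',
    NMap_map_ev (ev ℓ U) (ev_naturality ℓ U) hk hp, NMap_map_ev (ev ℓ V) (ev_naturality ℓ V) hk' hp]
  exact (evTens_nablaN ℓ U V hp _ _ x y).symm

lemma conormProd_phi (ℓ : ℕ∞) (U V : CSMod.{u}) (x : (N (Tot ℓ U)).carrier)
    (y : (N (Tot ℓ V)).carrier) {p : ℕ} (hp : (p : ℕ∞) ≤ ℓ) (t : ℕ) :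
    (conormProd ℓ U V (phi ℓ U x) (phi ℓ V y) : ∀ p t, CObj ((U.tensor V).NV t) p) p t =
      toC (U.tensor V) (act (evTens ℓ U V) (star stdMod stdMod iota iota) (nablaN _ _ x y)) p t := by
  rw [conormProd_apply ℓ U V _ _ hp, toC, toC,
    star_congr U V (fun q hq => rep_phi ℓ U x (cast_le_of_le hp hq))
      (fun q hq => rep_phi ℓ V y (cast_le_of_le hp hq)), act_apply _ _ _ hp, star, star, map_sum,
    LinearMap.sum_apply, map_sum, Finset.sum_congr rfl fun i hi =>
      aw_act ℓ U V (Finset.HasAntidiagonal.mem_antidiagonal.1 hi) hp x y]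

/-- The diagonal `F₂[Δ^p]_n → F₂[Δ^p]_n ⊗ F₂[Δ^p]_n`. -/
def diagAt (n p : SimplexCategory) : (stdMod.{u}.obj p).obj (op n) →ₗ[ZMod 2]
    (tens (stdMod.{u}.obj p) (stdMod.{u}.obj p)).obj (op n) :=
  basLift fun α => tm (stdMod.{u}.obj p) (stdMod.{u}.obj p) (op n) (bas α) (bas α)

lemma diagAt_bas {n p : SimplexCategory} (α : n ⟶ p) : diagAt.{u} n p (bas α) =
    tm (stdMod.{u}.obj p) (stdMod.{u}.obj p) (op n) (bas α) (bas α) := basLift_bas _ _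

/-- The diagonal `F₂[Δ^•] → F₂[Δ^•] ⊗ F₂[Δ^•]`. -/
def diag : stdMod.{u} ⟶ stdMod.{u}.tensor stdMod where
  app p :=
    { app n := ModuleCat.ofHom (diagAt n.unop p)
      naturality n n' θ := by
        refine ModuleCat.hom_ext (stdMod_hom_ext fun α => ?_)
        change diagAt n'.unop p (((stdMod.{u}.obj p).map θ.unop.op).hom (bas α)) =
          ((tens (stdMod.{u}.obj p) (stdMod.{u}.obj p)).map θ).hom (diagAt n.unop p (bas α))
        rw [map_bas, diagAt_bas, diagAt_bas]
        exact congrArg₂ (fun a b => tm (stdMod.{u}.obj p) (stdMod.{u}.obj p) n' a b)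
          (map_bas θ.unop α).symm (map_bas θ.unop α).symm }
  naturality p p' γ := by
    refine NatTrans.ext (funext fun n => ModuleCat.hom_ext (stdMod_hom_ext fun α => ?_))
    change diagAt n.unop p' (((stdMod.{u}.map γ).app (op n.unop)).hom (bas α)) =
      (((stdMod.{u}.tensor stdMod).map γ).app n).hom (diagAt n.unop p (bas α))
    rw [map_app_bas, diagAt_bas, diagAt_bas]
    exact congrArg₂ (fun a b => tm (stdMod.{u}.obj p') (stdMod.{u}.obj p') n a b)
      (map_app_bas γ α).symm (map_app_bas γ α).symm

/-- The diagonals of the top simplices. -/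
def diagIota (p : ℕ) : (N ((stdMod.{u}.tensor stdMod).obj ⦋p⦌)).carrier :=
  NMap (diag.app ⦋p⦌) (iota p)

/-- The interchange map evaluates both factors at the same simplex, that is, on the diagonal: both
sides send `α ⊗ (f ⊗ g)` to `f(α, id) ⊗ g(α, id)`. -/
lemma interchange_ev (ℓ : ℕ∞) (U V : CSMod.{u}) {p : ℕ} (hp : (p : ℕ∞) ≤ ℓ) :
    tensMap (𝟙 (stdMod.{u}.obj ⦋p⦌)) (interchange ℓ U V) ≫ ev ℓ (U.tensor V) p hp =
      tensMap (diag.app ⦋p⦌) (𝟙 _) ≫ evTens ℓ U V p hp := by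
  refine NatTrans.ext (funext fun n => ModuleCat.hom_ext (TensorProduct.ext (stdMod_hom_ext
    fun α => TensorProduct.ext' fun (f : TotObj ℓ U n.unop) (g : TotObj ℓ V n.unop) => ?_)))
  change ((ev ℓ (U.tensor V) p hp).app (op n.unop)).hom
      (tm (stdMod.{u}.obj ⦋p⦌) (Tot ℓ (U.tensor V)) (op n.unop) (bas α)
        (((interchange ℓ U V).app n).hom (TensorProduct.tmul (ZMod 2) f g))) =
    ((evTens ℓ U V p hp).app n).hom (tm ((stdMod.{u}.tensor stdMod).obj ⦋p⦌)
      (tens (Tot ℓ U) (Tot ℓ V)) n (diagAt n.unop ⦋p⦌ (bas α)) (TensorProduct.tmul (ZMod 2) f g))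
  rw [diagAt_bas]
  refine (ev_bas ℓ (U.tensor V) hp α _).trans ?_
  exact congrArg₂ (TensorProduct.tmul (ZMod 2)) (ev_bas ℓ U hp α f).symm (ev_bas ℓ V hp α g).symm

lemma phi_totProd (ℓ : ℕ∞) (U V : CSMod.{u}) (x : (N (Tot ℓ U)).carrier)
    (y : (N (Tot ℓ V)).carrier) {p : ℕ} (hp : (p : ℕ∞) ≤ ℓ) (t : ℕ) :
    (phi ℓ (U.tensor V) (totProd ℓ U V x y) : ∀ p t, CObj ((U.tensor V).NV t) p) p t =
      toC (U.tensor V) (act (evTens ℓ U V) diagIota (nablaN _ _ x y)) p t := by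
  rw [phi_apply ℓ _ _ hp, toC, toC, act_apply _ _ _ hp, act_apply _ _ _ hp]
  have h : NMap (ev ℓ (U.tensor V) p hp) (nablaN _ _ (iota p)
      (NMap (interchange ℓ U V) (nablaN _ _ x y))) =
      NMap (evTens ℓ U V p hp) (nablaN _ _ (diagIota p) (nablaN _ _ x y)) := by
    rw [← NMap_id _ (iota p), ← NMap_nablaN, ← NMap_comp, interchange_ev, NMap_comp, NMap_nablaN,
      NMap_id, diagIota]
  exact congrArg (fun z : ∀ n, NObj _ n => Submodule.Quotient.mk (z t)) h

/-! ### Acyclicity of `F₂[Δ^p] ⊗ F₂[Δ^p]` -/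

/-- A cone operator on a simplicial module shows that the normalized complex is exact in positive
degrees. -/
lemma exists_Nd_eq {A : SMod.{u}}
    (S : ∀ n : ℕ, A.obj (op ⦋n⦌) →ₗ[ZMod 2] A.obj (op ⦋n + 1⦌))
    (h₀ : ∀ n x, (A.map (SimplexCategory.δ 0).op).hom (S n x) = x)
    (hδ : ∀ n (i : Fin (n + 2)) x, (A.map (SimplexCategory.δ i.succ).op).hom (S (n + 1) x) =
      S n ((A.map (SimplexCategory.δ i).op).hom x))
    (hσ : ∀ n (i : Fin (n + 1)) x, S (n + 1) ((A.map (SimplexCategory.σ i).op).hom x) =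
      (A.map (SimplexCategory.σ i.succ).op).hom (S n x))
    {n : ℕ} {z : NObj A (n + 1)} (hz : Nd A n z = 0) : ∃ y, Nd A (n + 1) y = z := by
  obtain ⟨a, rfl⟩ := Submodule.Quotient.mk_surjective _ z
  rw [Nd_mk, Submodule.Quotient.mk_eq_zero] at hz
  refine ⟨Submodule.Quotient.mk (S (n + 1) a), ?_⟩
  -- The zeroth face gives back `a`, and the other faces pass through `S`: the cone is a contraction
  -- in positive degrees.
  have h : bdry A (n + 1) (S (n + 1) a) = a + S n (bdry A n a) := by
    rw [bdry_eq_sum, bdry_eq_sum, Fin.sum_univ_succ, h₀, map_sum]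
    congr 1
    exact Finset.sum_congr rfl fun i _ => hδ n i a
  have hS : S n (bdry A n a) ∈ degen A (n + 1) := by
    cases n with
    | zero =>
      have : bdry A 0 a = 0 := hz
      rw [this, map_zero]
      exact zero_mem _
    | succ n =>
      have hle : degen A (n + 1) ≤ (degen A (n + 2)).comap (S (n + 1)) := degen_le fun k x => by
        rw [Submodule.mem_comap, hσ]
        exact σ_mem_degen A _ _
      exact hle hz
  rw [Nd_mk, h, Submodule.Quotient.mk_add, (Submodule.Quotient.mk_eq_zero _).2 hS, add_zero]

/-- The simplex of `Δ^p` spanned by the vertex `0` and `α`. -/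
def cone {n p : ℕ} (α : ⦋n⦌ ⟶ ⦋p⦌) : ⦋n + 1⦌ ⟶ ⦋p⦌ :=
  SimplexCategory.mkHom ⟨fun i => ⟨if (i : ℕ) = 0 then 0 else val α (i - 1), by
    have := val_le α (i - 1)
    split_ifs <;> omega⟩, fun i j hij => by
      have h : (i : ℕ) ≤ j := hij
      have := val_mono α (Nat.sub_le_sub_right h 1)
      simp only [Fin.mk_le_mk]
      split_ifs <;> omega⟩

lemma val_cone {n p : ℕ} (α : ⦋n⦌ ⟶ ⦋p⦌) {l : ℕ} (hl : l ≤ n + 1) :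
    val (cone α) l = if l = 0 then 0 else val α (l - 1) := by
  change (if min l (n + 1) = 0 then 0 else val α (min l (n + 1) - 1)) = _
  rw [min_eq_left hl]

lemma δ_zero_cone {n p : ℕ} (α : ⦋n⦌ ⟶ ⦋p⦌) : SimplexCategory.δ 0 ≫ cone α = α :=
  val_ext fun l hl => by
    rw [val_comp, val_cone _ (val_le _ _), val_δ _ hl, Fin.val_zero, if_neg (Nat.not_lt_zero l),
      if_neg (Nat.succ_ne_zero l), Nat.add_sub_cancel]

lemma δ_succ_cone {n p : ℕ} (i : Fin (n + 2)) (α : ⦋n + 1⦌ ⟶ ⦋p⦌) :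
    SimplexCategory.δ i.succ ≫ cone α = cone (SimplexCategory.δ i ≫ α) :=
  val_ext fun l hl => by
    rw [val_comp, val_cone _ (val_le _ _), val_δ _ hl, val_cone _ hl, val_comp, Fin.val_succ]
    rcases Nat.eq_zero_or_pos l with rfl | h
    · simp
    · have h' : ¬(if l < (i : ℕ) + 1 then l else l + 1) = 0 := by
        split_ifs
        exacts [h.ne', not_false]
      rw [val_δ _ (by omega), if_neg h', if_neg h.ne']
      congr 1
      split_ifs <;> omega

lemma σ_succ_cone {n p : ℕ} (i : Fin (n + 1)) (α : ⦋n⦌ ⟶ ⦋p⦌) :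
    SimplexCategory.σ i.succ ≫ cone α = cone (SimplexCategory.σ i ≫ α) :=
  val_ext fun l hl => by
    rw [val_comp, val_cone _ (val_le _ _), val_σ _ hl, val_cone _ hl, val_comp, Fin.val_succ]
    rcases Nat.eq_zero_or_pos l with rfl | h
    · simp
    · rw [val_σ _ (by omega), if_neg (by split_ifs <;> omega), if_neg h.ne']
      congr 1
      split_ifs <;> omega

/-- The cone operator on `F₂[Δ^p]`. -/
def coneMap (n p : ℕ) : (stdMod.{u}.obj ⦋p⦌).obj (op ⦋n⦌) →ₗ[ZMod 2]
    (stdMod.{u}.obj ⦋p⦌).obj (op ⦋n + 1⦌) := basLift fun α => bas (cone α)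

lemma coneMap_bas {n p : ℕ} (α : ⦋n⦌ ⟶ ⦋p⦌) : coneMap.{u} n p (bas α) = bas (cone α) :=
  basLift_bas _ _

lemma δ_zero_coneMap (n p : ℕ) (x : (stdMod.{u}.obj ⦋p⦌).obj (op ⦋n⦌)) :
    ((stdMod.{u}.obj ⦋p⦌).map (SimplexCategory.δ 0).op).hom (coneMap n p x) = x := by
  have h : ((stdMod.{u}.obj ⦋p⦌).map (SimplexCategory.δ 0).op).hom ∘ₗ coneMap n p =
      LinearMap.id := stdMod_hom_ext fun α => by
    rw [LinearMap.comp_apply, coneMap_bas, map_bas, δ_zero_cone]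
    rfl
  exact LinearMap.congr_fun h x

lemma δ_succ_coneMap (n p : ℕ) (i : Fin (n + 2)) (x : (stdMod.{u}.obj ⦋p⦌).obj (op ⦋n + 1⦌)) :
    ((stdMod.{u}.obj ⦋p⦌).map (SimplexCategory.δ i.succ).op).hom (coneMap (n + 1) p x) =
      coneMap n p (((stdMod.{u}.obj ⦋p⦌).map (SimplexCategory.δ i).op).hom x) := by
  have h : ((stdMod.{u}.obj ⦋p⦌).map (SimplexCategory.δ i.succ).op).hom ∘ₗ coneMap (n + 1) p =
      coneMap n p ∘ₗ ((stdMod.{u}.obj ⦋p⦌).map (SimplexCategory.δ i).op).hom :=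
    stdMod_hom_ext fun α => by
      rw [LinearMap.comp_apply, LinearMap.comp_apply, coneMap_bas, map_bas, map_bas, coneMap_bas,
        δ_succ_cone]
  exact LinearMap.congr_fun h x

lemma σ_succ_coneMap (n p : ℕ) (i : Fin (n + 1)) (x : (stdMod.{u}.obj ⦋p⦌).obj (op ⦋n⦌)) :
    coneMap (n + 1) p (((stdMod.{u}.obj ⦋p⦌).map (SimplexCategory.σ i).op).hom x) =
      ((stdMod.{u}.obj ⦋p⦌).map (SimplexCategory.σ i.succ).op).hom (coneMap n p x) := by
  have h : coneMap (n + 1) p ∘ₗ ((stdMod.{u}.obj ⦋p⦌).map (SimplexCategory.σ i).op).hom =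
      ((stdMod.{u}.obj ⦋p⦌).map (SimplexCategory.σ i.succ).op).hom ∘ₗ coneMap n p :=
    stdMod_hom_ext fun α => by
      rw [LinearMap.comp_apply, LinearMap.comp_apply, coneMap_bas, map_bas, map_bas, coneMap_bas,
        σ_succ_cone]
  exact LinearMap.congr_fun h x

/-- The cone identities are compatible with levelwise tensor products, so coning both factors at
once is again a cone operator. -/
lemma stdMod_tensor_exact (p : ℕ) {n : ℕ} {z : NObj ((stdMod.{u}.tensor stdMod).obj ⦋p⦌) (n + 1)}
    (hz : Nd ((stdMod.{u}.tensor stdMod).obj ⦋p⦌) n z = 0) :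
    ∃ y, Nd ((stdMod.{u}.tensor stdMod).obj ⦋p⦌) (n + 1) y = z := by
  refine exists_Nd_eq (fun n => TensorProduct.map (coneMap n p) (coneMap n p)) (fun n x => ?_)
    (fun n i x => ?_) (fun n i x => ?_) hz
  · refine LinearMap.congr_fun (f := (((stdMod.{u}.tensor stdMod).obj ⦋p⦌).map
      (SimplexCategory.δ 0).op).hom ∘ₗ TensorProduct.map (coneMap n p) (coneMap n p))
      (g := LinearMap.id) (TensorProduct.ext' fun x y => ?_) x
    exact congrArg₂ (TensorProduct.tmul (ZMod 2)) (δ_zero_coneMap n p x) (δ_zero_coneMap n p y)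
  · refine LinearMap.congr_fun (f := (((stdMod.{u}.tensor stdMod).obj ⦋p⦌).map
      (SimplexCategory.δ i.succ).op).hom ∘ₗ TensorProduct.map (coneMap (n + 1) p)
        (coneMap (n + 1) p)) (g := TensorProduct.map (coneMap n p) (coneMap n p) ∘ₗ
        (((stdMod.{u}.tensor stdMod).obj ⦋p⦌).map (SimplexCategory.δ i).op).hom)
      (TensorProduct.ext' fun x y => ?_) x
    exact congrArg₂ (TensorProduct.tmul (ZMod 2)) (δ_succ_coneMap n p i x) (δ_succ_coneMap n p i y)
  · refine LinearMap.congr_fun (f := TensorProduct.map (coneMap (n + 1) p) (coneMap (n + 1) p) ∘ₗ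
        (((stdMod.{u}.tensor stdMod).obj ⦋p⦌).map (SimplexCategory.σ i).op).hom)
      (g := (((stdMod.{u}.tensor stdMod).obj ⦋p⦌).map
      (SimplexCategory.σ i.succ).op).hom ∘ₗ TensorProduct.map (coneMap n p) (coneMap n p))
      (TensorProduct.ext' fun x y => ?_) x
    exact congrArg₂ (TensorProduct.tmul (ZMod 2)) (σ_succ_coneMap n p i x) (σ_succ_coneMap n p i y)

/-! ### The homotopy between the diagonal and the Alexander–Whitney diagonal -/

lemma codiff_mem {V : CSMod.{u}} {p : ℕ} {m : ℤ} {x : (N (V.obj ⦋p⦌)).carrier}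
    (hx : x ∈ (N (V.obj ⦋p⦌)).deg m) : codiff V p x ∈ (N (V.obj ⦋p + 1⦌)).deg m :=
  Submodule.sum_mem _ fun _ _ => NMap_mem _ hx

lemma codiff_add (V : CSMod.{u}) (p : ℕ) (x y : (N (V.obj ⦋p⦌)).carrier) :
    codiff V p (x + y) = codiff V p x + codiff V p y := by
  simp_rw [codiff, map_add]
  exact Finset.sum_add_distrib

lemma codiff_zero (V : CSMod.{u}) (p : ℕ) : codiff V p 0 = 0 := by
  simp_rw [codiff, map_zero]
  exact Finset.sum_const_zero

lemma codiff_d (V : CSMod.{u}) (p : ℕ) (x : (N (V.obj ⦋p⦌)).carrier) :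
    (N (V.obj ⦋p + 1⦌)).d (codiff V p x) = codiff V p ((N (V.obj ⦋p⦌)).d x) := by
  rw [codiff, codiff, map_sum]
  exact Finset.sum_congr rfl fun i _ => (NMap_d _ _).symm

lemma codiff_codiff (V : CSMod.{u}) (p : ℕ) (x : (N (V.obj ⦋p⦌)).carrier) :
    codiff V (p + 1) (codiff V p x) = 0 := funext fun t => by
  rw [codiff_apply, codiff_apply]
  exact cobdry_cobdry _ _ _

lemma codiff_prevD (V : CSMod.{u}) (X : ∀ p, (N (V.obj ⦋p⦌)).carrier) (p : ℕ) :
    codiff V p (prevD V X p) = 0 := by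
  cases p with
  | zero => exact codiff_zero V 0
  | succ p => exact codiff_codiff V p _

/-- The family `h` is built by induction: `h_{p+1}` bounds `c_{p+1} + ∑ d^i h_p`, which is a cycle
of positive degree. Exactness says nothing in degree zero, which is why `c 0 = 0` is required and
`h_0 = 0` is taken. -/
lemma exists_famD_eq {W : CSMod.{u}}
    (hW : ∀ (p n : ℕ) (z : NObj (W.obj ⦋p⦌) (n + 1)), Nd (W.obj ⦋p⦌) n z = 0 →
      ∃ y, Nd (W.obj ⦋p⦌) (n + 1) y = z) (c : ∀ p, (N (W.obj ⦋p⦌)).carrier)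
    (hc : ∀ p, famD W c p = 0) (hdeg : ∀ p : ℕ, c p ∈ (N (W.obj ⦋p⦌)).deg p) (hc₀ : c 0 = 0) :
    ∃ h : ∀ p, (N (W.obj ⦋p⦌)).carrier,
      (∀ p : ℕ, h p ∈ (N (W.obj ⦋p⦌)).deg (p + 1)) ∧ ∀ p, famD W h p = c p := by
  -- The conditions stand behind the existential so that a choice function exists for every `z`,
  -- with value `0` where it is irrelevant; the recursion can then be defined before its invariants
  -- are proved.
  have step : ∀ (p : ℕ) (z : (N (W.obj ⦋p⦌)).carrier), ∃ y, z ∈ (N (W.obj ⦋p⦌)).deg p →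
      0 < p → (N (W.obj ⦋p⦌)).d z = 0 →
        y ∈ (N (W.obj ⦋p⦌)).deg (p + 1) ∧ (N (W.obj ⦋p⦌)).d y = z := by
    intro p z
    by_cases hp : 0 < p
    · obtain ⟨p, rfl⟩ : ∃ p', p = p' + 1 := ⟨p - 1, by omega⟩
      by_cases hz : (N (W.obj ⦋p + 1⦌)).d z = 0
      · obtain ⟨y, hy⟩ := hW (p + 1) p _ (congrFun hz p)
        refine ⟨conc _ (p + 2) y, fun h _ _ => ⟨?_, ?_⟩⟩
        · have := conc_mem _ (p + 2) y
          exact_mod_cast this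
        · rw [d_conc, hy]
          exact (eq_conc h).symm
      · exact ⟨0, fun _ _ h => absurd h hz⟩
    · exact ⟨0, fun _ h => absurd h hp⟩
  choose g hg using step
  let h : ∀ p, (N (W.obj ⦋p⦌)).carrier := fun p =>
    Nat.rec 0 (fun p x => g (p + 1) (c (p + 1) + codiff W p x)) p
  have key : ∀ p, h p ∈ (N (W.obj ⦋p⦌)).deg (p + 1) ∧ famD W h p = c p := by
    intro p
    induction p with
    | zero =>
      refine ⟨zero_mem _, ?_⟩
      rw [hc₀]
      change (N (W.obj ⦋0⦌)).d 0 + 0 = 0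
      rw [map_zero, add_zero]
    | succ p ih =>
      obtain ⟨h1, h2⟩ := ih
      have e1 : (N (W.obj ⦋p + 1⦌)).d (c (p + 1)) = codiff W p (c p) := by
        have := hc (p + 1)
        change _ + codiff W p (c p) = 0 at this
        exact (add_eq_zero_iff_eq_neg.1 this).trans (ZModModule.neg_eq_self _)
      -- Both summands have boundary `∑ d^i c_p`: the first since `c` is a total cycle, the second
      -- since `∂h_p` differs from `c_p` by a cosimplicial boundary, which `codiff` kills.
      have e2 : (N (W.obj ⦋p + 1⦌)).d (c (p + 1) + codiff W p (h p)) = 0 := by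
        rw [map_add, codiff_d, e1, ← h2, famD, codiff_add, codiff_prevD, add_zero]
        exact ZModModule.add_self _
      obtain ⟨e3, e4⟩ := hg (p + 1) (c (p + 1) + codiff W p (h p))
        (add_mem (hdeg (p + 1)) (by exact_mod_cast codiff_mem h1)) (Nat.succ_pos p) e2
      refine ⟨e3, ?_⟩
      change (N (W.obj ⦋p + 1⦌)).d (g (p + 1) (c (p + 1) + codiff W p (h p))) +
        codiff W p (h p) = _
      rw [e4, add_assoc, ZModModule.add_self, add_zero]
  exact ⟨h, fun p => (key p).1, fun p => (key p).2⟩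

lemma famD_add (V : CSMod.{u}) (X Y : ∀ p, (N (V.obj ⦋p⦌)).carrier) (p : ℕ) :
    famD V (X + Y) p = famD V X p + famD V Y p := by
  have h : prevD V (X + Y) p = prevD V X p + prevD V Y p := by
    cases p with
    | zero => exact (add_zero _).symm
    | succ p => exact codiff_add V p _ _
  rw [famD, h, Pi.add_apply, map_add]
  exact add_add_add_comm _ _ _ _

lemma famD_NMap {V W : CSMod.{u}} (F : V ⟶ W) (X : ∀ p, (N (V.obj ⦋p⦌)).carrier) (p : ℕ) :
    famD W (fun p => NMap (F.app ⦋p⦌) (X p)) p = NMap (F.app ⦋p⦌) (famD V X p) := by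
  have h : prevD W (fun p => NMap (F.app ⦋p⦌) (X p)) p = NMap (F.app ⦋p⦌) (prevD V X p) := by
    cases p with
    | zero => exact (map_zero _).symm
    | succ p =>
      change codiff W p _ = NMap _ (codiff V p (X p))
      rw [codiff, codiff, map_sum]
      refine Finset.sum_congr rfl fun i _ => ?_
      rw [← NMap_comp, ← NMap_comp, F.naturality]
  rw [famD, h, ← NMap_d, famD, map_add]

lemma famD_diagIota (p : ℕ) : famD _ diagIota.{u} p = 0 := by
  refine (famD_NMap diag iota p).trans ?_
  rw [famD_iota, map_zero]

lemma famD_star_iota (p : ℕ) : famD _ (star stdMod.{u} stdMod iota iota) p = 0 := by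
  have h1 : star stdMod.{u} stdMod (famD stdMod iota) iota p = 0 :=
    Finset.sum_eq_zero fun i _ => by rw [famD_iota, map_zero, LinearMap.zero_apply]
  have h2 : star stdMod.{u} stdMod iota (famD stdMod iota) p = 0 :=
    Finset.sum_eq_zero fun i _ => by rw [famD_iota, map_zero]
  rw [famD_star, h1, h2, add_zero]

lemma iota_mem (p : ℕ) : iota.{u} p ∈ (N _).deg p := conc_mem _ _ _

lemma star_iota_mem (p : ℕ) : star stdMod.{u} stdMod iota iota p ∈ (N _).deg p := by
  refine Submodule.sum_mem _ fun i hi => ?_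
  have h := Finset.HasAntidiagonal.mem_antidiagonal.1 hi
  rw [aw_apply _ _ h]
  have := nablaN_mem _ _
    (NMap_mem (stdMod.{u}.map (SimplexCategory.subinterval 0 i.1 (show 0 + i.1 ≤ p by omega)))
      (iota_mem i.1))
    (NMap_mem (stdMod.{u}.map (SimplexCategory.subinterval i.1 i.2 (show i.1 + i.2 ≤ p by omega)))
      (iota_mem i.2))
  rwa [show ((i.1 : ℤ) + i.2) = p by exact_mod_cast h] at this

/-- In degree zero there is a single `(0,0)`-shuffle and `Δ^0` has a single vertex, so both chains
are that vertex tensored with itself. -/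
lemma star_iota_zero : star stdMod.{u} stdMod iota iota 0 = diagIota 0 := by
  refine (eq_conc (star_iota_mem 0)).trans (Eq.trans ?_ (NMap_conc _ _ _).symm)
  refine congrArg (conc _ 0) ?_
  rw [star, Finset.Nat.antidiagonal_zero, Finset.sum_singleton,
    aw_apply stdMod stdMod (zero_add 0), nablaN_apply,
    Finset.Nat.antidiagonal_zero, Finset.sum_singleton, NMap_iota, conc_self, nab_mk _ _ (zero_add 0), shuf_apply]
  let x₀ : Shuf 0 0 0 := ⟨(𝟙 _, 𝟙 _), fun i => by
    obtain rfl : i = 0 := Subsingleton.elim (α := Fin 1) _ _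
    rfl⟩
  rw [Fintype.sum_eq_single x₀ fun x hx => absurd (Subtype.ext (Subsingleton.elim _ _)) hx]
  refine congrArg Submodule.Quotient.mk ?_
  refine Eq.trans ?_ (diagAt_bas (𝟙 ⦋0⦌)).symm
  rw [map_bas]
  exact congrArg₂ (fun a b => tm (stdMod.{u}.obj ⦋0⦌) (stdMod.{u}.obj ⦋0⦌) (op ⦋0⦌) (bas a) (bas b))
    (Subsingleton.elim _ _) (Subsingleton.elim _ _)

/-- The diagonal and the Alexander–Whitney diagonal are total cycles that agree on vertices, so
acyclicity makes them homotopic, compatibly with cofaces. -/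
lemma exists_homotopy : ∃ h : ∀ p, (N ((stdMod.{u}.tensor stdMod).obj ⦋p⦌)).carrier,
    (∀ p : ℕ, h p ∈ (N _).deg (p + 1)) ∧
      ∀ p, famD _ h p = star stdMod stdMod iota iota p + diagIota p := by
  refine exists_famD_eq (W := stdMod.tensor stdMod) (fun p n z => stdMod_tensor_exact p)
    (star stdMod stdMod iota iota + diagIota) (fun p => ?_) (fun p => ?_) ?_
  · rw [famD_add, famD_star_iota, famD_diagIota, add_zero]
  · exact add_mem (star_iota_mem p) (NMap_mem _ (iota_mem p))
  · rw [Pi.add_apply, star_iota_zero]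
    exact ZModModule.add_self _

/-- On cycles, the two products agree up to a boundary. -/
lemma phi_totProd_sub (ℓ : ℕ∞) (U V : CSMod.{u}) {m n : ℤ} {x : (N (Tot ℓ U)).carrier}
    {y : (N (Tot ℓ V)).carrier} (hx : x ∈ (N (Tot ℓ U)).cycles m)
    (hy : y ∈ (N (Tot ℓ V)).cycles n) :
    ∃ z ∈ (T ℓ (CN (U.tensor V))).deg (m + n + 1), (T ℓ (CN (U.tensor V))).d z =
      phi ℓ (U.tensor V) (totProd ℓ U V x y) + conormProd ℓ U V (phi ℓ U x) (phi ℓ V y) := by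
  obtain ⟨h, hdeg, hD⟩ := exists_homotopy.{u}
  have hdx : (N (Tot ℓ U)).d x = 0 := hx.2
  have hdy : (N (Tot ℓ V)).d y = 0 := hy.2
  have hw := nablaN_mem _ _ hx.1 hy.1
  have hdw : (N (tens (Tot ℓ U) (Tot ℓ V))).d (nablaN _ _ x y) = 0 := by
    rw [d_nablaN, hdx, hdy, map_zero, map_zero, LinearMap.zero_apply, add_zero]
  set w := nablaN (Tot ℓ U) (Tot ℓ V) x y
  -- The bounding chain evaluates the universal homotopy against `w = ∇(x ⊗ y)`. As `w` is a cycle,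
  -- its differential is the evaluation of `famD h`, which is the sum of the two diagonals.
  refine ⟨fun p t => toC (U.tensor V) (act (evTens ℓ U V) h w) p t, fun p t hpt => ?_, ?_⟩
  · by_cases hp : (p : ℕ∞) ≤ ℓ
    · change toC (U.tensor V) (act (evTens ℓ U V) h w) p t = 0
      rw [toC, act_apply _ _ _ hp]
      have := NMap_mem (evTens ℓ U V p hp) (nablaN_mem _ _ (hdeg p) hw)
      rw [this t fun e => hpt ⟨hp, by omega⟩]
      rfl
    · change toC (U.tensor V) (act (evTens ℓ U V) h w) p t = 0
      rw [toC, act, dif_neg hp]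
      rfl
  · funext p t
    by_cases hp : (p : ℕ∞) ≤ ℓ
    · rw [T_d_apply ℓ (U.tensor V) (act (evTens ℓ U V) h w) _ (fun _ _ _ => rfl) hp]
      change _ = (phi ℓ (U.tensor V) _ : ∀ p t, CObj ((U.tensor V).NV t) p) p t +
        (conormProd ℓ U V _ _ : ∀ p t, CObj ((U.tensor V).NV t) p) p t
      rw [phi_totProd ℓ U V x y hp, conormProd_phi ℓ U V x y hp, toC, toC, toC,
        famD_act _ (evTens_naturality ℓ U V) _ _ hp, hdw, map_zero, map_zero, add_zero, hD, map_add,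
        LinearMap.add_apply, map_add, act_apply _ _ _ hp, act_apply _ _ _ hp, add_comm]
      rfl
    · rw [T_d_eq_zero ℓ _ _ hp]
      change _ = (phi ℓ (U.tensor V) _ : ∀ p t, CObj ((U.tensor V).NV t) p) p t +
        (conormProd ℓ U V _ _ : ∀ p t, CObj ((U.tensor V).NV t) p) p t
      rw [phi_eq_zero ℓ _ _ fun e => hp e.1, conormProd_eq_zero ℓ U V _ _ hp, add_zero]

end TotProd

end

theorem theoremT (ℓ : ℕ∞) (U V : TotProd.CSMod.{u}) :
    ∃ (hφ : ∀ W : TotProd.CSMod.{u},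
          TotProd.IsChainMap (TotProd.N (TotProd.Tot ℓ W)) (TotProd.T ℓ (TotProd.CN W))
            (TotProd.phi ℓ W))
      (hP : TotProd.IsPairing (TotProd.N (TotProd.Tot ℓ U)) (TotProd.N (TotProd.Tot ℓ V))
          (TotProd.N (TotProd.Tot ℓ (U.tensor V))) (TotProd.totProd ℓ U V))
      (hQ : TotProd.IsPairing (TotProd.T ℓ (TotProd.CN U)) (TotProd.T ℓ (TotProd.CN V))
          (TotProd.T ℓ (TotProd.CN (U.tensor V))) (TotProd.conormProd ℓ U V)),
      ∀ m n : ℤ,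
        (hφ (U.tensor V)).onH (m + n) ∘ₗ TensorProduct.lift (hP.onH m n) =
          TensorProduct.lift (hQ.onH m n) ∘ₗ
            TensorProduct.map ((hφ U).onH m) ((hφ V).onH n) := by
  refine ⟨TotProd.phi_isChainMap ℓ, TotProd.totProd_isPairing ℓ U V,
    TotProd.conormProd_isPairing ℓ U V, fun m n => TensorProduct.ext' fun x y => ?_⟩
  obtain ⟨⟨x, hx⟩, rfl⟩ := Submodule.Quotient.mk_surjective _ x
  obtain ⟨⟨y, hy⟩, rfl⟩ := Submodule.Quotient.mk_surjective _ y
  obtain ⟨z, hz, hdz⟩ := TotProd.phi_totProd_sub ℓ U V hx hy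
  refine (Submodule.Quotient.eq _).2 ⟨z, hz, ?_⟩
  rw [hdz]
  -- The bounded chain is the sum of the two composites, which is their difference modulo 2.
  refine (congrArg _ (ZModModule.neg_eq_self _).symm).trans (sub_eq_add_neg _ _).symm
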